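/- Let $d\ge 1$, $X=[0,1]^d$, and let $M\subset X$ be a $(d-1)$-dimensional topological manifold (possibly with boundary) cutting $X$ into two parts: $X\setminus M$ is the disjoint union of two nonempty, relatively open sets, labelled $-1$ and $+1$, and every point of $M$ is adherent to both of them. Consider the regular grid of $n_G^d$ points on $X$, $n_G\ge 2$, with mesh size $\varepsilon=\frac1{n_G-1}$, and suppose that no grid point lies on $M$. *Boundary points.* On each edge of the grid cubes (resp. of the Kuhn simplices of the grid cubes) whose end points $v_-,v_+$ are labelled $-1$ and $+1$, a boundary point is computed by $q$ dichotomies: starting from $(p_-,p_+)=(v_-,v_+)$, replace $q$ times $p_+$ by the midpoint $m$ of $[p_-,p_+]$ if $m$ is labelled $+1$, and $p_-$ by $m$ otherwise; the boundary point is the midpoint of the final segment $[p_-,p_+]$. For a face $F$ of a cube (resp. Kuhn simplex), let $B_M(F)$ be the set of boundary points on the edges of $F$, and $\bar B_M(F)$ its barycentre. *Resistars.* The resistar in a cube (resp. Kuhn simplex) $C$ is the union, over all flags $F_1\subset F_2\subset\dots\subset F_d=C$ of faces of $C$ with $\dim F_i=i$ and $B_M(F_1)\ne\emptyset$, of the simplices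 $\mathrm{conv}\{\bar B_M(F_1),\dots,\bar B_M(F_d)\}$. The resistar approximation of $M$ in cubes (resp. in Kuhn simplices) is the union of the resistars in all cubes (resp. all Kuhn simplices) of the grid. The *reach* of a set $S\subset\mathbb R^d$ is the supremum of all $\rho$ such that every point at distance less than $\rho$ from $S$ has exactly one nearest point in $S$ (it is $+\infty$ if $S=\emptyset$). **Theorem.** Suppose that $M$ has reach $r>\sqrt2\,d\,\varepsilon$, that for every face $F$ of $X$ of dimension $i\ge1$ the trace $M\cap F$ is an $(i-1)$-dimensional topological manifold (possibly with boundary, possibly empty) of reach $r_F>\sqrt2\,i\,\varepsilon$, and that $q\ge-\log_2\varepsilon$. Then the Hausdorff distance between $M$ and its resistar approximation, in cubes as well as in Kuhn simplices, is $\mathcal O(d\,\varepsilon^2)$. Precisely: for every $r_0>0$ there is a constant $C$, depending only on $r_0$ (not on $d$, $M$, $n_G$ or $q$), such that both Hausdorff distances are at most $C\,d\,\varepsilon^2$ whenever, in addition, $r\ge r_0$ and $r_F\ge r_0$ for all these faces $F$. -/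

import Mathlib

noncomputable section

/-! ### Reach, manifolds, the unit cube -/

/-- The reach of a set `S` (Federer): the supremum of all `ρ` such that every point at distance
less than `ρ` from `S` has exactly one nearest point in `S`. It is `⊤` for the empty set and for
closed convex sets. -/
def reach {d : ℕ} (S : Set (EuclideanSpace ℝ (Fin d))) : ENNReal :=
  sSup {ρ : ENNReal | ∀ x, Metric.infEDist x S < ρ →
    ∃! y, y ∈ S ∧ edist x y = Metric.infEDist x S}

/-- `S` is an `n`-dimensional topological manifold, possibly with boundary. The local model is the
quadrant `{x ∈ ℝⁿ | 0 ≤ x}`, which topologically is a half-space (a point if `n = 0`); hence traces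
of hypersurfaces on a cube, which may have corners, are allowed. The empty set is allowed. -/
def IsTopManifold {d : ℕ} (n : ℕ) (S : Set (EuclideanSpace ℝ (Fin d))) : Prop :=
  Nonempty (ChartedSpace (EuclideanQuadrant n) S)

/-- The cube `X = [0,1]^d`. -/
def unitCube (d : ℕ) : Set (EuclideanSpace ℝ (Fin d)) :=
  {x | ∀ j, 0 ≤ x j ∧ x j ≤ 1}

/-- `F` is an `i`-dimensional face of `[0,1]^d`: the coordinates in `J` are free, the other ones are
fixed to `0` or `1`. -/
def IsFaceOfUnitCube {d : ℕ} (i : ℕ) (F : Set (EuclideanSpace ℝ (Fin d))) : Prop :=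
  ∃ (J : Finset (Fin d)) (a : Fin d → ℝ), J.card = i ∧ (∀ j, a j = 0 ∨ a j = 1) ∧
    F = {x | x ∈ unitCube d ∧ ∀ j, j ∉ J → x j = a j}

/-- `M` cuts `X = [0,1]^d` into two parts, labelled `-1` and `+1` by the function `lab`
(only its values on `X` matter): `lab` vanishes exactly on `M`, the two parts are nonempty and
relatively open in `X`, and `M` is the interface of the two parts, that is, each of its points is
adherent to both. The parts need not be connected. -/
structure Splits {d : ℕ} (M : Set (EuclideanSpace ℝ (Fin d)))
    (lab : EuclideanSpace ℝ (Fin d) → SignType) : Prop where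
  subset : M ⊆ unitCube d
  zero_iff : ∀ x ∈ unitCube d, lab x = 0 ↔ x ∈ M
  open_pos : ∃ U, IsOpen U ∧ {x | x ∈ unitCube d ∧ lab x = 1} = U ∩ unitCube d
  open_neg : ∃ U, IsOpen U ∧ {x | x ∈ unitCube d ∧ lab x = -1} = U ∩ unitCube d
  nonempty_pos : {x | x ∈ unitCube d ∧ lab x = 1}.Nonempty
  nonempty_neg : {x | x ∈ unitCube d ∧ lab x = -1}.Nonempty
  adherent_pos : M ⊆ closure {x | x ∈ unitCube d ∧ lab x = 1}
  adherent_neg : M ⊆ closure {x | x ∈ unitCube d ∧ lab x = -1}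

/-! ### The grid

A grid point is given by its integer coordinates `v : Fin d → ℕ`; a face of a cube or of a Kuhn
simplex of the grid is given by the finite set of its vertices. -/

/-- The edge size `ε = 1 / (n - 1)` of the regular grid with `n` points on each axis. -/
def meshSize (n : ℕ) : ℝ := 1 / ((n : ℝ) - 1)

/-- The point of `ℝ^d` with integer grid coordinates `v`. -/
def gridPoint {d : ℕ} (n : ℕ) (v : Fin d → ℕ) : EuclideanSpace ℝ (Fin d) :=
  WithLp.toLp 2 (fun j => (v j : ℝ) * meshSize n)

/-- `v` is one of the `n^d` grid points (integer coordinates between `0` and `n - 1`). -/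
def IsGridVertex {d : ℕ} (n : ℕ) (v : Fin d → ℕ) : Prop := ∀ j, v j + 1 ≤ n

/-- `k` is the lowest vertex of one of the `(n-1)^d` cubes of the grid. -/
def IsGridCube {d : ℕ} (n : ℕ) (k : Fin d → ℕ) : Prop := ∀ j, k j + 2 ≤ n

/-- The vertex `k + 1_S` of the cube with lowest vertex `k`. -/
def cubeVertex {d : ℕ} (k : Fin d → ℕ) (S : Finset (Fin d)) : Fin d → ℕ :=
  fun j => k j + if j ∈ S then 1 else 0

/-- `F` is (the vertex set of) an `i`-dimensional face of the grid cube with lowest vertex `k`: the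
directions in `J` are free; among the other ones, those in `A` are at their upper value. -/
def IsCubeFace {d : ℕ} (k : Fin d → ℕ) (i : ℕ) (F : Finset (Fin d → ℕ)) : Prop :=
  ∃ A J : Finset (Fin d), Disjoint A J ∧ J.card = i ∧
    F = J.powerset.image (fun S => cubeVertex k (A ∪ S))

/-- The vertices of the Kuhn simplex
`{x | 0 ≤ x_{π(0)} - min_{π(0)} ≤ ... ≤ x_{π(d-1)} - min_{π(d-1)} ≤ ε}` of the grid cube with
lowest vertex `k`: for `m = 0, ..., d`, the coordinates `π(m), ..., π(d-1)` are at their upper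
value and the other ones at their lower value. -/
def kuhnVertices {d : ℕ} (k : Fin d → ℕ) (π : Equiv.Perm (Fin d)) : Finset (Fin d → ℕ) :=
  (Finset.range (d + 1)).image
    (fun m => cubeVertex k (Finset.univ.filter (fun j => m ≤ (π.symm j : ℕ))))

/-- `F` is (the vertex set of) an `i`-dimensional face of a Kuhn simplex. -/
def IsKuhnFace {d : ℕ} (k : Fin d → ℕ) (π : Equiv.Perm (Fin d)) (i : ℕ)
    (F : Finset (Fin d → ℕ)) : Prop :=
  F ⊆ kuhnVertices k π ∧ F.card = i + 1

/-! ### Boundary points and resistars -/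

/-- The result of `q` dichotomies on the segment from `pm` (label `-1`) to `pp` (label `+1`). -/
def dichotomy {d : ℕ} (lab : EuclideanSpace ℝ (Fin d) → SignType) :
    ℕ → EuclideanSpace ℝ (Fin d) → EuclideanSpace ℝ (Fin d) → EuclideanSpace ℝ (Fin d)
  | 0, pm, pp => midpoint ℝ pm pp
  | q + 1, pm, pp =>
      if lab (midpoint ℝ pm pp) = 1 then dichotomy lab q pm (midpoint ℝ pm pp)
      else dichotomy lab q (midpoint ℝ pm pp) pp

open scoped Classical in
/-- The set `B_M(F)` of the boundary points on the edges of a face `F` of a polytope whose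
`i`-dimensional faces are given by `face i`: one for each edge of `F` whose end points are labelled
`-1` and `+1`, found by `q` dichotomies. -/
def boundaryPoints {d : ℕ} (lab : EuclideanSpace ℝ (Fin d) → SignType) (n q : ℕ)
    (face : ℕ → Finset (Fin d → ℕ) → Prop) (F : Finset (Fin d → ℕ)) :
    Finset (EuclideanSpace ℝ (Fin d)) :=
  ((F ×ˢ F).filter (fun e => face 1 {e.1, e.2} ∧
      lab (gridPoint n e.1) = -1 ∧ lab (gridPoint n e.2) = 1)).image
    (fun e => dichotomy lab q (gridPoint n e.1) (gridPoint n e.2))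

/-- The barycentre of a finite set of points. -/
def barycentre {d : ℕ} (B : Finset (EuclideanSpace ℝ (Fin d))) : EuclideanSpace ℝ (Fin d) :=
  (B.card : ℝ)⁻¹ • ∑ b ∈ B, b

/-- The resistar in a `d`-dimensional polytope whose `i`-dimensional faces are given by `face i`
(the only `d`-dimensional one being the polytope itself): the union, over all flags
`F 1 ⊂ F 2 ⊂ ... ⊂ F d` of faces with `dim (F i) = i` whose edge `F 1` carries a boundary point, of
the simplices with vertices the barycentres of `B_M(F 1), ..., B_M(F d)`. -/
def cellResistar {d : ℕ} (lab : EuclideanSpace ℝ (Fin d) → SignType) (n q : ℕ)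
    (face : ℕ → Finset (Fin d → ℕ) → Prop) : Set (EuclideanSpace ℝ (Fin d)) :=
  {x | ∃ F : ℕ → Finset (Fin d → ℕ),
    (∀ i, 1 ≤ i → i ≤ d → face i (F i)) ∧
    (∀ i, 1 ≤ i → i < d → F i ⊆ F (i + 1)) ∧
    (boundaryPoints lab n q face (F 1)).Nonempty ∧
    x ∈ convexHull ℝ ((fun i => barycentre (boundaryPoints lab n q face (F i))) '' Set.Icc 1 d)}

/-- The resistar approximation in cubes (c-resistar) on the grid. -/
def cResistar {d : ℕ} (lab : EuclideanSpace ℝ (Fin d) → SignType) (n q : ℕ) :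
    Set (EuclideanSpace ℝ (Fin d)) :=
  ⋃ (k : Fin d → ℕ) (_ : IsGridCube n k), cellResistar lab n q (IsCubeFace k)

/-- The resistar approximation in Kuhn simplices (K-resistar) on the grid. -/
def kResistar {d : ℕ} (lab : EuclideanSpace ℝ (Fin d) → SignType) (n q : ℕ) :
    Set (EuclideanSpace ℝ (Fin d)) :=
  ⋃ (k : Fin d → ℕ) (_ : IsGridCube n k) (π : Equiv.Perm (Fin d)),
    cellResistar lab n q (IsKuhnFace k π)

end

/-! One inclusion is a tangent ball argument. Let `y` be labelled `σ` and be a convex combination of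
points within `η` of points not labelled `σ`, the latter at distance at most `D` from `y`. If `p` is
the point of `M` nearest to `y`, positive reach (Federer, `UniqueNearest.infDist_normal`) provides a
ball of radius `s`, below the reach, that contains `y`, touches `M` at `p` and has no point of `M`
inside; so it is labelled `σ`. Points of another label lie outside it and rise above the tangent
hyperplane at `p` by at most `2D²/s`. By convexity `y` is within `2D²/s + η` of `M`
(`Splits.infDist_le_of_mem_convexHull`). In a cell `D = √d ε`, and the dichotomies give `η ≤ dε²/2`,
whence `O(dε²)`. Resistars lie in hulls of boundary points, so they are close to `M`.

For the converse, the barycentres of boundary points (the centres) subdivide the complex: a face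
with both labels is the cone from its centre over its proper faces. This produces two closed regions
of signs `1` and `-1` that cover the cube and meet only in an interface contained in the resistar
(`SignCone`, `ZeroCone`). Near a point of `M` there are points of both labels. If each lies only in
the region of its own sign, the segment between them crosses the interface. Otherwise some `y` lies
in the wrong region. Points of the wrong region are convex combinations as above, hence within `K =
O(dε²)` of `M`; walking from `y` along the normal until the distance to `M` is `2K` or `s` therefore
leaves that region and crosses the interface (`IsGridComplex.exists_zeroCone_near`). If the walk
reaches the boundary of the cube first, it goes on in the face reached, with the trace of `M` there:
this is where the reach of the traces enters. Bounding the sum of the distances to the interface and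
to `M` keeps the errors from adding up over successive faces.

Only the combinatorial properties collected in `IsGridComplex` are used; they are checked for cubes
and for Kuhn simplices. -/

/-- Every point at distance less than `R` from `S` has exactly one nearest point in `S`. -/
def UniqueNearest {E : Type*} [PseudoMetricSpace E] (S : Set E) (R : ℝ) : Prop :=
  ∀ x, Metric.infDist x S < R → ∃! y, y ∈ S ∧ dist x y = Metric.infDist x S

theorem uniqueNearest_of_lt_reach {d : ℕ} {S : Set (EuclideanSpace ℝ (Fin d))} {R : ℝ}
    (hS : S.Nonempty) (hR : ENNReal.ofReal R < reach S) : UniqueNearest S R := by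
  obtain ⟨ρ, hρ, hlt⟩ := lt_sSup_iff.1 hR
  intro x hx
  have key : Metric.infEDist x S = ENNReal.ofReal (Metric.infDist x S) := by
    rw [Metric.infDist, ENNReal.ofReal_toReal (Metric.infEDist_ne_top hS)]
  have h1 : Metric.infEDist x S < ρ := by
    rw [key]
    exact (ENNReal.ofReal_le_ofReal hx.le).trans_lt hlt
  obtain ⟨y, ⟨hyS, hy⟩, huniq⟩ := hρ x h1
  refine ⟨y, ⟨hyS, ?_⟩, ?_⟩
  · rw [Metric.infDist, ← hy, dist_edist]
  · rintro z ⟨hzS, hz⟩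
    exact huniq z ⟨hzS, by rw [edist_dist, hz, key]⟩

theorem UniqueNearest.isClosed {E : Type*} [MetricSpace E] {S : Set E} {R : ℝ}
    (hU : UniqueNearest S R) (hR : 0 < R)
    (hS : S.Nonempty) : IsClosed S := by
  refine isClosed_of_closure_subset fun x hx => ?_
  have h0 : Metric.infDist x S = 0 := (Metric.mem_closure_iff_infDist_zero hS).1 hx
  obtain ⟨y, ⟨hyS, hy⟩, -⟩ := hU x (by rw [h0]; exact hR)
  rw [h0, dist_eq_zero] at hy
  exact hy ▸ hyS

/-! ### Growth of the distance along normals -/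

section Ray

variable {E : Type*} [NormedAddCommGroup E] [InnerProductSpace ℝ E] [ProperSpace E]

open Filter Topology

/-- Moving away from the unique nearest point increases the distance at unit speed. -/
theorem UniqueNearest.exists_infDist_gt {S : Set E} {R : ℝ} (hU : UniqueNearest S R)
    (hS : S.Nonempty) {y p : E} (hp : p ∈ S) (hyp : dist y p = Metric.infDist y S)
    (hpos : 0 < Metric.infDist y S) (hlt : Metric.infDist y S < R) {c : ℝ} (hc : c < 1)
    {h₀ : ℝ} (hh₀ : 0 < h₀) :
    ∃ h, 0 < h ∧ h < h₀ ∧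
      Metric.infDist y S + c * h < Metric.infDist (y + (h / dist y p) • (y - p)) S := by
  by_contra! hcon
  set δ := Metric.infDist y S with hδ
  have hcl : IsClosed S := hU.isClosed (hpos.trans hlt) hS
  set u : E := (δ⁻¹) • (y - p) with hu
  have hnorm : ‖y - p‖ = δ := by rw [← dist_eq_norm, hyp]
  have hun : ‖u‖ = 1 := by
    rw [hu, norm_smul, hnorm, Real.norm_of_nonneg (inv_nonneg.2 hpos.le),
      inv_mul_cancel₀ hpos.ne']
  have hiu : inner ℝ u (y - p) = δ := by
    rw [hu, real_inner_smul_left, real_inner_self_eq_norm_sq, hnorm]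
    field_simp
  set m := min h₀ (R - δ) with hm
  have hm0 : 0 < m := lt_min hh₀ (by linarith)
  -- Points nearest to `y + h k • u` accumulate at a nearest point of `y`, thus at `p`. Expanding
  -- the square of their distance to `y + h k • u` bounds `2⟨u, y - P⟩` by `2cδ + c²h`; in the limit
  -- `δ ≤ cδ`, against `c < 1`.
  set h : ℕ → ℝ := fun k => m / (k + 2) with hh
  have hhpos : ∀ k, 0 < h k := fun k => by positivity
  have hhm : ∀ k, h k < m := fun k => by
    rw [hh]; simp only
    rw [div_lt_iff₀ (by positivity)]
    nlinarith [(Nat.cast_nonneg k : (0 : ℝ) ≤ k)]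
  have hh0 : Tendsto h atTop (𝓝 0) := by
    have h1 := (tendsto_const_div_atTop_nhds_zero_nat m).comp (tendsto_add_atTop_nat 2)
    refine h1.congr fun k => ?_
    simp [hh]
  have hle : ∀ k, Metric.infDist (y + h k • u) S ≤ δ + c * h k := fun k => by
    have h1 := hcon (h k) (hhpos k) ((hhm k).trans_le (min_le_left _ _))
    rwa [hyp, div_eq_mul_inv, mul_smul] at h1
  have hltR : ∀ k, Metric.infDist (y + h k • u) S < R := fun k => by
    have h1 := hle k
    have h2 := (hhm k).trans_le (min_le_right _ _)
    nlinarith [hhpos k]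
  choose P hP hPu using fun k => hU _ (hltR k)
  have hbd : ∀ k, P k ∈ Metric.closedBall y (R + m) := fun k => by
    rw [Metric.mem_closedBall, dist_comm]
    calc dist y (P k) ≤ dist y (y + h k • u) + dist (y + h k • u) (P k) := dist_triangle _ _ _
      _ ≤ m + R := by
        have h1 : dist y (y + h k • u) = h k := by
          rw [dist_eq_norm, sub_add_cancel_left, norm_neg, norm_smul, hun, mul_one,
            Real.norm_of_nonneg (hhpos k).le]
        rw [h1, (hP k).2]
        linarith [hhm k, hltR k]
      _ = R + m := add_comm _ _
  obtain ⟨a, -, φ, hφ, hlim⟩ := (isCompact_closedBall y (R + m)).tendsto_subseq hbd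
  have haS : a ∈ S := hcl.mem_of_tendsto hlim (Eventually.of_forall fun k => (hP _).1)
  have hhφ : Tendsto (fun k => h (φ k)) atTop (𝓝 0) := hh0.comp hφ.tendsto_atTop
  have hmove : Tendsto (fun k => y + h (φ k) • u) atTop (𝓝 y) := by
    simpa using tendsto_const_nhds.add (hhφ.smul_const u)
  have hadist : dist y a = δ := by
    have h1 : Tendsto (fun k => dist (y + h (φ k) • u) (P (φ k))) atTop (𝓝 (dist y a)) :=
      hmove.dist hlim
    have h2 : Tendsto (fun k => Metric.infDist (y + h (φ k) • u) S) atTop (𝓝 δ) :=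
      ((Metric.continuous_infDist_pt S).tendsto y).comp hmove
    refine tendsto_nhds_unique h1 (h2.congr fun k => ((hP (φ k)).2).symm)
  have hap : a = p := (hU y hlt).unique ⟨haS, hadist⟩ ⟨hp, hyp⟩
  have hineq : ∀ k, 2 * inner ℝ u (y - P (φ k)) ≤ 2 * c * δ + c ^ 2 * h (φ k) := fun k => by
    have h1 : ‖y + h (φ k) • u - P (φ k)‖ ≤ δ + c * h (φ k) := by
      rw [← dist_eq_norm, (hP _).2]; exact hle _
    have h2 : δ ≤ ‖y - P (φ k)‖ := by
      rw [← dist_eq_norm]; exact Metric.infDist_le_dist_of_mem (hP _).1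
    have h3 : ‖y + h (φ k) • u - P (φ k)‖ ^ 2
        = ‖y - P (φ k)‖ ^ 2 + 2 * h (φ k) * inner ℝ u (y - P (φ k)) + h (φ k) ^ 2 := by
      rw [show y + h (φ k) • u - P (φ k) = (y - P (φ k)) + h (φ k) • u by abel,
        norm_add_sq_real, real_inner_smul_right, norm_smul, hun, real_inner_comm]
      simp only [mul_one, Real.norm_eq_abs, sq_abs]
      ring
    have h4 : ‖y + h (φ k) • u - P (φ k)‖ ^ 2 ≤ (δ + c * h (φ k)) ^ 2 :=
      pow_le_pow_left₀ (norm_nonneg _) h1 2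
    have h5 : δ ^ 2 ≤ ‖y - P (φ k)‖ ^ 2 := pow_le_pow_left₀ hpos.le h2 2
    have hpk := hhpos (φ k)
    refine le_of_mul_le_mul_left ?_ hpk
    nlinarith [sq_nonneg (h (φ k))]
  have hl1 : Tendsto (fun k => 2 * inner ℝ u (y - P (φ k))) atTop
      (𝓝 (2 * inner ℝ u (y - a))) :=
    (tendsto_const_nhds.inner (tendsto_const_nhds.sub hlim)).const_mul 2
  have hl2 : Tendsto (fun k => 2 * c * δ + c ^ 2 * h (φ k)) atTop (𝓝 (2 * c * δ + c ^ 2 * 0)) :=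
    tendsto_const_nhds.add (hhφ.const_mul _)
  have := le_of_tendsto_of_tendsto' hl1 hl2 hineq
  rw [hap, hiu] at this
  nlinarith

/-- Federer: the distance to a set of reach at least `R` grows at unit speed along its normals. -/
theorem UniqueNearest.infDist_normal {S : Set E} {R : ℝ} (hU : UniqueNearest S R)
    (hS : S.Nonempty) {x p : E} (hp : p ∈ S) (hxp : dist x p = Metric.infDist x S)
    (hpos : 0 < Metric.infDist x S) {T : ℝ} (hT : 0 ≤ T) (hlt : Metric.infDist x S + T < R) :
    Metric.infDist (x + (T / dist x p) • (x - p)) S = Metric.infDist x S + T := by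
  set δ := Metric.infDist x S with hδ
  have hcont : Continuous fun y => Metric.infDist y S := Metric.continuous_infDist_pt S
  have hne : (Metric.closedBall x T).Nonempty := ⟨x, Metric.mem_closedBall_self hT⟩
  -- A maximiser of `infDist y S - c * dist y x` lies on the sphere of radius `T`: from an inner
  -- point, a move of length `h` gains more than `c * h` in the first term and loses at most `c * h`
  -- in the second.
  have hstep : ∀ c : ℝ, 0 ≤ c → c < 1 → ∃ y ∈ Metric.closedBall x T,
      δ + c * T ≤ Metric.infDist y S := by
    intro c hc0 hc
    obtain ⟨y, hy, hmax⟩ := (isCompact_closedBall x T).exists_isMaxOn hne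
      (f := fun y => Metric.infDist y S - c * dist y x) (by fun_prop)
    have hyx : δ ≤ Metric.infDist y S - c * dist y x := by
      have := hmax (Metric.mem_closedBall_self hT)
      simpa using this
    have hyd : dist y x ≤ T := hy
    have hcd : 0 ≤ c * dist y x := mul_nonneg hc0 dist_nonneg
    have hyR : Metric.infDist y S < R := by
      have : Metric.infDist y S ≤ Metric.infDist x S + dist y x := Metric.infDist_le_infDist_add_dist
      linarith
    refine ⟨y, hy, ?_⟩
    rcases hyd.eq_or_lt with heq | hlt'
    · rw [heq] at hyx; linarith
    exfalso
    obtain ⟨p', ⟨hp'S, hp'⟩, -⟩ := hU y hyR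
    have hypos : 0 < Metric.infDist y S := by linarith
    obtain ⟨h, hh0, hhlt, hgt⟩ := hU.exists_infDist_gt hS hp'S hp' hypos hyR hc
      (sub_pos.2 hlt')
    set y' := y + (h / dist y p') • (y - p') with hy'
    have hyy' : dist y' y = h := by
      rw [hy', dist_eq_norm, add_sub_cancel_left, norm_smul, ← dist_eq_norm, Real.norm_of_nonneg
        (by positivity), div_mul_cancel₀ _ (by rw [hp']; exact hypos.ne')]
    have htri : dist y' x ≤ h + dist y x := by
      rw [← hyy']; exact dist_triangle _ _ _
    have hmem : y' ∈ Metric.closedBall x T := by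
      rw [Metric.mem_closedBall]; linarith
    have := hmax hmem
    simp only [Set.mem_ofPred_eq] at this
    nlinarith
  obtain ⟨z, hz, hzmax⟩ := (isCompact_closedBall x T).exists_isMaxOn hne hcont.continuousOn
  have hzge : δ + T ≤ Metric.infDist z S := by
    refine le_of_forall_pos_le_add fun e he => ?_
    -- This `c` is below `1` even for `T = 0`, and `T - c * T ≤ e`.
    obtain ⟨y, hy, hle⟩ := hstep (T / (T + e)) (by positivity)
      ((div_lt_one (by positivity)).2 (by linarith))
    have h1 : Metric.infDist y S ≤ Metric.infDist z S := hzmax hy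
    have h2 : T ≤ T / (T + e) * T + e := by
      rw [div_mul_eq_mul_div, div_add' _ _ _ (by positivity), le_div_iff₀ (by positivity)]
      nlinarith
    linarith
  have hzx : dist z x ≤ T := hz
  have hzp : Metric.infDist z S ≤ dist z p := Metric.infDist_le_dist_of_mem hp
  have hnx : ‖x - p‖ = δ := by rw [← dist_eq_norm, hxp]
  have hznorm : ‖z - x‖ ≤ T := by rwa [← dist_eq_norm]
  -- Equality holds in the triangle inequality for `z`, `x`, `p`, which forces `z` onto the normal
  -- ray.
  have hzp' : δ + T ≤ ‖(z - x) + (x - p)‖ := by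
    rw [sub_add_sub_cancel, ← dist_eq_norm]; linarith
  have hin : δ * T ≤ inner ℝ (z - x) (x - p) := by
    have h1 := norm_add_sq_real (z - x) (x - p)
    have h2 : (δ + T) ^ 2 ≤ ‖(z - x) + (x - p)‖ ^ 2 := pow_le_pow_left₀ (by linarith) hzp' 2
    have h3 : ‖z - x‖ ^ 2 ≤ T ^ 2 := pow_le_pow_left₀ (norm_nonneg _) hznorm 2
    rw [hnx] at h1
    nlinarith
  have hzeq : z = x + (T / dist x p) • (x - p) := by
    rw [hxp, ← sub_eq_zero, ← norm_eq_zero, ← sq_eq_zero_iff]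
    refine le_antisymm ?_ (sq_nonneg _)
    rw [← sub_sub, norm_sub_sq_real, real_inner_smul_right, norm_smul, hnx, Real.norm_of_nonneg
      (by positivity), div_mul_cancel₀ _ hpos.ne']
    have h3 : ‖z - x‖ ^ 2 ≤ T ^ 2 := pow_le_pow_left₀ (norm_nonneg _) hznorm 2
    have h4 : T ^ 2 ≤ T / δ * inner ℝ (z - x) (x - p) := by
      rw [div_mul_eq_mul_div, le_div_iff₀ hpos]
      nlinarith
    linarith
  rw [← hzeq]
  refine le_antisymm ?_ hzge
  have : Metric.infDist z S ≤ Metric.infDist x S + dist z x := Metric.infDist_le_infDist_add_dist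
  linarith

end Ray

/-! ### Labels, and the tangent ball estimate -/

/-- A connected subset of the cube that avoids `M` has constant label. -/
theorem Splits.lab_eq_of_isPreconnected {d : ℕ} {M : Set (EuclideanSpace ℝ (Fin d))}
    {lab : EuclideanSpace ℝ (Fin d) → SignType} (hsp : Splits M lab)
    {W : Set (EuclideanSpace ℝ (Fin d))} (hW : IsPreconnected W) (hWX : W ⊆ unitCube d)
    (hM : ∀ x ∈ W, x ∉ M) {x y : EuclideanSpace ℝ (Fin d)} (hx : x ∈ W) (hy : y ∈ W) :
    lab x = lab y := by
  obtain ⟨U, hUo, hU⟩ := hsp.open_pos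
  obtain ⟨V, hVo, hV⟩ := hsp.open_neg
  have memU : ∀ z ∈ W, z ∈ U ↔ lab z = 1 := fun z hz => by
    have : z ∈ {x | x ∈ unitCube d ∧ lab x = 1} ↔ z ∈ U ∩ unitCube d := by rw [hU]
    simpa [hWX hz] using this.symm
  have memV : ∀ z ∈ W, z ∈ V ↔ lab z = -1 := fun z hz => by
    have : z ∈ {x | x ∈ unitCube d ∧ lab x = -1} ↔ z ∈ V ∩ unitCube d := by rw [hV]
    simpa [hWX hz] using this.symm
  have hne : ∀ z ∈ W, lab z = 1 ∨ lab z = -1 := fun z hz => by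
    have h0 : lab z ≠ 0 := fun h => hM z hz ((hsp.zero_iff z (hWX hz)).1 h)
    revert h0
    cases lab z <;> decide
  have hcov : W ⊆ U ∪ V := fun z hz =>
    (hne z hz).imp (fun h => (memU z hz).2 h) (fun h => (memV z hz).2 h)
  have hnot : ¬ ((W ∩ U).Nonempty ∧ (W ∩ V).Nonempty) := fun ⟨h1, h2⟩ => by
    obtain ⟨z, hz, hzU, hzV⟩ := hW U V hUo hVo hcov h1 h2
    have e1 := (memU z hz).1 hzU
    rw [(memV z hz).1 hzV] at e1
    exact absurd e1 (by decide)
  rcases hne x hx with h1 | h1 <;> rcases hne y hy with h2 | h2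
  · rw [h1, h2]
  · exact absurd ⟨⟨x, hx, (memU x hx).2 h1⟩, ⟨y, hy, (memV y hy).2 h2⟩⟩ hnot
  · exact absurd ⟨⟨y, hy, (memU y hy).2 h2⟩, ⟨x, hx, (memV x hx).2 h1⟩⟩ hnot
  · rw [h1, h2]

/-- A point labelled `σ` that is a convex combination of points close to points not labelled `σ`
is close to the interface. -/
theorem Splits.infDist_le_of_mem_convexHull {d : ℕ} {M : Set (EuclideanSpace ℝ (Fin d))}
    {lab : EuclideanSpace ℝ (Fin d) → SignType} (hsp : Splits M lab)
    {W : Set (EuclideanSpace ℝ (Fin d))} (hWc : Convex ℝ W) (hWX : W ⊆ unitCube d)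
    {R D η s : ℝ} {σ : SignType} (hσ : σ ≠ 0)
    (hU : (M ∩ W).Nonempty → UniqueNearest (M ∩ W) R) (hDs : D < s) (hsR : s < R)
    {y : EuclideanSpace ℝ (Fin d)} (hyW : y ∈ W) (hy : lab y = σ)
    {Q : Set (EuclideanSpace ℝ (Fin d))} (hyQ : y ∈ convexHull ℝ Q)
    (hQ : ∀ b ∈ Q, ∃ p ∈ W, lab p ≠ σ ∧ dist b p ≤ η ∧ dist p y ≤ D) :
    (M ∩ W).Nonempty ∧ 0 < Metric.infDist y (M ∩ W) ∧ Metric.infDist y (M ∩ W) ≤ D ∧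
      Metric.infDist y (M ∩ W) ≤ 2 * D ^ 2 / s + η := by
  have hyM : y ∉ M := fun h => hσ (hy ▸ (hsp.zero_iff y (hWX hyW)).2 h)
  obtain ⟨b₀, hb₀⟩ := convexHull_nonempty_iff.1 (⟨y, hyQ⟩ : (convexHull ℝ Q).Nonempty)
  obtain ⟨p₀, hp₀W, hp₀σ, -, hp₀D⟩ := hQ b₀ hb₀
  obtain ⟨m, hmM, hmseg⟩ : ∃ m ∈ M, m ∈ segment ℝ y p₀ := by
    by_contra! hno
    refine hp₀σ ?_
    rw [← hy]
    exact hsp.lab_eq_of_isPreconnected (convex_segment y p₀).isPreconnected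
      ((hWc.segment_subset hyW hp₀W).trans hWX) (fun x hx hxM => hno x hxM hx)
      (right_mem_segment ℝ y p₀) (left_mem_segment ℝ y p₀)
  have hmW : m ∈ W := hWc.segment_subset hyW hp₀W hmseg
  have hmD : dist y m ≤ D := by
    have hball : segment ℝ y p₀ ⊆ Metric.closedBall y (dist p₀ y) :=
      (convex_closedBall y _).segment_subset (Metric.mem_closedBall_self dist_nonneg)
        (Metric.mem_closedBall.2 le_rfl)
    rw [dist_comm]
    exact (hball hmseg).trans hp₀D
  have hne : (M ∩ W).Nonempty := ⟨m, hmM, hmW⟩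
  set δ := Metric.infDist y (M ∩ W) with hδ
  have hδD : δ ≤ D :=
    (Metric.infDist_le_dist_of_mem (s := M ∩ W) ⟨hmM, hmW⟩).trans hmD
  have hUN := hU hne
  have hD0 : 0 ≤ D := dist_nonneg.trans hmD
  have hs0 : 0 < s := hD0.trans_lt hDs
  have hcl : IsClosed (M ∩ W) := hUN.isClosed (hs0.trans hsR) hne
  have hδ0 : 0 < δ := (hcl.notMem_iff_infDist_pos hne).1 fun h => hyM h.1
  refine ⟨hne, hδ0, hδD, ?_⟩
  obtain ⟨p, ⟨hpS, hpd⟩, -⟩ := hUN y (hδD.trans_lt (hDs.trans hsR))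
  -- Centre of the ball of radius `s` touching `M ∩ W` at `p` on the side of `y`. It may lie outside
  -- `W`: nearest points are unique around `M ∩ W` in the whole space.
  have hz := hUN.infDist_normal hne hpS hpd hδ0 (T := s - δ) (by linarith)
    (by rw [← hδ]; linarith)
  set z := y + ((s - δ) / dist y p) • (y - p) with hzdef
  rw [← hδ, add_sub_cancel] at hz
  have hnyp : ‖y - p‖ = δ := by rw [← dist_eq_norm, hpd]
  have hzp : z - p = (s / δ) • (y - p) := by
    rw [hzdef, hpd, ← hδ, show s / δ = (s - δ) / δ + 1 by field_simp; ring]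
    module
  have hyz : dist y z < s := by
    rw [hzdef, dist_eq_norm, sub_add_cancel_left, norm_neg, norm_smul, hnyp, hpd, ← hδ,
      Real.norm_of_nonneg (div_nonneg (by linarith) hδ0.le), div_mul_cancel₀ _ hδ0.ne']
    linarith
  -- The intersection of `W` with the open ball is convex, avoids `M` and contains `y`, so it is
  -- labelled `σ` throughout.
  have hfar : ∀ x ∈ W, lab x ≠ σ → s ≤ ‖x - z‖ := by
    intro x hxW hxσ
    by_contra! hlt
    refine hxσ ?_
    rw [← hy]
    refine hsp.lab_eq_of_isPreconnected (W := W ∩ Metric.ball z s)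
      (hWc.inter (convex_ball z s)).isPreconnected (Set.inter_subset_left.trans hWX) ?_
      ⟨hxW, ?_⟩ ⟨hyW, hyz⟩
    · rintro w ⟨hwW, hwz⟩ hwM
      have : Metric.infDist z (M ∩ W) ≤ dist z w := Metric.infDist_le_dist_of_mem ⟨hwM, hwW⟩
      rw [hz, dist_comm] at this
      exact absurd hwz (not_lt.2 this)
    · rwa [Metric.mem_ball, dist_eq_norm]
  -- From `‖x - z‖ ≥ s = ‖z - p‖`, the height of `x` above the tangent hyperplane is at most `‖x -
  -- p‖² / (2s)`, and `‖x - p‖ ≤ D + δ ≤ 2D`.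
  have hnear : ∀ x ∈ W, lab x ≠ σ → dist x y ≤ D →
      inner ℝ (y - p) (x - p) ≤ δ * (2 * D ^ 2 / s) := by
    intro x hxW hxσ hxD
    have h1 := hfar x hxW hxσ
    have h2 : ‖x - z‖ ^ 2 = ‖x - p‖ ^ 2 - 2 * (s / δ * inner ℝ (y - p) (x - p)) + s ^ 2 := by
      rw [show x - z = (x - p) - (z - p) by abel, norm_sub_sq_real, hzp, real_inner_smul_right,
        norm_smul, hnyp, Real.norm_of_nonneg (by positivity), div_mul_cancel₀ _ hδ0.ne',
        real_inner_comm]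
    have h3 : s ^ 2 ≤ ‖x - z‖ ^ 2 := pow_le_pow_left₀ hs0.le h1 2
    have h4 : ‖x - p‖ ≤ 2 * D := by
      rw [← dist_eq_norm]
      have := dist_triangle x y p
      rw [hpd] at this
      linarith
    have h5 : ‖x - p‖ ^ 2 ≤ (2 * D) ^ 2 := pow_le_pow_left₀ (norm_nonneg _) h4 2
    have h6 : s / δ * inner ℝ (y - p) (x - p) ≤ 2 * D ^ 2 := by linarith
    rw [div_mul_eq_mul_div, div_le_iff₀ hδ0] at h6
    rw [mul_div_assoc', le_div_iff₀ hs0]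
    linarith
  -- The height is affine, so its bound, enlarged by `η`, passes to the hull; the height of `y` is
  -- `δ` itself.
  have hhalf : convexHull ℝ Q ⊆ {x | inner ℝ (y - p) x ≤
      inner ℝ (y - p) p + δ * (2 * D ^ 2 / s + η)} := by
    refine convexHull_min (fun b hb => ?_)
      (convex_halfSpace_le (innerSL ℝ (y - p)).isLinear _)
    obtain ⟨x, hxW, hxσ, hbx, hxD⟩ := hQ b hb
    have h1 := hnear x hxW hxσ hxD
    have h2 : inner ℝ (y - p) (b - x) ≤ δ * η :=
      calc inner ℝ (y - p) (b - x) ≤ ‖y - p‖ * ‖b - x‖ := real_inner_le_norm _ _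
        _ ≤ δ * η := by
          rw [hnyp, ← dist_eq_norm]
          exact mul_le_mul_of_nonneg_left hbx hδ0.le
    rw [inner_sub_right] at h1 h2
    simp only [Set.mem_ofPred_eq]
    linarith
  have hfin : inner ℝ (y - p) y ≤ inner ℝ (y - p) p + δ * (2 * D ^ 2 / s + η) := hhalf hyQ
  have hsq : inner ℝ (y - p) (y - p) = δ ^ 2 := by rw [real_inner_self_eq_norm_sq, hnyp]
  rw [inner_sub_right] at hsq
  refine le_of_mul_le_mul_left ?_ hδ0
  linarith [sq δ]

/-! ### Dichotomies -/

/-- The point found by dichotomies lies on the open segment. -/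
theorem dichotomy_eq_lineMap {d : ℕ} (lab : EuclideanSpace ℝ (Fin d) → SignType) (q : ℕ)
    (x y : EuclideanSpace ℝ (Fin d)) :
    ∃ t ∈ Set.Ioo (0 : ℝ) 1, dichotomy lab q x y = AffineMap.lineMap x y t := by
  induction q generalizing x y with
  | zero => exact ⟨1 / 2, by norm_num, by simp [dichotomy, midpoint]⟩
  | succ q ih =>
    have hm : midpoint ℝ x y = (1 / 2 : ℝ) • x + (1 / 2 : ℝ) • y := by
      rw [midpoint_eq_smul_add, smul_add]; norm_num
    rw [dichotomy]
    split_ifs with h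
    · obtain ⟨t, ht, h'⟩ := ih x (midpoint ℝ x y)
      refine ⟨t / 2, ⟨by linarith [ht.1], by linarith [ht.2]⟩, ?_⟩
      rw [h', hm, AffineMap.lineMap_apply_module, AffineMap.lineMap_apply_module]
      module
    · obtain ⟨t, ht, h'⟩ := ih (midpoint ℝ x y) y
      refine ⟨(1 + t) / 2, ⟨by linarith [ht.1], by linarith [ht.2]⟩, ?_⟩
      rw [h', hm, AffineMap.lineMap_apply_module, AffineMap.lineMap_apply_module]
      module

theorem dichotomy_mem_openSegment {d : ℕ} (lab : EuclideanSpace ℝ (Fin d) → SignType) (q : ℕ)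
    (x y : EuclideanSpace ℝ (Fin d)) : dichotomy lab q x y ∈ openSegment ℝ x y := by
  obtain ⟨t, ht, h⟩ := dichotomy_eq_lineMap lab q x y
  rw [h, openSegment_eq_image_lineMap]
  exact ⟨t, ht, rfl⟩

/-- The point found by dichotomies is close to points of the segment with different labels. -/
theorem exists_near_dichotomy {d : ℕ} (lab : EuclideanSpace ℝ (Fin d) → SignType) (q : ℕ)
    {x y : EuclideanSpace ℝ (Fin d)} (hx : lab x ≠ 1) (hy : lab y = 1) :
    (∃ p ∈ segment ℝ x y, lab p ≠ 1 ∧ dist (dichotomy lab q x y) p ≤ dist x y / 2 ^ (q + 1)) ∧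
    (∃ p ∈ segment ℝ x y, lab p = 1 ∧ dist (dichotomy lab q x y) p ≤ dist x y / 2 ^ (q + 1)) := by
  induction q generalizing x y with
  | zero =>
    refine ⟨⟨x, left_mem_segment ℝ x y, hx, ?_⟩, ⟨y, right_mem_segment ℝ x y, hy, ?_⟩⟩
    · rw [dichotomy, dist_midpoint_left]
      norm_num
      linarith
    · rw [dichotomy, dist_midpoint_right]
      norm_num
      linarith
  | succ q ih =>
    have hmid : midpoint ℝ x y ∈ segment ℝ x y := midpoint_mem_segment x y
    rw [dichotomy]
    split_ifs with h
    · have hsub : segment ℝ x (midpoint ℝ x y) ⊆ segment ℝ x y :=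
        (convex_segment x y).segment_subset (left_mem_segment ℝ x y) hmid
      have hd : dist x (midpoint ℝ x y) / 2 ^ (q + 1) = dist x y / 2 ^ (q + 1 + 1) := by
        rw [dist_left_midpoint]
        norm_num [pow_succ]
        field_simp
      obtain ⟨⟨p, hp, hp1, hp2⟩, ⟨p', hp', hp1', hp2'⟩⟩ := ih hx h
      rw [hd] at hp2 hp2'
      exact ⟨⟨p, hsub hp, hp1, hp2⟩, ⟨p', hsub hp', hp1', hp2'⟩⟩
    · have hsub : segment ℝ (midpoint ℝ x y) y ⊆ segment ℝ x y :=
        (convex_segment x y).segment_subset hmid (right_mem_segment ℝ x y)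
      have hd : dist (midpoint ℝ x y) y / 2 ^ (q + 1) = dist x y / 2 ^ (q + 1 + 1) := by
        rw [dist_midpoint_right]
        norm_num [pow_succ]
        field_simp
      obtain ⟨⟨p, hp, hp1, hp2⟩, ⟨p', hp', hp1', hp2'⟩⟩ := ih h hy
      rw [hd] at hp2 hp2'
      exact ⟨⟨p, hsub hp, hp1, hp2⟩, ⟨p', hsub hp', hp1', hp2'⟩⟩

/-! ### Grid complexes and their subdivision by centres -/

/-- The polytope spanned by a finite set of grid points. -/
def gridHull {d : ℕ} (n : ℕ) (F : Finset (Fin d → ℕ)) : Set (EuclideanSpace ℝ (Fin d)) :=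
  convexHull ℝ (gridPoint n '' (F : Set (Fin d → ℕ)))

/-- A set of grid points with both labels. -/
def IsMixed {d : ℕ} (lab : EuclideanSpace ℝ (Fin d) → SignType) (n : ℕ)
    (F : Finset (Fin d → ℕ)) : Prop :=
  (∃ v ∈ F, lab (gridPoint n v) = 1) ∧ ∃ v ∈ F, lab (gridPoint n v) = -1

/-- A polyhedral complex with vertices on the grid: `face i F` means that `F` is the vertex set of
an `i`-dimensional face. -/
structure IsGridComplex {d : ℕ} (n : ℕ) (face : ℕ → Finset (Fin d → ℕ) → Prop) : Prop where
  cover : ∀ x ∈ unitCube d, ∃ C, face d C ∧ x ∈ gridHull n C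
  nonempty : ∀ {i F}, face i F → F.Nonempty
  cube : ∀ {i F}, face i F → ∃ k, IsGridCube n k ∧ ∀ v ∈ F, ∀ j, k j ≤ v j ∧ v j ≤ k j + 1
  inter : ∀ {i F m G x}, face i F → face m G → x ∈ gridHull n F → x ∈ gridHull n G →
    ∃ l K, face l K ∧ K ⊆ F ∧ K ⊆ G ∧ x ∈ gridHull n K
  extreme : ∀ {i F m G}, face i F → face m G → G ⊆ F → IsExtreme ℝ (gridHull n F) (gridHull n G)
  -- Points on no proper face are relatively interior.
  extend : ∀ {i F x}, face i F → x ∈ gridHull n F →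
    (∀ m G, face m G → G ⊂ F → x ∉ gridHull n G) →
    ∀ b ∈ gridHull n F, ∃ t : ℝ, 0 < t ∧ x + t • (x - b) ∈ gridHull n F
  dim_le : ∀ {i F m G}, face i F → face m G → G ⊆ F → m ≤ i ∧ (m = i → G = F)
  step : ∀ {i F m G}, face i F → face m G → G ⊆ F → m < i →
    ∃ H, face (m + 1) H ∧ G ⊆ H ∧ H ⊆ F
  edge : ∀ {i F} (s : (Fin d → ℕ) → SignType), face i F → (∀ v ∈ F, s v = 1 ∨ s v = -1) →
    (∃ v ∈ F, s v = 1) → (∃ v ∈ F, s v = -1) →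
    ∃ a ∈ F, ∃ b ∈ F, face 1 {a, b} ∧ s a = -1 ∧ s b = 1
  -- This keeps the centre of a mixed face off its proper faces, so that the cones from the centre
  -- are not degenerate.
  edge_notMem : ∀ {i F m G} (s : (Fin d → ℕ) → SignType), face i F → face m G → G ⊂ F →
    (∀ v ∈ F, s v = 1 ∨ s v = -1) → (∃ v ∈ F, s v = 1) → (∃ v ∈ F, s v = -1) →
    ∃ a ∈ F, ∃ b ∈ F, face 1 {a, b} ∧ s a = -1 ∧ s b = 1 ∧ (a ∉ G ∨ b ∉ G)

/-- The barycentre of the boundary points of a face. -/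
noncomputable def center {d : ℕ} (lab : EuclideanSpace ℝ (Fin d) → SignType) (n q : ℕ)
    (face : ℕ → Finset (Fin d → ℕ) → Prop) (F : Finset (Fin d → ℕ)) :
    EuclideanSpace ℝ (Fin d) :=
  barycentre (boundaryPoints lab n q face F)

/-- The part with sign `σ` of a face, in the subdivision of the complex by the barycentres of
the boundary points. -/
inductive SignCone {d : ℕ} (lab : EuclideanSpace ℝ (Fin d) → SignType) (n q : ℕ)
    (face : ℕ → Finset (Fin d → ℕ) → Prop) (σ : SignType) :
    Finset (Fin d → ℕ) → EuclideanSpace ℝ (Fin d) → Prop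
  | pure {i F x} : face i F → (∀ v ∈ F, lab (gridPoint n v) = σ) → x ∈ gridHull n F →
      SignCone lab n q face σ F x
  | cone {i F m G x y} : face i F → face m G → G ⊂ F → IsMixed lab n F →
      SignCone lab n q face σ G y → x ∈ segment ℝ (center lab n q face F) y →
      SignCone lab n q face σ F x

/-- The interface in a face, in the subdivision of the complex by the barycentres of
the boundary points. -/
inductive ZeroCone {d : ℕ} (lab : EuclideanSpace ℝ (Fin d) → SignType) (n q : ℕ)
    (face : ℕ → Finset (Fin d → ℕ) → Prop) :
    Finset (Fin d → ℕ) → EuclideanSpace ℝ (Fin d) → Prop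
  | apex {i F} : face i F → IsMixed lab n F → ZeroCone lab n q face F (center lab n q face F)
  | cone {i F m G x y} : face i F → face m G → G ⊂ F → ZeroCone lab n q face G y →
      x ∈ segment ℝ (center lab n q face F) y → ZeroCone lab n q face F x

/-! ### The two signed parts of a face -/

section Complex

variable {d : ℕ} {lab : EuclideanSpace ℝ (Fin d) → SignType} {n q : ℕ}
  {face : ℕ → Finset (Fin d → ℕ) → Prop}

theorem meshSize_pos {n : ℕ} (hn : 2 ≤ n) : 0 < meshSize n := by
  have : (2 : ℝ) ≤ n := by exact_mod_cast hn
  exact one_div_pos.2 (by linarith)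

@[simp] theorem gridPoint_apply (v : Fin d → ℕ) (j : Fin d) :
    gridPoint n v j = v j * meshSize n := rfl

theorem gridHull_mono {F G : Finset (Fin d → ℕ)} (h : G ⊆ F) : gridHull n G ⊆ gridHull n F :=
  convexHull_mono (Set.image_mono (by exact_mod_cast h))

theorem gridPoint_mem_gridHull {F : Finset (Fin d → ℕ)} {v : Fin d → ℕ} (h : v ∈ F) :
    gridPoint n v ∈ gridHull n F :=
  subset_convexHull ℝ _ ⟨v, h, rfl⟩

theorem convex_gridHull (F : Finset (Fin d → ℕ)) : Convex ℝ (gridHull n F) :=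
  convex_convexHull ℝ _

theorem isCompact_gridHull (F : Finset (Fin d → ℕ)) : IsCompact (gridHull n F) :=
  (F.finite_toSet.image _).isCompact_convexHull ℝ

theorem IsMixed.mono {F G : Finset (Fin d → ℕ)} (h : IsMixed lab n G) (hGF : G ⊆ F) :
    IsMixed lab n F :=
  ⟨h.1.imp fun _ hv => ⟨hGF hv.1, hv.2⟩, h.2.imp fun _ hv => ⟨hGF hv.1, hv.2⟩⟩

theorem IsGridComplex.isGridVertex (hc : IsGridComplex n face) {i F} (hF : face i F)
    {v : Fin d → ℕ} (hv : v ∈ F) : IsGridVertex n v := fun j => by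
  obtain ⟨k, hk, h⟩ := hc.cube hF
  have h1 := hk j
  have h2 := (h v hv j).2
  omega

/-- A vertex of a cube lying in the hull of some vertices is one of them. -/
theorem IsGridComplex.mem_of_gridPoint_mem (hn : 2 ≤ n) (hc : IsGridComplex n face) {i F G}
    (hF : face i F) (hGF : G ⊆ F) {a : Fin d → ℕ} (ha : a ∈ F) (h : gridPoint n a ∈ gridHull n G) :
    a ∈ G := by
  by_contra haG
  obtain ⟨k, -, hk⟩ := hc.cube hF
  have hε := meshSize_pos hn
  -- Among the vertices of the cube, the linear form with coefficients `c` is minimal at `a` alone,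
  -- with a gap of at least one mesh size.
  set c : Fin d → ℝ := fun j => if a j = k j then 1 else -1
  set f : EuclideanSpace ℝ (Fin d) → ℝ := fun x => ∑ j, c j * x j with hf
  have hlin : IsLinearMap ℝ f := by
    constructor
    · intro x y
      simp [hf, mul_add, Finset.sum_add_distrib]
    · intro r x
      simp only [hf, PiLp.smul_apply, smul_eq_mul, Finset.mul_sum]
      exact Finset.sum_congr rfl fun j _ => by ring
  have hterm : ∀ v ∈ F, ∀ j, c j * gridPoint n a j ≤ c j * gridPoint n v j ∧
      (a j ≠ v j → c j * gridPoint n a j + meshSize n ≤ c j * gridPoint n v j) := by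
    intro v hv j
    have h1 := hk v hv j
    have h2 := hk a ha j
    simp only [gridPoint_apply, c]
    split_ifs with hj
    · rw [hj]
      rcases (show v j = k j ∨ v j = k j + 1 by omega) with e | e <;> rw [e]
      · simp
      · push_cast
        constructor <;> intros <;> nlinarith
    · have e' : a j = k j + 1 := by omega
      rw [e']
      rcases (show v j = k j ∨ v j = k j + 1 by omega) with e | e <;> rw [e]
      · push_cast
        constructor <;> intros <;> nlinarith
      · simp
  have hsub : gridHull n G ⊆ {x | f (gridPoint n a) + meshSize n ≤ f x} := by
    refine convexHull_min ?_ (convex_halfSpace_ge hlin _)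
    rintro _ ⟨v, hv, rfl⟩
    have hvF := hGF hv
    have hne : a ≠ v := fun e => haG (e ▸ hv)
    obtain ⟨j₀, hj₀⟩ := Function.ne_iff.1 hne
    have h1 : ∑ j, (c j * gridPoint n a j + if j = j₀ then meshSize n else 0) ≤
        ∑ j, c j * gridPoint n v j := by
      refine Finset.sum_le_sum fun j _ => ?_
      split_ifs with e
      · exact (hterm v hvF j).2 (e ▸ hj₀)
      · simpa using (hterm v hvF j).1
    rw [Finset.sum_add_distrib, Finset.sum_ite_eq' Finset.univ j₀] at h1
    simpa [hf] using h1
  have := hsub h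
  simp only [Set.mem_ofPred_eq] at this
  linarith

theorem barycentre_mem_convexHull {B : Finset (EuclideanSpace ℝ (Fin d))} (hB : B.Nonempty) :
    barycentre B ∈ convexHull ℝ (B : Set (EuclideanSpace ℝ (Fin d))) := by
  have h : (0 : ℝ) < B.card := by exact_mod_cast hB.card_pos
  rw [barycentre, Finset.smul_sum]
  refine (convex_convexHull ℝ _).sum_mem (fun _ _ => by positivity) ?_
    (fun b hb => subset_convexHull ℝ _ hb)
  rw [Finset.sum_const, nsmul_eq_mul, mul_inv_cancel₀ h.ne']

/-- Each point has positive weight in the barycentre; `r` is the barycentre of the others, or `p` if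
there are none. Together with extremality, a face containing the centre must contain every boundary
point. -/
theorem exists_barycentre_mem_openSegment {B : Finset (EuclideanSpace ℝ (Fin d))}
    {p : EuclideanSpace ℝ (Fin d)} (hp : p ∈ B) :
    ∃ r ∈ convexHull ℝ (B : Set (EuclideanSpace ℝ (Fin d))), barycentre B ∈ openSegment ℝ p r := by
  classical
  rcases (B.erase p).eq_empty_or_nonempty with h | h
  · refine ⟨p, subset_convexHull ℝ _ hp, ?_⟩
    have : B = {p} := by rw [← Finset.insert_erase hp, h]; rfl
    simp [this, barycentre]
  · refine ⟨barycentre (B.erase p), convexHull_mono (by exact_mod_cast B.erase_subset p)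
      (barycentre_mem_convexHull h), ?_⟩
    have hm : (0 : ℝ) < (B.erase p).card := by exact_mod_cast h.card_pos
    have hcard : (B.card : ℝ) = (B.erase p).card + 1 := by
      exact_mod_cast (Finset.card_erase_add_one hp).symm
    refine ⟨(B.card : ℝ)⁻¹, (B.card : ℝ)⁻¹ * (B.erase p).card, ?_, ?_, ?_, ?_⟩
    · rw [hcard]; positivity
    · rw [hcard]; positivity
    · rw [hcard]; field_simp; ring
    · rw [barycentre, barycentre, ← Finset.add_sum_erase B _ hp, smul_add, smul_smul,
        mul_assoc, mul_inv_cancel₀ hm.ne', mul_one]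

open scoped Classical in
theorem mem_boundaryPoints {F : Finset (Fin d → ℕ)} {x : EuclideanSpace ℝ (Fin d)} :
    x ∈ boundaryPoints lab n q face F ↔ ∃ a ∈ F, ∃ b ∈ F, face 1 {a, b} ∧
      lab (gridPoint n a) = -1 ∧ lab (gridPoint n b) = 1 ∧
      dichotomy lab q (gridPoint n a) (gridPoint n b) = x := by
  simp only [boundaryPoints, Finset.mem_image, Finset.mem_filter, Finset.mem_product, Prod.exists]
  constructor
  · rintro ⟨a, b, ⟨⟨ha, hb⟩, h1, h2, h3⟩, h4⟩
    exact ⟨a, ha, b, hb, h1, h2, h3, h4⟩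
  · rintro ⟨a, ha, b, hb, h1, h2, h3, h4⟩
    exact ⟨a, b, ⟨⟨ha, hb⟩, h1, h2, h3⟩, h4⟩

theorem boundaryPoints_subset_gridHull (F : Finset (Fin d → ℕ)) :
    (boundaryPoints lab n q face F : Set (EuclideanSpace ℝ (Fin d))) ⊆ gridHull n F := by
  intro x hx
  obtain ⟨a, ha, b, hb, -, -, -, rfl⟩ := mem_boundaryPoints.1 hx
  exact (convex_gridHull F).openSegment_subset (gridPoint_mem_gridHull ha)
    (gridPoint_mem_gridHull hb) (dichotomy_mem_openSegment _ _ _ _)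

theorem IsGridComplex.boundaryPoints_nonempty (hc : IsGridComplex n face)
    (hlab : ∀ v, IsGridVertex n v → lab (gridPoint n v) = 1 ∨ lab (gridPoint n v) = -1)
    {i F} (hF : face i F) (hmix : IsMixed lab n F) :
    (boundaryPoints lab n q face F).Nonempty := by
  obtain ⟨a, ha, b, hb, h1, h2, h3⟩ := hc.edge (fun v => lab (gridPoint n v)) hF
    (fun v hv => hlab v (hc.isGridVertex hF hv)) hmix.1 hmix.2
  exact ⟨_, mem_boundaryPoints.2 ⟨a, ha, b, hb, h1, h2, h3, rfl⟩⟩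

theorem IsGridComplex.center_mem_convexHull (hc : IsGridComplex n face)
    (hlab : ∀ v, IsGridVertex n v → lab (gridPoint n v) = 1 ∨ lab (gridPoint n v) = -1)
    {i F} (hF : face i F) (hmix : IsMixed lab n F) :
    center lab n q face F ∈
      convexHull ℝ (boundaryPoints lab n q face F : Set (EuclideanSpace ℝ (Fin d))) :=
  barycentre_mem_convexHull (hc.boundaryPoints_nonempty hlab hF hmix)

theorem IsGridComplex.center_mem_gridHull (hc : IsGridComplex n face)
    (hlab : ∀ v, IsGridVertex n v → lab (gridPoint n v) = 1 ∨ lab (gridPoint n v) = -1)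
    {i F} (hF : face i F) (hmix : IsMixed lab n F) : center lab n q face F ∈ gridHull n F :=
  convexHull_min (boundaryPoints_subset_gridHull F) (convex_gridHull F)
    (hc.center_mem_convexHull hlab hF hmix)

/-- The centre of a mixed face lies on no proper face. -/
theorem IsGridComplex.center_notMem (hn : 2 ≤ n) (hc : IsGridComplex n face)
    (hlab : ∀ v, IsGridVertex n v → lab (gridPoint n v) = 1 ∨ lab (gridPoint n v) = -1)
    {i F m G} (hF : face i F) (hmix : IsMixed lab n F) (hG : face m G) (hGF : G ⊂ F) :
    center lab n q face F ∉ gridHull n G := by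
  intro hcG
  obtain ⟨a, ha, b, hb, h1, h2, h3, h4⟩ := hc.edge_notMem (fun v => lab (gridPoint n v)) hF hG hGF
    (fun v hv => hlab v (hc.isGridVertex hF hv)) hmix.1 hmix.2
  have hpB := mem_boundaryPoints (q := q).2 ⟨a, ha, b, hb, h1, h2, h3, rfl⟩
  set p := dichotomy lab q (gridPoint n a) (gridPoint n b)
  -- Extremality of `G` is used first at the centre, between `p` and `r`, then at `p`, inside a
  -- mixed edge; both ends of that edge land in `G`.
  obtain ⟨r, hr, hseg⟩ := exists_barycentre_mem_openSegment hpB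
  have hext := hc.extreme hF hG hGF.subset
  have hrF : r ∈ gridHull n F :=
    convexHull_min (boundaryPoints_subset_gridHull F) (convex_gridHull F) hr
  have hpG : p ∈ gridHull n G := hext.left_mem_of_mem_openSegment
    (boundaryPoints_subset_gridHull F hpB) hrF hcG hseg
  have hpo : p ∈ openSegment ℝ (gridPoint n a) (gridPoint n b) := dichotomy_mem_openSegment _ _ _ _
  have haG : gridPoint n a ∈ gridHull n G := hext.left_mem_of_mem_openSegment
    (gridPoint_mem_gridHull ha) (gridPoint_mem_gridHull hb) hpG hpo
  have hbG : gridPoint n b ∈ gridHull n G := hext.left_mem_of_mem_openSegment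
    (gridPoint_mem_gridHull hb) (gridPoint_mem_gridHull ha) hpG (by rwa [openSegment_symm])
  exact h4.elim (fun h => h (hc.mem_of_gridPoint_mem hn hF hGF.subset ha haG))
    (fun h => h (hc.mem_of_gridPoint_mem hn hF hGF.subset hb hbG))

/-- Radial projection of a point of a face from another point, to a proper face. -/
theorem IsGridComplex.exists_mem_segment (hc : IsGridComplex n face)
    {i F} (hF : face i F) {b x : EuclideanSpace ℝ (Fin d)} (hb : b ∈ gridHull n F)
    (hx : x ∈ gridHull n F) (hbx : b ≠ x) :
    ∃ m G y, face m G ∧ G ⊂ F ∧ y ∈ gridHull n G ∧ x ∈ segment ℝ b y := by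
  -- The last point of `F` on the ray from `b` through `x` lies on a proper face, for otherwise
  -- `extend` would prolong the ray within `F`.
  set T : Set ℝ := {t | b + t • (x - b) ∈ gridHull n F} ∩ Set.Ici 0 with hT
  have hxb : 0 < ‖x - b‖ := norm_pos_iff.2 (sub_ne_zero.2 hbx.symm)
  have hTcl : IsClosed T := by
    refine IsClosed.inter ?_ isClosed_Ici
    exact (isCompact_gridHull F).isClosed.preimage (by fun_prop)
  obtain ⟨C, hC⟩ := (isCompact_gridHull (n := n) F).isBounded.subset_closedBall b
  have hTb : BddAbove T := by
    refine ⟨C / ‖x - b‖, fun t ht => ?_⟩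
    have h1 := hC ht.1
    rw [Metric.mem_closedBall, dist_eq_norm, add_sub_cancel_left, norm_smul,
      Real.norm_of_nonneg ht.2] at h1
    rwa [le_div_iff₀ hxb]
  have h1T : (1 : ℝ) ∈ T := ⟨by simpa using hx, by simp⟩
  have hsup := hTcl.csSup_mem ⟨1, h1T⟩ hTb
  set t := sSup T
  have ht1 : 1 ≤ t := le_csSup hTb h1T
  set y := b + t • (x - b) with hy
  have hseg : x ∈ segment ℝ b y := by
    rw [segment_eq_image_lineMap]
    refine ⟨t⁻¹, ⟨by positivity, inv_le_one_of_one_le₀ ht1⟩, ?_⟩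
    rw [AffineMap.lineMap_apply_module', hy, add_sub_cancel_left, smul_smul,
      inv_mul_cancel₀ (by positivity), one_smul, sub_add_cancel]
  by_contra! hcon
  obtain ⟨e, he, hmem⟩ := hc.extend hF hsup.1
    (fun m G hG hGF hyG => hcon m G y hG hGF hyG hseg) b hb
  have hbig : t + e * t ∈ T := by
    refine ⟨?_, by simp only [Set.mem_Ici]; positivity⟩
    have : b + (t + e * t) • (x - b) = y + e • (y - b) := by
      rw [hy]; module
    change b + (t + e * t) • (x - b) ∈ gridHull n F
    rw [this]
    exact hmem
  have := le_csSup hTb hbig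
  nlinarith

/-- Every point of a mixed face lies on a segment from its centre to a proper face. -/
theorem IsGridComplex.exists_mem_segment_center (hc : IsGridComplex n face)
    (hlab : ∀ v, IsGridVertex n v → lab (gridPoint n v) = 1 ∨ lab (gridPoint n v) = -1)
    {i F} (hF : face i F) (hmix : IsMixed lab n F) {x : EuclideanSpace ℝ (Fin d)}
    (hx : x ∈ gridHull n F) :
    ∃ m G y, face m G ∧ G ⊂ F ∧ y ∈ gridHull n G ∧
      x ∈ segment ℝ (center lab n q face F) y := by
  have hb := hc.center_mem_gridHull (q := q) hlab hF hmix
  by_cases hbx : center lab n q face F = x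
  · obtain ⟨⟨v, hv, hv1⟩, ⟨w, hw, hw1⟩⟩ := hmix
    -- At the centre any proper face will do. One is found by projecting a vertex other than the
    -- centre, which exists because two vertices have different labels.
    obtain ⟨u, hu, hub⟩ : ∃ u ∈ F, center lab n q face F ≠ gridPoint n u := by
      by_contra! hcon
      have : lab (gridPoint n v) = lab (gridPoint n w) := by rw [← hcon v hv, ← hcon w hw]
      rw [hv1, hw1] at this
      exact absurd this (by decide)
    obtain ⟨m, G, y, h1, h2, h3, -⟩ :=
      hc.exists_mem_segment hF hb (gridPoint_mem_gridHull hu) hub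
    exact ⟨m, G, y, h1, h2, h3, hbx ▸ left_mem_segment ℝ _ _⟩
  · exact hc.exists_mem_segment hF hb hx hbx

theorem SignCone.exists_face {σ : SignType} {F x} (h : SignCone lab n q face σ F x) :
    ∃ i, face i F := by
  cases h with
  | pure hF _ _ => exact ⟨_, hF⟩
  | cone hF _ _ _ _ _ => exact ⟨_, hF⟩

theorem SignCone.exists_vertex (hc : IsGridComplex n face) {σ : SignType} {F x}
    (h : SignCone lab n q face σ F x) : ∃ v ∈ F, lab (gridPoint n v) = σ := by
  induction h with
  | pure hF h _ => exact (hc.nonempty hF).imp fun v hv => ⟨hv, h v hv⟩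
  | cone _ _ hGF _ _ _ ih => exact ih.imp fun v hv => ⟨hGF.subset hv.1, hv.2⟩

/-- Unwinding the cones, `x` is obtained from vertices labelled `σ` by joining with centres, which
are averages of boundary points. This puts `x` in the situation of
`Splits.infDist_le_of_mem_convexHull` for the label `-σ`. -/
theorem SignCone.mem_convexHull (hc : IsGridComplex n face)
    (hlab : ∀ v, IsGridVertex n v → lab (gridPoint n v) = 1 ∨ lab (gridPoint n v) = -1)
    {σ : SignType} {F x} (h : SignCone lab n q face σ F x) :
    x ∈ convexHull ℝ ({y | ∃ v ∈ F, lab (gridPoint n v) = σ ∧ gridPoint n v = y} ∪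
      (boundaryPoints lab n q face F : Set _)) := by
  induction h with
  | pure hF h hx =>
    refine convexHull_mono ?_ hx
    rintro _ ⟨v, hv, rfl⟩
    exact Or.inl ⟨v, hv, h v hv, rfl⟩
  | cone hF hG hGF hmix _ hx ih =>
    refine (convex_convexHull ℝ _).segment_subset
      (convexHull_mono Set.subset_union_right (hc.center_mem_convexHull hlab hF hmix)) ?_ hx
    refine convexHull_mono (Set.union_subset_union ?_ ?_) ih
    · rintro _ ⟨v, hv, h1, rfl⟩
      exact ⟨v, hGF.subset hv, h1, rfl⟩
    · intro p hp
      obtain ⟨a, ha, b, hb, h⟩ := mem_boundaryPoints.1 hp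
      exact mem_boundaryPoints.2 ⟨a, hGF.subset ha, b, hGF.subset hb, h⟩

theorem SignCone.mem_gridHull (hc : IsGridComplex n face)
    (hlab : ∀ v, IsGridVertex n v → lab (gridPoint n v) = 1 ∨ lab (gridPoint n v) = -1)
    {σ : SignType} {F x} (h : SignCone lab n q face σ F x) : x ∈ gridHull n F := by
  refine convexHull_min (Set.union_subset ?_ (boundaryPoints_subset_gridHull F))
    (convex_gridHull F) (h.mem_convexHull hc hlab)
  rintro _ ⟨v, hv, -, rfl⟩
  exact gridPoint_mem_gridHull hv

/-- For a mixed `F`, the cone over `K` contains its base. Otherwise a vertex of `K` labelled `σ`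
forces all the vertices of `F` to be labelled `σ`. -/
theorem SignCone.mono (hc : IsGridComplex n face)
    (hlab : ∀ v, IsGridVertex n v → lab (gridPoint n v) = 1 ∨ lab (gridPoint n v) = -1)
    {σ : SignType} (hσ : σ = 1 ∨ σ = -1) {K x} (h : SignCone lab n q face σ K x) {i F}
    (hF : face i F) (hKF : K ⊆ F) : SignCone lab n q face σ F x := by
  rcases hKF.eq_or_ssubset with rfl | hss
  · exact h
  obtain ⟨m, hK⟩ := h.exists_face
  by_cases hmix : IsMixed lab n F
  · exact .cone hF hK hss hmix h (right_mem_segment ℝ _ _)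
  · obtain ⟨v, hv, hvσ⟩ := h.exists_vertex hc
    refine .pure hF (fun w hw => ?_) (gridHull_mono hKF (h.mem_gridHull hc hlab))
    by_contra hne
    have hw' := hlab w (hc.isGridVertex hF hw)
    apply hmix
    rcases hσ with rfl | rfl
    · exact ⟨⟨v, hKF hv, hvσ⟩, ⟨w, hw, hw'.resolve_left hne⟩⟩
    · exact ⟨⟨w, hw, hw'.resolve_right hne⟩, ⟨v, hKF hv, hvσ⟩⟩

/-- The parts with sign `1` and `-1` cover each face. -/
theorem IsGridComplex.signCone_or (hc : IsGridComplex n face)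
    (hlab : ∀ v, IsGridVertex n v → lab (gridPoint n v) = 1 ∨ lab (gridPoint n v) = -1)
    {i F} (hF : face i F) {x : EuclideanSpace ℝ (Fin d)} (hx : x ∈ gridHull n F) :
    SignCone lab n q face 1 F x ∨ SignCone lab n q face (-1) F x := by
  induction F using Finset.strongInductionOn generalizing i x with
  | _ F ih =>
    by_cases hmix : IsMixed lab n F
    · obtain ⟨m, G, y, hG, hGF, hy, hseg⟩ := hc.exists_mem_segment_center (q := q) hlab hF hmix hx
      exact (ih G hGF hG hy).imp (fun h => .cone hF hG hGF hmix h hseg)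
        (fun h => .cone hF hG hGF hmix h hseg)
    · by_cases h1 : ∃ v ∈ F, lab (gridPoint n v) = 1
      · refine Or.inl (.pure hF (fun w hw => ?_) hx)
        exact (hlab w (hc.isGridVertex hF hw)).resolve_right fun h => hmix ⟨h1, w, hw, h⟩
      · refine Or.inr (.pure hF (fun w hw => ?_) hx)
        exact (hlab w (hc.isGridVertex hF hw)).resolve_left fun h => h1 ⟨w, hw, h⟩

/-- The part with sign `σ` of a subface is the trace of the part with sign `σ` of the face. -/
theorem SignCone.restrict (hn : 2 ≤ n) (hc : IsGridComplex n face)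
    (hlab : ∀ v, IsGridVertex n v → lab (gridPoint n v) = 1 ∨ lab (gridPoint n v) = -1)
    {σ : SignType} (hσ : σ = 1 ∨ σ = -1) {F x} (h : SignCone lab n q face σ F x) {m K}
    (hK : face m K) (hKF : K ⊆ F) (hx : x ∈ gridHull n K) : SignCone lab n q face σ K x := by
  induction h generalizing m K with
  | pure hF h _ => exact .pure hK (fun v hv => h v (hKF hv)) hx
  | @cone i F m' G x y hF hG hGF hmix hGy hseg ih =>
    rcases hKF.eq_or_ssubset with rfl | hss
    · exact .cone hF hG hGF hmix hGy hseg
    have hcx := hc.center_notMem (q := q) hn hlab hF hmix hK hss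
    have hyG := hGy.mem_gridHull hc hlab
    -- If `x` were strictly between the centre and `y`, extremality of `K` would put the centre in
    -- `K`. So `y = x`, which lies on a common face of `G` and `K`.
    by_cases hyx : y = x
    · subst hyx
      obtain ⟨l, K', hK', h1, h2, h3⟩ := hc.inter hG hK hyG hx
      exact (ih hK' h1 h3).mono hc hlab hσ hK h2
    · refine absurd ((hc.extreme hF hK hKF).left_mem_of_mem_openSegment
        (hc.center_mem_gridHull hlab hF hmix) (gridHull_mono hGF.subset hyG) hx
        (mem_openSegment_of_ne_left_right ?_ hyx hseg)) hcx
      rintro rfl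
      exact hcx hx

/-- The two parts of a face meet in the interface only. -/
theorem IsGridComplex.zeroCone_of_signCone (hn : 2 ≤ n) (hc : IsGridComplex n face)
    (hlab : ∀ v, IsGridVertex n v → lab (gridPoint n v) = 1 ∨ lab (gridPoint n v) = -1)
    {F x} (hp : SignCone lab n q face 1 F x) (hm : SignCone lab n q face (-1) F x) :
    ZeroCone lab n q face F x := by
  induction F using Finset.strongInductionOn generalizing x with
  | _ F ih =>
    cases hp with
    | pure hF h _ =>
      obtain ⟨v, hv, h'⟩ := hm.exists_vertex hc
      rw [h v hv] at h'
      exact absurd h' (by decide)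
    | @cone i _ m G _ y hF hG hGF hmix hGy hseg =>
      cases hm with
      | pure hF h _ =>
        obtain ⟨v, hv, h'⟩ := hmix.1
        rw [h v hv] at h'
        exact absurd h' (by decide)
      | @cone i' _ m' G' _ y' _ hG' hGF' _ hGy' hseg' =>
        set b := center lab n q face F with hb
        have hyG := hGy.mem_gridHull hc hlab
        have hyG' := hGy'.mem_gridHull hc hlab
        have hbF : b ∈ gridHull n F := hc.center_mem_gridHull hlab hF hmix
        have hbG : b ∉ gridHull n G := hc.center_notMem hn hlab hF hmix hG hGF
        have hbG' : b ∉ gridHull n G' := hc.center_notMem hn hlab hF hmix hG' hGF'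
        by_cases hxb : x = b
        · rw [hxb]
          exact .apex hF hmix
        -- Both points are on the same ray from `b`. If they differed, one would be strictly between
        -- `b` and the other, and extremality of its face would put `b` there.
        have hyy : y = y' := by
          by_contra hne
          have key : y ∈ segment ℝ b y' ∨ y' ∈ segment ℝ b y := by
            rw [segment_eq_image'] at hseg hseg'
            obtain ⟨t, ht, hxt⟩ := hseg
            obtain ⟨t', ht', hxt'⟩ := hseg'
            have ht0 : 0 < t := ht.1.lt_of_ne fun h => hxb (by simp [← hxt, ← h])
            have ht0' : 0 < t' := ht'.1.lt_of_ne fun h => hxb (by simp [← hxt', ← h])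
            have heq : t • (y - b) = t' • (y' - b) := by
              have : b + t • (y - b) = b + t' • (y' - b) := hxt.trans hxt'.symm
              exact add_left_cancel this
            rcases le_total t' t with hle | hle
            · left
              rw [segment_eq_image']
              refine ⟨t' / t, ⟨by positivity, (div_le_one ht0).2 hle⟩, ?_⟩
              simp only [div_eq_inv_mul, mul_smul, ← heq, inv_smul_smul₀ ht0.ne',
                add_sub_cancel]
            · right
              rw [segment_eq_image']
              refine ⟨t / t', ⟨by positivity, (div_le_one ht0').2 hle⟩, ?_⟩
              simp only [div_eq_inv_mul, mul_smul, heq, inv_smul_smul₀ ht0'.ne',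
                add_sub_cancel]
          rcases key with hk | hk
          · refine hbG ((hc.extreme hF hG hGF.subset).left_mem_of_mem_openSegment hbF
              (gridHull_mono hGF'.subset hyG') hyG (mem_openSegment_of_ne_left_right ?_ ?_ hk))
            · rintro h; exact hbG (h ▸ hyG)
            · exact fun h => hne h.symm
          · refine hbG' ((hc.extreme hF hG' hGF'.subset).left_mem_of_mem_openSegment hbF
              (gridHull_mono hGF.subset hyG) hyG' (mem_openSegment_of_ne_left_right ?_ ?_ hk))
            · rintro h; exact hbG' (h ▸ hyG')
            · exact fun h => hne h
        subst hyy
        -- The common projection belongs to both parts of a common face of `G` and `G'`, where the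
        -- induction applies.
        obtain ⟨l, K, hK, h1, h2, h3⟩ := hc.inter hG hG' hyG hyG'
        refine .cone hF hK (h1.trans_ssubset hGF) (ih K (h1.trans_ssubset hGF) ?_ ?_) hseg
        · exact hGy.restrict hn hc hlab (Or.inl rfl) hK h1 h3
        · exact hGy'.restrict hn hc hlab (Or.inr rfl) hK h2 h3

/-- The part with sign `σ` of a face is compact. -/
theorem isCompact_signCone (σ : SignType)
    {i F} (hF : face i F) : IsCompact {x | SignCone lab n q face σ F x} := by
  induction F using Finset.strongInductionOn generalizing i with
  | _ F ih =>
    by_cases hpure : ∀ v ∈ F, lab (gridPoint n v) = σ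
    · by_cases hmix : IsMixed lab n F
      · obtain ⟨⟨v, hv, hv1⟩, ⟨w, hw, hw1⟩⟩ := hmix
        have h1 := hpure v hv
        have h2 := hpure w hw
        rw [hv1] at h1
        rw [hw1, ← h1] at h2
        exact absurd h2 (by decide)
      convert isCompact_gridHull (n := n) F using 1
      ext x
      refine ⟨fun h => ?_, fun h => .pure hF hpure h⟩
      cases h with
      | pure _ _ h => exact h
      | cone _ _ _ h _ _ => exact absurd h hmix
    · have heq : {x | SignCone lab n q face σ F x} =
          ⋃ G ∈ {G | G ⊂ F ∧ (∃ m, face m G) ∧ IsMixed lab n F},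
            (fun p : ℝ × EuclideanSpace ℝ (Fin d) =>
              center lab n q face F + p.1 • (p.2 - center lab n q face F)) ''
              (Set.Icc (0 : ℝ) 1 ×ˢ {y | SignCone lab n q face σ G y}) := by
        ext x
        simp only [Set.mem_ofPred_eq, Set.mem_iUnion, Set.mem_image, Set.mem_prod, Prod.exists]
        constructor
        · intro h
          cases h with
          | pure _ h _ => exact absurd h hpure
          | @cone _ _ m G _ y _ hG hGF hmix hGy hseg =>
            rw [segment_eq_image'] at hseg
            obtain ⟨t, ht, hx⟩ := hseg
            exact ⟨G, ⟨hGF, ⟨m, hG⟩, hmix⟩, t, y, ⟨ht, hGy⟩, hx⟩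
        · rintro ⟨G, ⟨hGF, ⟨m, hG⟩, hmix⟩, t, y, ⟨ht, hGy⟩, hx⟩
          refine .cone hF hG hGF hmix hGy ?_
          rw [segment_eq_image']
          exact ⟨t, ht, hx⟩
      have hfin : {G | G ⊂ F ∧ (∃ m, face m G) ∧ IsMixed lab n F}.Finite :=
        F.powerset.finite_toSet.subset fun G hG => by
          simpa using hG.1.subset
      rw [heq]
      refine hfin.isCompact_biUnion fun G hG => ?_
      obtain ⟨hGF, ⟨m, hG'⟩, -⟩ := hG
      exact (isCompact_Icc.prod (ih G hGF hG')).image (by fun_prop)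

end Complex

/-! ### Flags, crossings of the interface, carriers -/

section Complex

variable {d : ℕ} {lab : EuclideanSpace ℝ (Fin d) → SignType} {n q : ℕ}
  {face : ℕ → Finset (Fin d → ℕ) → Prop}

theorem ZeroCone.exists_face {F x} (h : ZeroCone lab n q face F x) : ∃ i, face i F := by
  cases h with
  | apex hF _ => exact ⟨_, hF⟩
  | cone hF _ _ _ _ => exact ⟨_, hF⟩

theorem ZeroCone.mono {K x} (h : ZeroCone lab n q face K x) {i F} (hF : face i F) (hKF : K ⊆ F) :
    ZeroCone lab n q face F x := by
  rcases hKF.eq_or_ssubset with rfl | hss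
  · exact h
  · obtain ⟨m, hK⟩ := h.exists_face
    exact .cone hF hK hss h (right_mem_segment ℝ _ _)

/-- `Φ 1 ⊆ ... ⊆ Φ i = F` is a flag of faces whose edge carries a boundary point. -/
structure IsFlag (lab : EuclideanSpace ℝ (Fin d) → SignType) (n q : ℕ)
    (face : ℕ → Finset (Fin d → ℕ) → Prop) (i : ℕ) (F : Finset (Fin d → ℕ))
    (Φ : ℕ → Finset (Fin d → ℕ)) : Prop where
  one_le : 1 ≤ i
  face_le : ∀ m, 1 ≤ m → m ≤ i → face m (Φ m)
  subset : ∀ m, 1 ≤ m → m < i → Φ m ⊆ Φ (m + 1)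
  top : Φ i = F
  nonempty : (boundaryPoints lab n q face (Φ 1)).Nonempty

/-- `step` adds one dimension at a time. The lower members of the flag are kept, so that the simplex
spanned by their centres is a face of the new one. -/
theorem IsFlag.extend (hc : IsGridComplex n face) {m G Φ} (h : IsFlag lab n q face m G Φ)
    {i F} (hF : face i F) (hGF : G ⊆ F) :
    ∃ Ψ, IsFlag lab n q face i F Ψ ∧ ∀ l ≤ m, Ψ l = Φ l := by
  have hG : face m G := h.top ▸ h.face_le m h.one_le le_rfl
  have hmi := (hc.dim_le hF hG hGF).1
  induction hk : i - m generalizing m G Φ with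
  | zero =>
    have hmi : m = i := by omega
    obtain rfl := (hc.dim_le hF hG hGF).2 hmi
    subst hmi
    exact ⟨Φ, h, fun _ _ => rfl⟩
  | succ k ih =>
    obtain ⟨H, hH, hGH, hHF⟩ := hc.step hF hG hGF (by omega)
    have h1 := h.one_le
    have hflag : IsFlag lab n q face (m + 1) H (Function.update Φ (m + 1) H) := by
      refine ⟨by omega, fun l hl hlm => ?_, fun l hl hlm => ?_, by simp, ?_⟩
      · rcases hlm.eq_or_lt with rfl | hlt
        · simpa using hH
        · rw [Function.update_of_ne (by omega)]
          exact h.face_le l hl (by omega)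
      · rw [Function.update_of_ne (by omega)]
        rcases (show l ≤ m by omega).eq_or_lt with rfl | hlt
        · simpa [h.top] using hGH
        · rw [Function.update_of_ne (by omega)]
          exact h.subset l hl hlt
      · rw [Function.update_of_ne (by omega)]
        exact h.nonempty
    obtain ⟨Ψ, hΨ, hΨ'⟩ := ih hflag hHF hH (by omega) (by omega)
    refine ⟨Ψ, hΨ, fun l hl => ?_⟩
    rw [hΨ' l (by omega), Function.update_of_ne (by omega)]

theorem IsFlag.center_mem {i F Φ} (h : IsFlag lab n q face i F Φ) :
    center lab n q face F ∈ convexHull ℝ ((fun m => center lab n q face (Φ m)) '' Set.Icc 1 i) :=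
  subset_convexHull ℝ _ ⟨i, ⟨h.one_le, le_rfl⟩, by simp only [h.top]⟩

/-- Successive cones may skip dimensions; filling in the missing faces only enlarges the simplex.
Below an apex, the flag starts at a mixed edge. -/
theorem ZeroCone.exists_flag (hc : IsGridComplex n face)
    (hlab : ∀ v, IsGridVertex n v → lab (gridPoint n v) = 1 ∨ lab (gridPoint n v) = -1)
    {F x} (h : ZeroCone lab n q face F x) {i} (hF : face i F) :
    ∃ Φ, IsFlag lab n q face i F Φ ∧
      x ∈ convexHull ℝ ((fun m => center lab n q face (Φ m)) '' Set.Icc 1 i) := by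
  induction h generalizing i with
  | @apex _ F _ hmix =>
    obtain ⟨a, ha, b, hb, h1, h2, h3⟩ := hc.edge (fun v => lab (gridPoint n v)) hF
      (fun v hv => hlab v (hc.isGridVertex hF hv)) hmix.1 hmix.2
    have hflag : IsFlag lab n q face 1 {a, b} (fun _ => {a, b}) :=
      ⟨le_rfl, fun m h h' => by rwa [le_antisymm h' h], fun m h h' => by omega, rfl,
        ⟨_, mem_boundaryPoints.2 ⟨a, by simp, b, by simp, h1, h2, h3, rfl⟩⟩⟩
    obtain ⟨Φ, hΦ, -⟩ := hflag.extend hc hF (by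
      intro v hv
      rcases Finset.mem_insert.1 hv with rfl | hv
      · exact ha
      · rwa [Finset.mem_singleton.1 hv])
    exact ⟨Φ, hΦ, hΦ.center_mem⟩
  | cone _ hG hGF _ hseg ih =>
    obtain ⟨Φ, hΦ, hy⟩ := ih hG
    obtain ⟨Ψ, hΨ, hΨΦ⟩ := hΦ.extend hc hF hGF.subset
    refine ⟨Ψ, hΨ, (convex_convexHull ℝ _).segment_subset hΨ.center_mem ?_ hseg⟩
    refine convexHull_mono ?_ hy
    rintro _ ⟨l, hl, rfl⟩
    exact ⟨l, ⟨hl.1, hl.2.trans (hc.dim_le hF hG hGF.subset).1⟩, by simp only [hΨΦ l hl.2]⟩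

/-- The part with sign `σ` of the complex. -/
def signRegion (lab : EuclideanSpace ℝ (Fin d) → SignType) (n q : ℕ)
    (face : ℕ → Finset (Fin d → ℕ) → Prop) (σ : SignType) : Set (EuclideanSpace ℝ (Fin d)) :=
  {x | ∃ C, face d C ∧ SignCone lab n q face σ C x}

theorem IsGridComplex.isClosed_signRegion (hc : IsGridComplex n face) (σ : SignType) :
    IsClosed (signRegion lab n q face σ) := by
  have heq : signRegion lab n q face σ =
      ⋃ C ∈ {C | face d C}, {x | SignCone lab n q face σ C x} := by
    ext x
    simp [signRegion]
  have hfin : {C | face d C}.Finite := by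
    refine (Fintype.piFinset fun _ : Fin d => Finset.range n).powerset.finite_toSet.subset
      fun C hC => ?_
    simp only [Finset.coe_powerset, Set.mem_preimage, Set.mem_powerset_iff, Finset.coe_subset]
    intro v hv
    rw [Fintype.mem_piFinset]
    intro j
    have := hc.isGridVertex hC hv j
    rw [Finset.mem_range]
    omega
  rw [heq]
  exact hfin.isClosed_biUnion fun C hC => (isCompact_signCone σ hC).isClosed

/-- A segment leaving the part with sign `σ` crosses the interface. -/
theorem IsGridComplex.exists_zeroCone_mem_segment (hn : 2 ≤ n) (hc : IsGridComplex n face)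
    (hlab : ∀ v, IsGridVertex n v → lab (gridPoint n v) = 1 ∨ lab (gridPoint n v) = -1)
    {σ : SignType} (hσ : σ = 1 ∨ σ = -1) {x y : EuclideanSpace ℝ (Fin d)}
    (hxy : segment ℝ x y ⊆ unitCube d) (hx : x ∈ signRegion lab n q face σ)
    (hy : y ∉ signRegion lab n q face σ) :
    ∃ z ∈ segment ℝ x y, ∃ C, face d C ∧ ZeroCone lab n q face C z := by
  have hcov : unitCube d ⊆ signRegion lab n q face 1 ∪ signRegion lab n q face (-1) := by
    intro z hz
    obtain ⟨C, hC, hzC⟩ := hc.cover z hz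
    exact (hc.signCone_or hlab hC hzC).imp (fun h => ⟨C, hC, h⟩) (fun h => ⟨C, hC, h⟩)
  have hy' := hcov (hxy (right_mem_segment ℝ x y))
  -- A connected segment covered by two closed sets, and meeting each of them, meets their
  -- intersection.
  have hmeet : (segment ℝ x y ∩ (signRegion lab n q face 1 ∩
      signRegion lab n q face (-1))).Nonempty := by
    refine isPreconnected_closed_iff.1 (convex_segment x y).isPreconnected _ _
      (hc.isClosed_signRegion 1) (hc.isClosed_signRegion (-1)) (hxy.trans hcov) ?_ ?_
    · rcases hσ with rfl | rfl
      · exact ⟨x, left_mem_segment ℝ x y, hx⟩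
      · exact ⟨y, right_mem_segment ℝ x y, hy'.resolve_right hy⟩
    · rcases hσ with rfl | rfl
      · exact ⟨y, right_mem_segment ℝ x y, hy'.resolve_left hy⟩
      · exact ⟨x, left_mem_segment ℝ x y, hx⟩
  obtain ⟨z, hz, ⟨C, hC, hzC⟩, ⟨C', hC', hzC'⟩⟩ := hmeet
  obtain ⟨l, K, hK, h1, h2, h3⟩ := hc.inter hC hC' (hzC.mem_gridHull hc hlab)
    (hzC'.mem_gridHull hc hlab)
  exact ⟨z, hz, C, hC, (hc.zeroCone_of_signCone hn hlab (hzC.restrict hn hc hlab (Or.inl rfl) hK h1 h3)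
    (hzC'.restrict hn hc hlab (Or.inr rfl) hK h2 h3)).mono hC h1⟩

theorem convex_unitCube : Convex ℝ (unitCube d) := by
  intro x hx y hy a b ha hb hab j
  have h1 := hx j
  have h2 := hy j
  simp only [PiLp.add_apply, PiLp.smul_apply, smul_eq_mul]
  constructor <;> nlinarith

theorem gridPoint_mem_unitCube (hn : 2 ≤ n) {v : Fin d → ℕ} (hv : IsGridVertex n v) :
    gridPoint n v ∈ unitCube d := by
  intro j
  have hε := meshSize_pos hn
  have h2 : (2 : ℝ) ≤ n := by exact_mod_cast hn
  have h1 : (v j : ℝ) + 1 ≤ n := by exact_mod_cast hv j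
  rw [gridPoint_apply]
  refine ⟨by positivity, ?_⟩
  rw [meshSize, mul_one_div, div_le_one (by linarith)]
  linarith

theorem IsGridComplex.gridHull_subset_unitCube (hn : 2 ≤ n) (hc : IsGridComplex n face)
    {i F} (hF : face i F) : gridHull n F ⊆ unitCube d := by
  refine convexHull_min ?_ convex_unitCube
  rintro _ ⟨v, hv, rfl⟩
  exact gridPoint_mem_unitCube hn (hc.isGridVertex hF hv)

/-- A point on an extreme subset `W` of the cube lies on a face with vertices in `W`. -/
theorem IsGridComplex.exists_carrier (hn : 2 ≤ n) (hc : IsGridComplex n face) {i F}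
    (hF : face i F) {W : Set (EuclideanSpace ℝ (Fin d))} (hW : IsExtreme ℝ (unitCube d) W)
    {x : EuclideanSpace ℝ (Fin d)} (hxF : x ∈ gridHull n F) (hxW : x ∈ W) :
    ∃ m K, face m K ∧ K ⊆ F ∧ x ∈ gridHull n K ∧ ∀ v ∈ K, gridPoint n v ∈ W := by
  induction F using Finset.strongInductionOn generalizing i with
  | _ F ih =>
    by_cases hmin : ∃ m G, face m G ∧ G ⊂ F ∧ x ∈ gridHull n G
    · obtain ⟨m, G, hG, hGF, hxG⟩ := hmin
      obtain ⟨l, K, hK, hKG, h⟩ := ih G hGF hG hxG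
      exact ⟨l, K, hK, hKG.trans hGF.subset, h⟩
    · push Not at hmin
      refine ⟨i, F, hF, subset_rfl, hxF, fun v hv => ?_⟩
      have hvF := gridPoint_mem_gridHull (n := n) hv
      -- Being on no proper face, `x` lies in an open segment from the vertex to another point of
      -- `F`; extremality of `W` then captures the vertex.
      obtain ⟨t, ht, hmem⟩ := hc.extend hF hxF hmin _ hvF
      have hsub := hc.gridHull_subset_unitCube hn hF
      refine hW.left_mem_of_mem_openSegment (hsub hvF) (hsub hmem) hxW ?_
      refine ⟨t / (1 + t), 1 / (1 + t), by positivity, by positivity, by field_simp; ring, ?_⟩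
      have h1 : (1 : ℝ) + t ≠ 0 := by positivity
      rw [smul_add, smul_smul, div_mul_eq_mul_div, one_mul, smul_sub, ← add_sub_assoc,
        add_sub_cancel, ← add_smul, ← add_div, div_self h1, one_smul]

end Complex

/-! ### Distance estimates on the faces of the cube -/

section Faces

variable {d : ℕ} {lab : EuclideanSpace ℝ (Fin d) → SignType} {n q : ℕ}
  {face : ℕ → Finset (Fin d → ℕ) → Prop} {M : Set (EuclideanSpace ℝ (Fin d))}

/-- The face of the unit cube with free coordinates in `J`, the other ones being given by `a`. -/
def cubeFace (J : Finset (Fin d)) (a : Fin d → ℝ) : Set (EuclideanSpace ℝ (Fin d)) :=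
  {x | x ∈ unitCube d ∧ ∀ j, j ∉ J → x j = a j}

theorem cubeFace_univ (a : Fin d → ℝ) : cubeFace Finset.univ a = unitCube d := by
  ext x; simp [cubeFace]

theorem convex_cubeFace (J : Finset (Fin d)) (a : Fin d → ℝ) : Convex ℝ (cubeFace J a) := by
  intro x hx y hy u v hu hv huv
  refine ⟨convex_unitCube hx.1 hy.1 hu hv huv, fun j hj => ?_⟩
  simp only [PiLp.add_apply, PiLp.smul_apply, smul_eq_mul, hx.2 j hj, hy.2 j hj]
  rw [← add_mul, huv, one_mul]

theorem isClosed_cubeFace (J : Finset (Fin d)) (a : Fin d → ℝ) : IsClosed (cubeFace J a) := by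
  have : cubeFace J a = (⋂ j, {x : EuclideanSpace ℝ (Fin d) | 0 ≤ x j} ∩ {x | x j ≤ 1}) ∩
      ⋂ j, ⋂ (_ : j ∉ J), {x | x j = a j} := by
    ext x
    simp [cubeFace, unitCube]
  rw [this]
  refine (isClosed_iInter fun j => ?_).inter (isClosed_iInter fun j => isClosed_iInter fun _ => ?_)
  · exact (isClosed_le (by fun_prop) (by fun_prop)).inter (isClosed_le (by fun_prop) (by fun_prop))
  · exact isClosed_eq (by fun_prop) (by fun_prop)

theorem isExtreme_cubeFace (J : Finset (Fin d)) {a : Fin d → ℝ} (ha : ∀ j, a j = 0 ∨ a j = 1) :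
    IsExtreme ℝ (unitCube d) (cubeFace J a) := by
  refine ⟨fun x hx => hx.1, fun x hx y hy z hz hseg => ⟨hx, fun j hj => ?_⟩⟩
  obtain ⟨u, v, hu, hv, huv, rfl⟩ := hseg
  have h1 := hz.2 j hj
  simp only [PiLp.add_apply, PiLp.smul_apply, smul_eq_mul] at h1
  have hxj := hx j
  have hyj := hy j
  rcases ha j with h | h <;> rw [h] at h1 ⊢
  · have := mul_nonneg hv.le hyj.1
    have h3 := mul_nonneg hu.le hxj.1
    have h2 : u * x j = 0 := by linarith
    exact (mul_eq_zero.1 h2).resolve_left hu.ne'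
  · have := mul_nonneg hv.le (sub_nonneg.2 hyj.2)
    have h3 := mul_nonneg hu.le (sub_nonneg.2 hxj.2)
    have h2 : u * (1 - x j) = 0 := by nlinarith
    have := (mul_eq_zero.1 h2).resolve_left hu.ne'
    linarith

theorem dist_le_sqrt_card_mul {J : Finset (Fin d)} {ε : ℝ} (hε : 0 ≤ ε)
    {x y : EuclideanSpace ℝ (Fin d)} (h : ∀ j, |x j - y j| ≤ ε) (hJ : ∀ j, j ∉ J → x j = y j) :
    dist x y ≤ √J.card * ε := by
  rw [EuclideanSpace.dist_eq, Real.sqrt_le_left (by positivity), mul_pow,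
    Real.sq_sqrt (Nat.cast_nonneg _)]
  calc ∑ j, dist (x j) (y j) ^ 2 = ∑ j ∈ J, dist (x j) (y j) ^ 2 := by
        refine (Finset.sum_subset (Finset.subset_univ J) fun j _ hj => ?_).symm
        rw [hJ j hj, dist_self]; norm_num
    _ ≤ ∑ _j ∈ J, ε ^ 2 := Finset.sum_le_sum fun j _ => by
        rw [Real.dist_eq]
        exact pow_le_pow_left₀ (abs_nonneg _) (h j) 2
    _ = J.card * ε ^ 2 := by rw [Finset.sum_const, nsmul_eq_mul]

theorem one_div_two_pow_le_meshSize (hn : 2 ≤ n) (hq : -Real.logb 2 (meshSize n) ≤ q) :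
    1 / 2 ^ q ≤ meshSize n := by
  have hε := meshSize_pos hn
  have h1 : (meshSize n)⁻¹ ≤ (2 : ℝ) ^ (q : ℝ) := by
    rw [← Real.logb_le_iff_le_rpow (by norm_num) (inv_pos.2 hε), Real.logb_inv]
    exact hq
  rw [Real.rpow_natCast] at h1
  rw [one_div]
  exact inv_le_of_inv_le₀ hε h1

theorem IsGridComplex.dist_le_of_mem_gridHull (hn : 2 ≤ n) (hc : IsGridComplex n face) {i K}
    (hK : face i K) {J : Finset (Fin d)} {a : Fin d → ℝ}
    (hKW : ∀ v ∈ K, gridPoint n v ∈ cubeFace J a) {x y : EuclideanSpace ℝ (Fin d)}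
    (hx : x ∈ gridHull n K) (hy : y ∈ gridHull n K) : dist x y ≤ √J.card * meshSize n := by
  obtain ⟨k, -, hk⟩ := hc.cube hK
  have hε := meshSize_pos hn
  have hsub : gridHull n K ⊆ cubeFace J a := by
    refine convexHull_min ?_ (convex_cubeFace J a)
    rintro _ ⟨v, hv, rfl⟩
    exact hKW v hv
  have hbox : ∀ j, gridHull n K ⊆ {x | k j * meshSize n ≤ x j ∧ x j ≤ (k j + 1) * meshSize n} := by
    intro j
    refine convexHull_min ?_ ?_
    · rintro _ ⟨v, hv, rfl⟩
      have h1 := hk v hv j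
      have h2 : (k j : ℝ) ≤ v j := by exact_mod_cast h1.1
      have h3 : (v j : ℝ) ≤ k j + 1 := by exact_mod_cast h1.2
      exact ⟨mul_le_mul_of_nonneg_right h2 hε.le, mul_le_mul_of_nonneg_right h3 hε.le⟩
    · have hlin : IsLinearMap ℝ fun x : EuclideanSpace ℝ (Fin d) => x j :=
        ⟨fun _ _ => rfl, fun _ _ => rfl⟩
      exact (convex_halfSpace_ge hlin _).inter (convex_halfSpace_le hlin _)
  refine dist_le_sqrt_card_mul hε.le (fun j => ?_) fun j hj => ?_
  · have h1 := hbox j hx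
    have h2 := hbox j hy
    simp only [Set.mem_ofPred_eq] at h1 h2
    rw [abs_le]
    constructor <;> linarith [h1.1, h1.2, h2.1, h2.2]
  · rw [(hsub hx).2 j hj, (hsub hy).2 j hj]

/-- Near a boundary point there are points of the face whose label differs from a given one. -/
theorem IsGridComplex.exists_near_boundaryPoint (hn : 2 ≤ n) (hc : IsGridComplex n face)
    (hq : -Real.logb 2 (meshSize n) ≤ q) {i K} (hK : face i K) {J : Finset (Fin d)}
    {a : Fin d → ℝ} (hKW : ∀ v ∈ K, gridPoint n v ∈ cubeFace J a) {σ : SignType}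
    (hσ : σ = 1 ∨ σ = -1) {b : EuclideanSpace ℝ (Fin d)}
    (hb : b ∈ boundaryPoints lab n q face K) :
    ∃ p ∈ gridHull n K, lab p ≠ σ ∧ dist b p ≤ J.card * meshSize n ^ 2 / 2 := by
  obtain ⟨v, hv, w, hw, -, h1, h2, rfl⟩ := mem_boundaryPoints.1 hb
  have hvK := gridPoint_mem_gridHull (n := n) hv
  have hwK := gridPoint_mem_gridHull (n := n) hw
  have hε := meshSize_pos hn
  -- One factor `meshSize n` comes from the length of the edge, the other from `2 ^ q`; the `1 / 2`
  -- is due to the final midpoint.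
  have hbound : dist (gridPoint n v) (gridPoint n w) / 2 ^ (q + 1) ≤
      J.card * meshSize n ^ 2 / 2 := by
    have h3 := hc.dist_le_of_mem_gridHull hn hK hKW hvK hwK
    have h4 : √(J.card : ℝ) ≤ J.card := by
      rw [Real.sqrt_le_left (Nat.cast_nonneg _)]
      exact_mod_cast Nat.le_self_pow two_ne_zero _
    have h5 : dist (gridPoint n v) (gridPoint n w) ≤ J.card * meshSize n :=
      h3.trans (mul_le_mul_of_nonneg_right h4 hε.le)
    calc dist (gridPoint n v) (gridPoint n w) / 2 ^ (q + 1)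
        = dist (gridPoint n v) (gridPoint n w) * (1 / 2 ^ q) / 2 := by rw [pow_succ]; field_simp
      _ ≤ J.card * meshSize n * meshSize n / 2 := by
          refine div_le_div_of_nonneg_right ?_ (by norm_num)
          exact mul_le_mul h5 (one_div_two_pow_le_meshSize hn hq) (by positivity) (by positivity)
      _ = J.card * meshSize n ^ 2 / 2 := by ring
  obtain ⟨⟨p, hp, hp1, hp2⟩, ⟨p', hp', hp1', hp2'⟩⟩ := exists_near_dichotomy lab q
    (x := gridPoint n v) (y := gridPoint n w) (by rw [h1]; decide) h2
  have hsub := (convex_gridHull (n := n) K).segment_subset hvK hwK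
  rcases hσ with rfl | rfl
  · exact ⟨p, hsub hp, hp1, hp2.trans hbound⟩
  · exact ⟨p', hsub hp', by rw [hp1']; decide, hp2'.trans hbound⟩

/-- A point of the part with sign `-σ` is a convex combination of points close to points not
labelled `σ`, within the face of the cube that contains it. -/
theorem IsGridComplex.exists_hull_of_mem_signRegion (hn : 2 ≤ n) (hc : IsGridComplex n face)
    (hlab : ∀ v, IsGridVertex n v → lab (gridPoint n v) = 1 ∨ lab (gridPoint n v) = -1)
    (hq : -Real.logb 2 (meshSize n) ≤ q) {J : Finset (Fin d)} {a : Fin d → ℝ}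
    (ha : ∀ j, a j = 0 ∨ a j = 1) {σ : SignType} (hσ : σ = 1 ∨ σ = -1)
    {x : EuclideanSpace ℝ (Fin d)} (hx : x ∈ signRegion lab n q face (-σ))
    (hxW : x ∈ cubeFace J a) :
    ∃ Q, x ∈ convexHull ℝ Q ∧ ∀ b ∈ Q, ∃ p ∈ cubeFace J a, lab p ≠ σ ∧
      dist b p ≤ J.card * meshSize n ^ 2 / 2 ∧ dist p x ≤ √J.card * meshSize n := by
  obtain ⟨C, hC, hxC⟩ := hx
  have hε := meshSize_pos hn
  -- Passing to a face `K` carried by the face of the cube keeps all witnesses in the latter, and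
  -- lets its dimension replace `d` in the diameter.
  obtain ⟨m, K, hK, hKC, hxK, hKW⟩ := hc.exists_carrier hn hC (isExtreme_cubeFace J ha)
    (hxC.mem_gridHull hc hlab) hxW
  have hσ' : -σ = 1 ∨ -σ = -1 := by rcases hσ with rfl | rfl <;> decide
  have hxK' := hxC.restrict hn hc hlab hσ' hK hKC hxK
  have hsub : gridHull n K ⊆ cubeFace J a := by
    refine convexHull_min ?_ (convex_cubeFace J a)
    rintro _ ⟨v, hv, rfl⟩
    exact hKW v hv
  refine ⟨_, hxK'.mem_convexHull hc hlab, ?_⟩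
  rintro b (⟨v, hv, hvσ, rfl⟩ | hb)
  · refine ⟨_, hKW v hv, ?_, ?_, hc.dist_le_of_mem_gridHull hn hK hKW
      (gridPoint_mem_gridHull hv) hxK⟩
    · rw [hvσ]; rcases hσ with rfl | rfl <;> decide
    · rw [dist_self]; positivity
  · obtain ⟨p, hp, hpσ, hbp⟩ := hc.exists_near_boundaryPoint hn hq hK hKW hσ hb
    exact ⟨p, hsub hp, hpσ, hbp, hc.dist_le_of_mem_gridHull hn hK hKW hp hxK⟩

/-- All the traces of `M` on the faces of the cube satisfy the assumption on the reach. -/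
def TracesReach (M : Set (EuclideanSpace ℝ (Fin d))) (n : ℕ) (r₀ : ℝ) : Prop :=
  ∀ (J : Finset (Fin d)) (a : Fin d → ℝ), 1 ≤ J.card → (∀ j, a j = 0 ∨ a j = 1) →
    ∃ s R : ℝ, √J.card * meshSize n < s ∧ r₀ / 2 ≤ s ∧ s < R ∧
      ((M ∩ cubeFace J a).Nonempty → UniqueNearest (M ∩ cubeFace J a) R)

/-- Within a face of dimension `i`, a point of the face in the hull of points close to the opposite
label has a distance to `M` bounded by this quantity. -/
noncomputable def traceBound (r₀ : ℝ) (n i : ℕ) : ℝ := (4 / r₀ + 1 / 2) * i * meshSize n ^ 2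

/-- The tangent ball bound `2D²/s + η` with `D = √i ε` and `η = iε²/2`. -/
theorem two_mul_sq_div_add_le {r₀ s ε : ℝ} (hr₀ : 0 < r₀) (hs : r₀ / 2 ≤ s) (i : ℕ) :
    2 * (√i * ε) ^ 2 / s + i * ε ^ 2 / 2 ≤ (4 / r₀ + 1 / 2) * i * ε ^ 2 := by
  rw [mul_pow, Real.sq_sqrt (Nat.cast_nonneg _)]
  have h1 : 2 * (i * ε ^ 2) / s ≤ 2 * (i * ε ^ 2) / (r₀ / 2) :=
    div_le_div_of_nonneg_left (by positivity) (by positivity) hs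
  have h2 : 2 * (i * ε ^ 2) / (r₀ / 2) = 4 / r₀ * (i * ε ^ 2) := by field_simp; ring
  rw [h2] at h1
  linarith

/-- A point labelled `σ` in the part with sign `-σ` is close to the interface, the distance being
at most twice the bound in its face of the cube, minus its distance to `M`. -/
theorem IsGridComplex.exists_zeroCone_near (hn : 2 ≤ n) (hc : IsGridComplex n face)
    (hsp : Splits M lab)
    (hlab : ∀ v, IsGridVertex n v → lab (gridPoint n v) = 1 ∨ lab (gridPoint n v) = -1)
    (hq : -Real.logb 2 (meshSize n) ≤ q) {r₀ : ℝ} (hr₀ : 0 < r₀) (hM : TracesReach M n r₀)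
    {σ : SignType} (hσ : σ = 1 ∨ σ = -1) {J : Finset (Fin d)} {a : Fin d → ℝ}
    (ha : ∀ j, a j = 0 ∨ a j = 1) {y : EuclideanSpace ℝ (Fin d)} (hyW : y ∈ cubeFace J a)
    (hy : lab y = σ) (hyS : y ∈ signRegion lab n q face (-σ)) :
    ∃ z, (∃ C, face d C ∧ ZeroCone lab n q face C z) ∧ (M ∩ cubeFace J a).Nonempty ∧
      dist y z + Metric.infDist y (M ∩ cubeFace J a) ≤ 2 * traceBound r₀ n J.card := by
  have hσ0 : σ ≠ 0 := by rcases hσ with rfl | rfl <;> decide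
  have hσ' : -σ = 1 ∨ -σ = -1 := by rcases hσ with rfl | rfl <;> decide
  have hε := meshSize_pos hn
  induction hN : J.card generalizing J a y with
  | zero =>
    -- At a vertex of the cube `D = 0`, so `y` itself would have another label.
    exfalso
    obtain ⟨Q, hyQ, hQ⟩ := hc.exists_hull_of_mem_signRegion hn hlab hq ha hσ hyS hyW
    obtain ⟨b, hb⟩ := (convexHull_nonempty_iff (𝕜 := ℝ)).1 ⟨y, hyQ⟩
    obtain ⟨p, -, hp, -, hpy⟩ := hQ b hb
    rw [hN, Nat.cast_zero, Real.sqrt_zero, zero_mul] at hpy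
    rw [dist_le_zero.1 hpy] at hp
    exact hp hy
  | succ N ih =>
    obtain ⟨s, R, hDs, hr₀s, hsR, hU⟩ := hM J a (by omega) ha
    have hWX : cubeFace J a ⊆ unitCube d := fun x hx => hx.1
    have hbound : ∀ x ∈ cubeFace J a, lab x = σ → x ∈ signRegion lab n q face (-σ) →
        (M ∩ cubeFace J a).Nonempty ∧ 0 < Metric.infDist x (M ∩ cubeFace J a) ∧
        Metric.infDist x (M ∩ cubeFace J a) ≤ √J.card * meshSize n ∧
        Metric.infDist x (M ∩ cubeFace J a) ≤ traceBound r₀ n (N + 1) := by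
      intro x hxW hx hxS
      obtain ⟨Q, hxQ, hQ⟩ := hc.exists_hull_of_mem_signRegion hn hlab hq ha hσ hxS hxW
      obtain ⟨h1, h2, h3, h4⟩ := hsp.infDist_le_of_mem_convexHull (convex_cubeFace J a) hWX hσ0 hU
        hDs hsR hxW hx hxQ hQ
      refine ⟨h1, h2, h3, h4.trans ?_⟩
      rw [traceBound, ← hN]
      exact two_mul_sq_div_add_le hr₀ hr₀s J.card
    obtain ⟨hne, hδ0, hδD, hδK⟩ := hbound y hyW hy hyS
    set W := cubeFace J a with hW
    set δ := Metric.infDist y (M ∩ W) with hδ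
    have hK0 : 0 < traceBound r₀ n (N + 1) := by
      rw [traceBound]; positivity
    -- By `hbound`, a point of `W` labelled `σ` in the wrong region has distance to `M ∩ W` at most
    -- `traceBound` and at most `√J.card * meshSize n < s`. Whichever term realises the minimum,
    -- distance `τ` is thus excluded.
    set τ := min (2 * traceBound r₀ n (N + 1)) s with hτ
    have hδτ : δ < τ := lt_min (by linarith) (by linarith)
    have hτs : τ ≤ s := min_le_right _ _
    have hτK : τ ≤ 2 * traceBound r₀ n (N + 1) := min_le_left _ _
    have hUN := hU hne
    obtain ⟨p, ⟨hpS, hpd⟩, -⟩ := hUN y (by rw [← hδ]; linarith)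
    have hnyp : ‖y - p‖ = δ := by rw [← dist_eq_norm, hpd]
    set w : ℝ → EuclideanSpace ℝ (Fin d) := fun t => y + (t / dist y p) • (y - p) with hw
    have hwdist : ∀ t, 0 ≤ t → δ + t ≤ τ → Metric.infDist (w t) (M ∩ W) = δ + t :=
      fun t ht htτ => hUN.infDist_normal hne hpS hpd hδ0 ht (by rw [← hδ]; linarith)
    have hyw : ∀ t, 0 ≤ t → dist y (w t) = t := fun t ht => by
      simp only [hw]
      rw [dist_eq_norm, sub_add_cancel_left, norm_neg, norm_smul, hnyp, hpd, ← hδ,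
        Real.norm_of_nonneg (div_nonneg ht hδ0.le), div_mul_cancel₀ _ hδ0.ne']
    have hwlab : ∀ t, 0 ≤ t → δ + t ≤ τ → w t ∈ W → lab (w t) = σ := by
      intro t ht htτ htW
      rw [← hy]
      have hsegW := (convex_cubeFace J a).segment_subset hyW htW
      refine hsp.lab_eq_of_isPreconnected (convex_segment y (w t)).isPreconnected
        (hsegW.trans hWX) ?_ (right_mem_segment ℝ _ _) (left_mem_segment ℝ _ _)
      intro z hz hzM
      have hzW := hsegW hz
      rw [segment_eq_image'] at hz
      obtain ⟨u, hu, rfl⟩ := hz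
      have hzw : y + u • (w t - y) = w (u * t) := by
        simp only [hw, add_sub_cancel_left, smul_smul, mul_div_assoc]
      simp only [hzw] at hzM hzW
      have h1 := hwdist (u * t) (mul_nonneg hu.1 ht) (by nlinarith [hu.2])
      rw [Metric.infDist_zero_of_mem (s := M ∩ W) ⟨hzM, hzW⟩] at h1
      nlinarith [hu.1]
    -- The crossing point is within `t ≤ τ - δ` of `y`, and `τ` is at most twice the bound.
    have hcross : ∀ t, 0 ≤ t → δ + t ≤ τ → w t ∈ W → w t ∉ signRegion lab n q face (-σ) →
        ∃ z, (∃ C, face d C ∧ ZeroCone lab n q face C z) ∧ (M ∩ W).Nonempty ∧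
          dist y z + δ ≤ 2 * traceBound r₀ n (N + 1) := by
      intro t ht htτ htW htS
      obtain ⟨z, hz, hzC⟩ := hc.exists_zeroCone_mem_segment hn hlab hσ'
        (((convex_cubeFace J a).segment_subset hyW htW).trans hWX) hyS htS
      refine ⟨z, hzC, hne, ?_⟩
      have h1 : segment ℝ y (w t) ⊆ Metric.closedBall y t :=
        (convex_closedBall y t).segment_subset (Metric.mem_closedBall_self ht)
          (by rw [Metric.mem_closedBall, dist_comm, hyw t ht])
      have h2 := h1 hz
      rw [Metric.mem_closedBall, dist_comm] at h2
      linarith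
    by_cases hT : w (τ - δ) ∈ W
    · refine hcross (τ - δ) (by linarith) (by linarith) hT fun hS => ?_
      have hlabT := hwlab (τ - δ) (by linarith) (by linarith) hT
      obtain ⟨-, -, h1, h2⟩ := hbound _ hT hlabT hS
      rw [hwdist (τ - δ) (by linarith) (by linarith), add_sub_cancel] at h1 h2
      rcases min_choice (2 * traceBound r₀ n (N + 1)) s with h | h <;> rw [← hτ] at h <;> linarith
    · have hwc : Continuous w := by simp only [hw]; fun_prop
      -- The walk stays in the affine span of `W`, since `y` and `p` are in `W`. At the last
      -- parameter in `W`, a free coordinate must therefore have reached `0` or `1`.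
      set A : Set ℝ := Set.Icc 0 (τ - δ) ∩ w ⁻¹' W with hA
      have hAcl : IsClosed A := isClosed_Icc.inter ((isClosed_cubeFace J a).preimage hwc)
      have hAb : BddAbove A := ⟨τ - δ, fun t ht => ht.1.2⟩
      have h0A : (0 : ℝ) ∈ A := ⟨⟨le_rfl, by linarith⟩, by simpa [hw] using hyW⟩
      have hsup := hAcl.csSup_mem ⟨0, h0A⟩ hAb
      set t := sSup A with ht
      obtain ⟨⟨ht0, htT⟩, htW⟩ := hsup
      have htlt : t < τ - δ := htT.lt_of_ne fun h => hT (h ▸ htW)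
      obtain ⟨j, hjJ, hj⟩ : ∃ j ∈ J, w t j = 0 ∨ w t j = 1 := by
        by_contra! hcon
        have hopen : ∀ᶠ t' in nhds t, ∀ j ∈ J, 0 < w t' j ∧ w t' j < 1 := by
          rw [Filter.eventually_all_finset]
          intro j hj
          have h1 := htW.1 j
          have hcj : Continuous fun t' => w t' j := by fun_prop
          exact (hcj.continuousAt.eventually_const_lt (h1.1.lt_of_ne (hcon j hj).1.symm)).and
            (hcj.continuousAt.eventually_lt_const (h1.2.lt_of_ne (hcon j hj).2))
        have hev : ∀ᶠ t' in nhdsWithin t (Set.Ioi t), t' < τ - δ ∧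
            ∀ j ∈ J, 0 < w t' j ∧ w t' j < 1 :=
          ((eventually_lt_nhds htlt).and hopen).filter_mono nhdsWithin_le_nhds
        obtain ⟨t', ⟨h1, h2⟩, h3⟩ := (hev.and self_mem_nhdsWithin).exists
        have h3 : t < t' := h3
        have hfix : ∀ j, j ∉ J → w t' j = a j := fun j hj => by
          simp only [hw, PiLp.add_apply, PiLp.smul_apply, PiLp.sub_apply, hyW.2 j hj,
            hpS.2.2 j hj, sub_self, smul_zero, add_zero]
        have hmem : t' ∈ A := by
          refine ⟨⟨by linarith, h1.le⟩, fun j => ?_, hfix⟩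
          by_cases hj : j ∈ J
          · exact ⟨(h2 j hj).1.le, (h2 j hj).2.le⟩
          · rw [hfix j hj]
            rcases ha j with h | h <;> rw [h] <;> norm_num
        exact absurd (le_csSup hAb hmem) (not_le.2 h3)
      by_cases hS : w t ∈ signRegion lab n q face (-σ)
      · have hsub : cubeFace (J.erase j) (Function.update a j (w t j)) ⊆ W := by
          refine fun x hx => ⟨hx.1, fun l hl => ?_⟩
          have hlj : l ≠ j := fun h => hl (h ▸ hjJ)
          rw [hx.2 l (fun h => hl (Finset.mem_of_mem_erase h)), Function.update_of_ne hlj]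
        have ha' : ∀ l, Function.update a j (w t j) l = 0 ∨ Function.update a j (w t j) l = 1 := by
          intro l
          rcases eq_or_ne l j with rfl | h
          · simpa using hj
          · rw [Function.update_of_ne h]; exact ha l
        have hwF : w t ∈ cubeFace (J.erase j) (Function.update a j (w t j)) := by
          refine ⟨htW.1, fun l hl => ?_⟩
          rcases eq_or_ne l j with rfl | h
          · simp
          · rw [Function.update_of_ne h]
            exact htW.2 l fun hlJ => hl (Finset.mem_erase.2 ⟨h, hlJ⟩)
        -- The length `t` already walked equals the gain in distance to `M ∩ W`, and the trace of
        -- `M` on the smaller face is no closer. So the bound for the sum of distances at `w t`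
        -- implies the one at `y`.
        obtain ⟨z, hz, hne', hle⟩ := ih ha' hwF (hwlab t ht0 (by linarith) htW) hS
          (by rw [Finset.card_erase_of_mem hjJ, hN, Nat.add_sub_cancel])
        refine ⟨z, hz, hne, ?_⟩
        have h1 : Metric.infDist (w t) (M ∩ W) ≤ Metric.infDist (w t)
            (M ∩ cubeFace (J.erase j) (Function.update a j (w t j))) :=
          Metric.infDist_le_infDist_of_subset (Set.inter_subset_inter_right M hsub) hne'
        rw [hwdist t ht0 (by linarith)] at h1
        have h2 : dist y z ≤ t + dist (w t) z := by
          have := dist_triangle y (w t) z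
          rwa [hyw t ht0] at this
        have h3 : traceBound r₀ n N ≤ traceBound r₀ n (N + 1) := by
          rw [traceBound, traceBound]
          push_cast
          have : 0 ≤ (4 / r₀ + 1 / 2) * meshSize n ^ 2 := by positivity
          nlinarith
        linarith
      · exact hcross t ht0 (by linarith) htW hS

/-- The bound on the Hausdorff distance, for the interface of any grid complex. -/
theorem IsGridComplex.hausdorffEDist_le (hd : 1 ≤ d) (hn : 2 ≤ n) (hc : IsGridComplex n face)
    (hsp : Splits M lab)
    (hlab : ∀ v, IsGridVertex n v → lab (gridPoint n v) = 1 ∨ lab (gridPoint n v) = -1)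
    (hq : -Real.logb 2 (meshSize n) ≤ q) {r₀ : ℝ} (hr₀ : 0 < r₀) (hM : TracesReach M n r₀)
    {Z : Set (EuclideanSpace ℝ (Fin d))}
    (hZ : ∀ C z, face d C → ZeroCone lab n q face C z → z ∈ Z)
    (hZ' : ∀ z ∈ Z, ∃ C, face d C ∧
      z ∈ convexHull ℝ (boundaryPoints lab n q face C : Set (EuclideanSpace ℝ (Fin d)))) :
    Metric.hausdorffEDist M Z ≤ ENNReal.ofReal (2 * traceBound r₀ n d) := by
  have hcard : (Finset.univ : Finset (Fin d)).card = d := Finset.card_fin d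
  have ha : ∀ j : Fin d, (fun _ => 0 : Fin d → ℝ) j = 0 ∨ (fun _ => 0 : Fin d → ℝ) j = 1 :=
    fun _ => Or.inl rfl
  have hε := meshSize_pos hn
  have hK0 : 0 ≤ traceBound r₀ n d := by rw [traceBound]; positivity
  refine Metric.hausdorffEDist_le_of_infEDist (fun x hx => ?_) (fun y hy => ?_)
  · refine ENNReal.le_of_forall_pos_le_add fun e he _ => ?_
    have he' : (0 : ℝ) < e := he
    suffices h : ∃ z ∈ Z, dist x z ≤ 2 * traceBound r₀ n d + e by
      obtain ⟨z, hz, hxz⟩ := h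
      refine (Metric.infEDist_le_edist_of_mem hz).trans ?_
      rw [edist_dist, ← ENNReal.ofReal_coe_nnreal, ← ENNReal.ofReal_add (by linarith) he'.le]
      exact ENNReal.ofReal_le_ofReal hxz
    -- A point near `x` in the region of the wrong sign settles the claim. Otherwise two points near
    -- `x` with opposite labels lie in their own regions only, and the segment between them crosses
    -- the interface.
    have hone : ∀ σ : SignType, (σ = 1 ∨ σ = -1) → ∀ y ∈ unitCube d, lab y = σ → dist x y < e →
        (∃ z ∈ Z, dist x z ≤ 2 * traceBound r₀ n d + e) ∨
          y ∉ signRegion lab n q face (-σ) := by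
      intro σ hσ y hyX hy hxy
      by_cases hyS : y ∈ signRegion lab n q face (-σ)
      · left
        obtain ⟨z, ⟨C, hC, hz⟩, -, hle⟩ := hc.exists_zeroCone_near hn hsp hlab hq hr₀ hM hσ
          (J := Finset.univ) ha (by rwa [cubeFace_univ]) hy hyS
        refine ⟨z, hZ C z hC hz, ?_⟩
        rw [hcard] at hle
        have := dist_triangle x y z
        linarith [Metric.infDist_nonneg (x := y) (s := M ∩ cubeFace Finset.univ fun _ => 0)]
      · exact Or.inr hyS
    obtain ⟨y, ⟨hyX, hy⟩, hxy⟩ := Metric.mem_closure_iff.1 (hsp.adherent_pos hx) e he'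
    obtain ⟨y', ⟨hyX', hy'⟩, hxy'⟩ := Metric.mem_closure_iff.1 (hsp.adherent_neg hx) e he'
    rcases hone 1 (Or.inl rfl) y hyX hy hxy with h | hS
    · exact h
    rcases hone (-1) (Or.inr rfl) y' hyX' hy' hxy' with h | hS'
    · exact h
    rw [neg_neg] at hS'
    have hyS : y ∈ signRegion lab n q face 1 := by
      obtain ⟨C, hC, hyC⟩ := hc.cover y hyX
      rcases hc.signCone_or (q := q) hlab hC hyC with h | h
      · exact ⟨C, hC, h⟩
      · exact absurd ⟨C, hC, h⟩ hS
    obtain ⟨z, hz, C, hC, hzC⟩ := hc.exists_zeroCone_mem_segment hn hlab (Or.inl rfl)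
      (convex_unitCube.segment_subset hyX hyX') hyS hS'
    refine ⟨z, hZ C z hC hzC, ?_⟩
    have hball : segment ℝ y y' ⊆ Metric.closedBall x e := (convex_closedBall x _).segment_subset
      (by rw [Metric.mem_closedBall, dist_comm]; exact hxy.le)
      (by rw [Metric.mem_closedBall, dist_comm]; exact hxy'.le)
    have := hball hz
    rw [Metric.mem_closedBall, dist_comm] at this
    linarith
  · obtain ⟨C, hC, hyC⟩ := hZ' y hy
    have hyH : y ∈ gridHull n C :=
      convexHull_min (boundaryPoints_subset_gridHull C) (convex_gridHull C) hyC
    have hCX := hc.gridHull_subset_unitCube hn hC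
    by_cases hy0 : lab y = 0
    · rw [Metric.infEDist_zero_of_mem ((hsp.zero_iff y (hCX hyH)).1 hy0)]
      exact zero_le
    have hσ : lab y = 1 ∨ lab y = -1 := by
      revert hy0; cases lab y <;> decide
    obtain ⟨s, R, hDs, hr₀s, hsR, hU⟩ := hM Finset.univ (fun _ => 0) (by rw [hcard]; exact hd) ha
    have hCW : ∀ v ∈ C, gridPoint n v ∈ cubeFace Finset.univ fun _ => (0 : ℝ) := fun v hv => by
      rw [cubeFace_univ]; exact gridPoint_mem_unitCube hn (hc.isGridVertex hC hv)
    obtain ⟨hne, -, -, hle⟩ := hsp.infDist_le_of_mem_convexHull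
      (convex_cubeFace Finset.univ fun _ => 0) (fun x hx => hx.1) hy0 hU hDs hsR
      (by rw [cubeFace_univ]; exact hCX hyH) rfl hyC (fun b hb => by
        obtain ⟨p, hp, hpσ, hbp⟩ := hc.exists_near_boundaryPoint hn hq hC hCW hσ hb
        exact ⟨p, by rw [cubeFace_univ]; exact hCX hp, hpσ, hbp,
          hc.dist_le_of_mem_gridHull hn hC hCW hp hyH⟩)
    have h1 := hle.trans (two_mul_sq_div_add_le hr₀ hr₀s _)
    have hMX : M ∩ cubeFace Finset.univ (fun _ => (0 : ℝ)) = M := by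
      rw [cubeFace_univ]; exact Set.inter_eq_left.2 hsp.subset
    rw [hMX] at h1 hne
    rw [← ENNReal.ofReal_toReal (Metric.infEDist_ne_top hne)]
    refine ENNReal.ofReal_le_ofReal ?_
    change Metric.infDist y M ≤ _
    rw [hcard] at h1
    change Metric.infDist y M ≤ traceBound r₀ n d at h1
    linarith

end Faces

/-! ### The complex of grid cubes -/

section CubeComplex

variable {d : ℕ} {n : ℕ}

theorem mem_Icc_pi {lo hi v : Fin d → ℕ} :
    v ∈ Finset.Icc lo hi ↔ ∀ j, lo j ≤ v j ∧ v j ≤ hi j := by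
  rw [Finset.mem_Icc, Pi.le_def, Pi.le_def, forall_and]

/-- `F` consists of the vertices of the cube with lowest vertex `k` that lie between `lo` and
`hi`, which differ in `i` coordinates. -/
def IsBoxFace (k : Fin d → ℕ) (i : ℕ) (F : Finset (Fin d → ℕ)) (lo hi : Fin d → ℕ) : Prop :=
  (∀ j, k j ≤ lo j ∧ lo j ≤ hi j ∧ hi j ≤ k j + 1) ∧
    (Finset.univ.filter fun j => lo j < hi j).card = i ∧ F = Finset.Icc lo hi

theorem isCubeFace_iff {k : Fin d → ℕ} {i : ℕ} {F : Finset (Fin d → ℕ)} :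
    IsCubeFace k i F ↔ ∃ lo hi, IsBoxFace k i F lo hi := by
  constructor
  · rintro ⟨A, J, hAJ, hJ, rfl⟩
    refine ⟨cubeVertex k A, cubeVertex k (A ∪ J), fun j => ?_, ?_, ?_⟩
    · simp only [cubeVertex, Finset.mem_union]
      split_ifs <;> simp_all
    · rw [← hJ]
      congr 1
      ext j
      have : j ∈ A → j ∉ J := fun h => Finset.disjoint_left.1 hAJ h
      simp only [cubeVertex, Finset.mem_union, Finset.mem_filter, Finset.mem_univ, true_and]
      split_ifs <;> simp_all
    · ext v
      simp only [Finset.mem_image, Finset.mem_powerset, mem_Icc_pi]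
      constructor
      · rintro ⟨S, hS, rfl⟩ j
        have := @hS j
        simp only [cubeVertex, Finset.mem_union]
        split_ifs <;> simp_all
      · intro h
        refine ⟨J.filter fun j => k j < v j, Finset.filter_subset _ _, ?_⟩
        ext j
        have h1 := h j
        simp only [cubeVertex, Finset.mem_union, Finset.mem_filter] at h1 ⊢
        by_cases hA : j ∈ A <;> by_cases hj : j ∈ J <;> by_cases hv : k j < v j <;>
          simp only [hA, hj, hv, or_true, or_false, and_true, and_false, or_self,
            if_true, if_false] at h1 ⊢ <;> omega
  · rintro ⟨lo, hi, h, rfl, rfl⟩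
    refine ⟨Finset.univ.filter fun j => k j < lo j, Finset.univ.filter fun j => lo j < hi j,
      ?_, rfl, ?_⟩
    · rw [Finset.disjoint_left]
      intro j h1 h2
      have := h j
      simp only [Finset.mem_filter, Finset.mem_univ, true_and] at h1 h2
      omega
    · ext v
      simp only [Finset.mem_image, Finset.mem_powerset, mem_Icc_pi]
      constructor
      · intro hv
        refine ⟨Finset.univ.filter fun j => lo j < v j, fun j => ?_, ?_⟩
        · have := hv j
          simp only [Finset.mem_filter, Finset.mem_univ, true_and]
          omega
        · ext j
          have := h j
          have := hv j
          simp only [cubeVertex, Finset.mem_union, Finset.mem_filter, Finset.mem_univ, true_and]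
          split_ifs <;> omega
      · rintro ⟨S, hS, rfl⟩ j
        have := h j
        have h3 := @hS j
        simp only [cubeVertex, Finset.mem_union, Finset.mem_filter, Finset.mem_univ,
          true_and] at h3 ⊢
        by_cases hj : j ∈ S
        · simp only [hj, or_true, if_true]
          have := h3 hj
          omega
        · simp only [hj, or_false]
          split_ifs <;> omega

/-- The faces of all the cubes of the grid. -/
def gridCubeFace (n i : ℕ) (F : Finset (Fin d → ℕ)) : Prop :=
  ∃ k, IsGridCube n k ∧ IsCubeFace k i F

theorem gridCubeFace_iff {i : ℕ} {F : Finset (Fin d → ℕ)} :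
    gridCubeFace n i F ↔ ∃ k lo hi, IsGridCube n k ∧ IsBoxFace k i F lo hi := by
  simp only [gridCubeFace, isCubeFace_iff]
  constructor
  · rintro ⟨k, hk, lo, hi, h⟩
    exact ⟨k, lo, hi, hk, h⟩
  · rintro ⟨k, lo, hi, hk, h⟩
    exact ⟨k, hk, lo, hi, h⟩

/-- The vertices form a product of pairs, and convex hulls commute with products. -/
theorem mem_gridHull_Icc (hn : 2 ≤ n) {lo hi : Fin d → ℕ}
    (h : ∀ j, lo j ≤ hi j ∧ hi j ≤ lo j + 1) {x : EuclideanSpace ℝ (Fin d)} :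
    x ∈ gridHull n (Finset.Icc lo hi) ↔
      ∀ j, lo j * meshSize n ≤ x j ∧ x j ≤ hi j * meshSize n := by
  have hε := meshSize_pos hn
  set L : (Fin d → ℝ) →ₗ[ℝ] EuclideanSpace ℝ (Fin d) :=
    (WithLp.linearEquiv 2 ℝ (Fin d → ℝ)).symm.toLinearMap
  have himage : gridPoint n '' (Finset.Icc lo hi : Set (Fin d → ℕ)) =
      L '' (Set.univ.pi fun j => {(lo j * meshSize n : ℝ), (hi j * meshSize n : ℝ)}) := by
    ext y
    constructor
    · rintro ⟨v, hv, rfl⟩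
      refine ⟨fun j => v j * meshSize n, fun j _ => ?_, rfl⟩
      have h1 := mem_Icc_pi.1 (Finset.mem_coe.1 hv) j
      have h3 := h j
      rcases (show v j = lo j ∨ v j = hi j by omega) with e | e <;> simp [e]
    · rintro ⟨w, hw, rfl⟩
      have hw' : ∀ j, ∃ m : ℕ, lo j ≤ m ∧ m ≤ hi j ∧ w j = m * meshSize n := fun j => by
        rcases hw j (Set.mem_univ j) with e | e
        · exact ⟨lo j, le_rfl, (h j).1, e⟩
        · exact ⟨hi j, (h j).1, le_rfl, e⟩
      choose v hv1 hv2 hv3 using hw'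
      refine ⟨v, ?_, ?_⟩
      · exact Finset.mem_coe.2 (mem_Icc_pi.2 fun j => ⟨hv1 j, hv2 j⟩)
      · ext j
        exact (hv3 j).symm
  rw [gridHull, himage, ← LinearMap.image_convexHull, convexHull_pi]
  have hseg : ∀ j, convexHull ℝ {(lo j * meshSize n : ℝ), (hi j * meshSize n : ℝ)} =
      Set.Icc (lo j * meshSize n) (hi j * meshSize n) := fun j => by
    rw [convexHull_pair, segment_eq_Icc]
    exact mul_le_mul_of_nonneg_right (by exact_mod_cast (h j).1) hε.le
  simp only [hseg]
  constructor
  · rintro ⟨w, hw, rfl⟩ j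
    exact hw j (Set.mem_univ j)
  · intro hx
    exact ⟨fun j => x j, fun j _ => hx j, rfl⟩

/-- A function on the vertices of a box that is constant along the edges is constant. -/
theorem eq_lo_of_forall_edge {α : Type*} {lo hi : Fin d → ℕ} (s : (Fin d → ℕ) → α)
    (hs : ∀ a j, a ∈ Finset.Icc lo hi → Function.update a j (a j + 1) ∈ Finset.Icc lo hi →
      s a = s (Function.update a j (a j + 1))) {v : Fin d → ℕ} (hv : v ∈ Finset.Icc lo hi) :
    s v = s lo := by
  induction hN : ∑ j, v j using Nat.strong_induction_on generalizing v with
  | _ N ih =>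
    by_cases hvlo : v = lo
    · rw [hvlo]
    obtain ⟨j, hj⟩ := Function.ne_iff.1 hvlo
    have h1 := mem_Icc_pi.1 hv
    have hlt : lo j < v j := lt_of_le_of_ne (h1 j).1 (Ne.symm hj)
    set a := Function.update v j (v j - 1) with ha
    have haj : a j = v j - 1 := by simp [ha]
    have hav : Function.update a j (a j + 1) = v := by
      rw [haj, ha, Function.update_idem, show v j - 1 + 1 = v j by omega,
        Function.update_eq_self]
    have hale : ∀ l, a l ≤ v l := fun l => by
      rcases eq_or_ne l j with rfl | hl
      · omega
      · rw [ha, Function.update_of_ne hl]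
    have haI : a ∈ Finset.Icc lo hi := by
      refine mem_Icc_pi.2 fun l => ⟨?_, (hale l).trans (h1 l).2⟩
      rcases eq_or_ne l j with rfl | hl
      · omega
      · rw [ha, Function.update_of_ne hl]; exact (h1 l).1
    have hsum : ∑ l, a l < N := by
      rw [← hN]
      exact Finset.sum_lt_sum (fun l _ => hale l) ⟨j, Finset.mem_univ j, by omega⟩
    have h3 := hs a j haI (by rwa [hav])
    rw [hav] at h3
    rw [← h3, ih _ hsum haI rfl]

theorem gridCubeFace_pair {k : Fin d → ℕ} (hk : IsGridCube n k) {a : Fin d → ℕ} {j : Fin d}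
    (ha : ∀ l, k l ≤ a l ∧ a l ≤ k l + 1) (haj : a j + 1 ≤ k j + 1) :
    gridCubeFace n 1 {a, Function.update a j (a j + 1)} := by
  rw [gridCubeFace_iff]
  refine ⟨k, a, Function.update a j (a j + 1), hk, fun l => ?_, ?_, ?_⟩
  · have := ha l
    rcases eq_or_ne l j with rfl | hl
    · rw [Function.update_self]; omega
    · rw [Function.update_of_ne hl]; omega
  · rw [Finset.card_eq_one]
    refine ⟨j, ?_⟩
    ext l
    rcases eq_or_ne l j with rfl | hl
    · simp
    · simp [hl]
  · ext v
    rw [Finset.mem_insert, Finset.mem_singleton, mem_Icc_pi]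
    constructor
    · rintro (rfl | rfl) l <;> rcases eq_or_ne l j with rfl | hl
      · simp
      · simp [hl]
      · simp
      · simp [hl]
    · intro h1
      have hne : ∀ l, l ≠ j → v l = a l := fun l hl => by
        have h4 := h1 l
        rw [Function.update_of_ne hl] at h4
        omega
      have h4 := h1 j
      rw [Function.update_self] at h4
      rcases (show v j = a j ∨ v j = a j + 1 by omega) with e | e
      · left
        ext l
        rcases eq_or_ne l j with rfl | hl
        · exact e
        · exact hne l hl
      · right
        ext l
        rcases eq_or_ne l j with rfl | hl
        · rw [e, Function.update_self]
        · rw [hne l hl, Function.update_of_ne hl]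

/-- Two labels that differ are the labels of an edge with a boundary point. -/
theorem exists_edge_of_ne {face : ℕ → Finset (Fin d → ℕ) → Prop} {F : Finset (Fin d → ℕ)}
    {s : (Fin d → ℕ) → SignType}
    (hs : ∀ v ∈ F, s v = 1 ∨ s v = -1) {a b : Fin d → ℕ} (ha : a ∈ F) (hb : b ∈ F)
    (hab : face 1 {a, b}) (hne : s a ≠ s b) :
    ∃ a' ∈ F, ∃ b' ∈ F, face 1 {a', b'} ∧ s a' = -1 ∧ s b' = 1 ∧
      (a' = a ∧ b' = b ∨ a' = b ∧ b' = a) := by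
  rcases hs a ha with h1 | h1 <;> rcases hs b hb with h2 | h2
  · exact absurd (h1.trans h2.symm) hne
  · exact ⟨b, hb, a, ha, Finset.pair_comm a b ▸ hab, h2, h1, Or.inr ⟨rfl, rfl⟩⟩
  · exact ⟨a, ha, b, hb, hab, h1, h2, Or.inl ⟨rfl, rfl⟩⟩
  · exact absurd (h1.trans h2.symm) hne

theorem isGridComplex_cube (hn : 2 ≤ n) : IsGridComplex n (gridCubeFace (d := d) n) := by
  have hε := meshSize_pos hn
  have hbox : ∀ {k : Fin d → ℕ} {i F lo hi}, IsBoxFace k i F lo hi →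
      ∀ j, lo j ≤ hi j ∧ hi j ≤ lo j + 1 := fun h j => by
    have := h.1 j
    omega
  have hmem : ∀ {k : Fin d → ℕ} {i F lo hi} {x : EuclideanSpace ℝ (Fin d)},
      IsBoxFace k i F lo hi → (x ∈ gridHull n F ↔
      ∀ j, lo j * meshSize n ≤ x j ∧ x j ≤ hi j * meshSize n) := fun h => by
    rw [h.2.2]; exact mem_gridHull_Icc hn (hbox h)
  have hsub : ∀ {k k' : Fin d → ℕ} {i i' F F' lo hi lo' hi'}, IsBoxFace k i F lo hi →
      IsBoxFace k' i' F' lo' hi' → (F' ⊆ F ↔ ∀ j, lo j ≤ lo' j ∧ hi' j ≤ hi j) := fun h h' => by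
    rw [h.2.2, h'.2.2, Finset.Icc_subset_Icc_iff fun j => (h'.1 j).2.1, Pi.le_def, Pi.le_def,
      forall_and]
  -- It suffices to know the edges that meet a set `P` containing `F`: `P` is everything for `edge`,
  -- and the complement of `G` for `edge_notMem`.
  have hconst : ∀ {k : Fin d → ℕ} {i F lo hi} (s : (Fin d → ℕ) → SignType) (P : Set (Fin d → ℕ)),
      IsGridCube n k → IsBoxFace k i F lo hi →
      (∀ a ∈ F, ∀ b ∈ F, gridCubeFace n 1 {a, b} → (a ∈ P ∨ b ∈ P) → s a = s b) →
      (∀ v ∈ F, v ∈ P) → ∀ v ∈ F, s v = s lo := by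
    rintro k i F lo hi s P hk ⟨h, -, rfl⟩ hs hP v hv
    refine eq_lo_of_forall_edge s (fun a j ha hb => hs a ha _ hb ?_ (Or.inl (hP a ha))) hv
    rw [mem_Icc_pi] at ha hb
    refine gridCubeFace_pair hk (fun l => ?_) ?_
    · have h1 := ha l
      have := h l
      omega
    · have h2 := hb j
      rw [Function.update_self] at h2
      have := h j
      omega
  refine ⟨?_, ?_, ?_, ?_, ?_, ?_, ?_, ?_, ?_, ?_⟩
  · intro x hx
    have h2 : (2 : ℝ) ≤ n := by exact_mod_cast hn
    -- The minimum with `n - 2` matters when `x j = 1`, where the floor is `n - 1`.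
    set k : Fin d → ℕ := fun j => min ⌊x j / meshSize n⌋₊ (n - 2) with hk
    have hF : IsBoxFace k d (Finset.Icc k fun j => k j + 1) k fun j => k j + 1 :=
      ⟨fun j => ⟨le_rfl, by simp, le_rfl⟩, by simp, rfl⟩
    have hkG : IsGridCube n k := fun j => by
      have : k j ≤ n - 2 := min_le_right _ _
      omega
    refine ⟨_, gridCubeFace_iff.2 ⟨k, _, _, hkG, hF⟩, (hmem hF).2 fun j => ?_⟩
    have hxj := hx j
    have h0 : 0 ≤ x j / meshSize n := div_nonneg hxj.1 hε.le
    constructor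
    · rw [← le_div_iff₀ hε]
      refine le_trans ?_ (Nat.floor_le h0)
      exact_mod_cast min_le_left _ _
    · rw [← div_le_iff₀ hε]
      rcases min_choice ⌊x j / meshSize n⌋₊ (n - 2) with e | e
      · have : k j = ⌊x j / meshSize n⌋₊ := e
        rw [this]
        push_cast
        exact (Nat.lt_floor_add_one _).le
      · have : k j = n - 2 := e
        rw [this, show n - 2 + 1 = n - 1 by omega, Nat.cast_sub (by omega), meshSize]
        rw [div_div_eq_mul_div, div_one, Nat.cast_one]
        nlinarith
  · intro i F hF
    obtain ⟨k, lo, hi, -, h, -, rfl⟩ := gridCubeFace_iff.1 hF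
    exact ⟨lo, Finset.mem_Icc.2 ⟨le_rfl, fun j => (h j).2.1⟩⟩
  · intro i F hF
    obtain ⟨k, lo, hi, hk, h, -, rfl⟩ := gridCubeFace_iff.1 hF
    refine ⟨k, hk, fun v hv j => ?_⟩
    have h1 := mem_Icc_pi.1 hv j
    have := h j
    omega
  · intro i F m G x hF hG hxF hxG
    obtain ⟨k, lo, hi, hk, h⟩ := gridCubeFace_iff.1 hF
    obtain ⟨k', lo', hi', hk', h'⟩ := gridCubeFace_iff.1 hG
    have hx1 := (hmem h).1 hxF
    have hx2 := (hmem h').1 hxG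
    have hx : ∀ j, ((max (lo j) (lo' j) : ℕ) : ℝ) * meshSize n ≤ x j ∧
        x j ≤ ((min (hi j) (hi' j) : ℕ) : ℝ) * meshSize n := fun j => by
      constructor
      · rcases max_choice (lo j) (lo' j) with e | e <;> rw [e]
        exacts [(hx1 j).1, (hx2 j).1]
      · rcases min_choice (hi j) (hi' j) with e | e <;> rw [e]
        exacts [(hx1 j).2, (hx2 j).2]
    have hK : IsBoxFace k _ _ (fun j => max (lo j) (lo' j)) fun j => min (hi j) (hi' j) :=
      ⟨fun j => by
        have h1 := h.1 j
        have h2 := h'.1 j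
        have h3 : max (lo j) (lo' j) ≤ min (hi j) (hi' j) := by
          have := (hx j).1.trans (hx j).2
          exact_mod_cast le_of_mul_le_mul_right this hε
        dsimp only
        omega, rfl, rfl⟩
    refine ⟨_, _, gridCubeFace_iff.2 ⟨k, _, _, hk, hK⟩, (hsub h hK).2 fun j => ?_,
      (hsub h' hK).2 fun j => ?_, (hmem hK).2 hx⟩ <;> simp
  · intro i F m G hF hG hGF
    obtain ⟨k, lo, hi, hk, h⟩ := gridCubeFace_iff.1 hF
    obtain ⟨k', lo', hi', hk', h'⟩ := gridCubeFace_iff.1 hG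
    refine ⟨gridHull_mono hGF, fun x hx y hy z hz hseg => (hmem h').2 fun j => ?_⟩
    obtain ⟨u, v, hu, hv, huv, rfl⟩ := hseg
    have hxj := (hmem h).1 hx j
    have hyj := (hmem h).1 hy j
    have hzj := (hmem h').1 hz j
    simp only [PiLp.add_apply, PiLp.smul_apply, smul_eq_mul] at hzj
    have h1 := (hsub h h').1 hGF j
    have h2 := hbox h j
    have h3 := hbox h' j
    have hv' : v = 1 - u := by linarith
    constructor
    · rcases (show lo' j = lo j ∨ lo' j = hi j by omega) with e | e <;> rw [e] at hzj ⊢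
      · exact hxj.1
      · have h5 := mul_nonneg hv.le (sub_nonneg.2 hyj.2)
        have h6 : u * (hi j * meshSize n - x j) ≤ 0 := by
          rw [hv'] at h5 hzj; nlinarith [hzj.1]
        nlinarith [hxj.2]
    · rcases (show hi' j = hi j ∨ hi' j = lo j by omega) with e | e <;> rw [e] at hzj ⊢
      · exact hxj.2
      · have h5 := mul_nonneg hv.le (sub_nonneg.2 hyj.1)
        have h6 : u * (x j - lo j * meshSize n) ≤ 0 := by
          rw [hv'] at h5 hzj; nlinarith [hzj.2]
        nlinarith [hxj.1]
  · intro i F x hF hx hmin b hb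
    obtain ⟨k, lo, hi, hk, h⟩ := gridCubeFace_iff.1 hF
    have hxF := (hmem h).1 hx
    have hbF := (hmem h).1 hb
    have hlt : ∀ j, lo j < hi j → lo j * meshSize n < x j ∧ x j < hi j * meshSize n := by
      intro j hj
      -- Freezing coordinate `j` at an end value gives a proper face, which does not contain `x`.
      have hupd : ∀ c, (c = lo j ∨ c = hi j) → x j ≠ c * meshSize n := by
        intro c hc hxc
        have hG : IsBoxFace k _ _ (Function.update lo j c) (Function.update hi j c) :=
          ⟨fun l => by
            have := h.1 l
            rcases eq_or_ne l j with rfl | hl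
            · simp only [Function.update_self]; omega
            · simpa only [Function.update_of_ne hl] using this, rfl, rfl⟩
        refine hmin _ _ (gridCubeFace_iff.2 ⟨k, _, _, hk, hG⟩) ?_ ((hmem hG).2 fun l => ?_)
        · refine ⟨(hsub h hG).2 fun l => ?_, fun hFG => ?_⟩
          · rcases eq_or_ne l j with rfl | hl
            · simp only [Function.update_self]; omega
            · simp only [Function.update_of_ne hl]; omega
          · have := (hsub hG h).1 hFG j
            simp only [Function.update_self] at this
            omega
        · rcases eq_or_ne l j with rfl | hl
          · simp only [Function.update_self]
            exact ⟨hxc.symm.le, hxc.le⟩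
          · simpa only [Function.update_of_ne hl] using hxF l
      exact ⟨(hxF j).1.lt_of_ne (hupd _ (Or.inl rfl)).symm,
        (hxF j).2.lt_of_ne (hupd _ (Or.inr rfl))⟩
    have hopen : ∀ᶠ t : ℝ in nhds 0, ∀ j, lo j < hi j →
        lo j * meshSize n < x j + t * (x j - b j) ∧ x j + t * (x j - b j) < hi j * meshSize n := by
      rw [Filter.eventually_all]
      intro j
      by_cases hj : lo j < hi j
      · have hcj : Continuous fun t : ℝ => x j + t * (x j - b j) := by fun_prop
        have h0 := hlt j hj
        filter_upwards [(hcj.tendsto' 0 (x j) (by simp)).eventually_const_lt h0.1,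
          (hcj.tendsto' 0 (x j) (by simp)).eventually_lt_const h0.2] with t h1 h2 _
        exact ⟨h1, h2⟩
      · exact Filter.Eventually.of_forall fun t h => absurd h hj
    obtain ⟨t, ht, ht0⟩ := ((hopen.filter_mono nhdsWithin_le_nhds).and
      (self_mem_nhdsWithin (s := Set.Ioi (0 : ℝ)))).exists
    refine ⟨t, ht0, (hmem h).2 fun j => ?_⟩
    simp only [PiLp.add_apply, PiLp.smul_apply, PiLp.sub_apply, smul_eq_mul]
    by_cases hj : lo j < hi j
    · exact ⟨(ht j hj).1.le, (ht j hj).2.le⟩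
    · have hx1 := hxF j
      have hb1 := hbF j
      rw [show hi j = lo j by have := h.1 j; omega] at hx1 hb1 ⊢
      have h1 : x j = lo j * meshSize n := le_antisymm hx1.2 hx1.1
      have h2 : b j = lo j * meshSize n := le_antisymm hb1.2 hb1.1
      rw [h1, h2]
      simp
  · intro i F m G hF hG hGF
    obtain ⟨k, lo, hi, hk, h⟩ := gridCubeFace_iff.1 hF
    obtain ⟨k', lo', hi', hk', h'⟩ := gridCubeFace_iff.1 hG
    have h1 := (hsub h h').1 hGF
    have hss : (Finset.univ.filter fun j => lo' j < hi' j) ⊆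
        Finset.univ.filter fun j => lo j < hi j := by
      intro j
      have := h1 j
      simp only [Finset.mem_filter, Finset.mem_univ, true_and]
      omega
    refine ⟨h'.2.1 ▸ h.2.1 ▸ Finset.card_le_card hss, fun hmi => ?_⟩
    have heq := Finset.eq_of_subset_of_card_le hss (by rw [h.2.1, h'.2.1, hmi])
    have hall : ∀ j, lo' j = lo j ∧ hi' j = hi j := fun j => by
      have h2 : lo' j < hi' j ↔ lo j < hi j := by simpa using Finset.ext_iff.1 heq j
      have := h1 j
      have := hbox h j
      have := hbox h' j
      omega
    rw [h.2.2, h'.2.2, funext fun j => (hall j).1, funext fun j => (hall j).2]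
  · intro i F m G hF hG hGF hmi
    obtain ⟨k, lo, hi, hk, h⟩ := gridCubeFace_iff.1 hF
    obtain ⟨k', lo', hi', hk', h'⟩ := gridCubeFace_iff.1 hG
    have h1 := (hsub h h').1 hGF
    obtain ⟨j, hj, hj'⟩ : ∃ j, lo j < hi j ∧ ¬ lo' j < hi' j := by
      by_contra! hcon
      have : (Finset.univ.filter fun j => lo j < hi j).card ≤
          (Finset.univ.filter fun j => lo' j < hi' j).card :=
        Finset.card_le_card fun j => by simpa using hcon j
      rw [h.2.1, h'.2.1] at this
      omega
    have hH : IsBoxFace k (m + 1)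
        (Finset.Icc (Function.update lo' j (lo j)) (Function.update hi' j (hi j)))
        (Function.update lo' j (lo j)) (Function.update hi' j (hi j)) := by
      refine ⟨fun l => ?_, ?_, rfl⟩
      · have := h.1 l
        have := h'.1 l
        have := h1 l
        rcases eq_or_ne l j with rfl | hl
        · simp only [Function.update_self]; omega
        · simp only [Function.update_of_ne hl]; omega
      · have : (Finset.univ.filter fun l => Function.update lo' j (lo j) l <
            Function.update hi' j (hi j) l) =
            insert j (Finset.univ.filter fun j => lo' j < hi' j) := by
          ext l
          rcases eq_or_ne l j with rfl | hl
          · simp [hj]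
          · simp [hl]
        rw [this, Finset.card_insert_of_notMem (by simpa using hj'), h'.2.1]
    refine ⟨_, gridCubeFace_iff.2 ⟨k, _, _, hk, hH⟩, (hsub hH h').2 fun l => ?_,
      (hsub h hH).2 fun l => ?_⟩ <;>
    · have := h1 l
      rcases eq_or_ne l j with rfl | hl
      · simp only [Function.update_self]; omega
      · simp only [Function.update_of_ne hl]; omega
  · rintro i F s hF hs ⟨v, hv, hv1⟩ ⟨w, hw, hw1⟩
    obtain ⟨k, lo, hi, hk, h⟩ := gridCubeFace_iff.1 hF
    by_contra! hcon
    have hall := hconst s Set.univ hk h (fun a ha b hb hab _ => by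
      by_contra hne
      obtain ⟨a', ha', b', hb', h1, h2, h3, -⟩ := exists_edge_of_ne hs ha hb hab hne
      exact hcon a' ha' b' hb' h1 h2 h3) fun _ _ => trivial
    have := (hall v hv).trans (hall w hw).symm
    rw [hv1, hw1] at this
    exact absurd this (by decide)
  · rintro i F m G s hF hG hGF hs ⟨v, hv, hv1⟩ ⟨w, hw, hw1⟩
    obtain ⟨k, lo, hi, hk, h⟩ := gridCubeFace_iff.1 hF
    obtain ⟨k', lo', hi', hk', h'⟩ := gridCubeFace_iff.1 hG
    have h1 := (hsub h h').1 hGF.subset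
    by_contra! hcon
    have hedge : ∀ a ∈ F, ∀ b ∈ F, gridCubeFace n 1 {a, b} →
        (a ∈ {v | v ∉ G} ∨ b ∈ {v | v ∉ G}) → s a = s b := by
      intro a ha b hb hab hor
      by_contra hne
      obtain ⟨a', ha', b', hb', h1, h2, h3, h4⟩ := exists_edge_of_ne hs ha hb hab hne
      have h5 := hcon a' ha' b' hb' h1 h2 h3
      rcases h4 with ⟨rfl, rfl⟩ | ⟨rfl, rfl⟩
      · exact hor.elim (fun h => h h5.1) (fun h => h h5.2)
      · exact hor.elim (fun h => h h5.2) (fun h => h h5.1)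
    -- A proper face of a box misses a whole facet `v j = c`. Labels agree along edges with an end
    -- outside `G`: first on that facet, then along the edges in direction `j` that join the rest of
    -- `F` to it. So `s` would be constant.
    obtain ⟨j, c, hc, hcG⟩ : ∃ j c, (c = lo j ∨ c = hi j) ∧ ∀ v ∈ G, v j ≠ c := by
      by_contra! hno
      refine hGF.2 ((hsub h' h).2 fun j => ?_)
      obtain ⟨v, hvG, hvj⟩ := hno j (lo j) (Or.inl rfl)
      obtain ⟨w, hwG, hwj⟩ := hno j (hi j) (Or.inr rfl)
      rw [h'.2.2, mem_Icc_pi] at hvG hwG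
      have := hvG j
      have := hwG j
      omega
    have hFc : IsBoxFace k _ _ (Function.update lo j c) (Function.update hi j c) :=
      ⟨fun l => by
        have := h.1 l
        rcases eq_or_ne l j with rfl | hl
        · simp only [Function.update_self]; omega
        · simpa only [Function.update_of_ne hl] using this, rfl, rfl⟩
    have hFcF := (hsub h hFc).2 fun l => by
      have := h.1 l
      rcases eq_or_ne l j with rfl | hl
      · simp only [Function.update_self]; omega
      · simp only [Function.update_of_ne hl]; omega
    have hout : ∀ v ∈ Finset.Icc (Function.update lo j c) (Function.update hi j c),
        v ∉ G := by
      intro v hv hvG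
      have h2 := mem_Icc_pi.1 hv j
      simp only [Function.update_self] at h2
      exact hcG v hvG (le_antisymm h2.2 h2.1)
    have hall := hconst s {v | v ∉ G} hk hFc
      (fun a ha b hb => hedge a (hFcF ha) b (hFcF hb)) hout
    have hproj : ∀ v ∈ F, s v = s (Function.update lo j c) := by
      intro v hv
      have hvI := hv
      rw [h.2.2, mem_Icc_pi] at hvI
      have hv' : Function.update v j c ∈ Finset.Icc (Function.update lo j c)
          (Function.update hi j c) := by
        refine mem_Icc_pi.2 fun l => ?_
        rcases eq_or_ne l j with rfl | hl
        · simp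
        · simpa [hl] using hvI l
      rw [← hall _ hv']
      have h2 := hvI j
      have h4 := h.1 j
      have hvk : ∀ l, k l ≤ v l ∧ v l ≤ k l + 1 := fun l => by
        have := hvI l
        have := h.1 l
        omega
      rcases (show v j = c ∨ c = v j + 1 ∨ v j = c + 1 by omega) with e | e | e
      · rw [← e, Function.update_eq_self]
      · refine hedge _ hv _ (hFcF hv') ?_ (Or.inr (hout _ hv'))
        rw [e]
        exact gridCubeFace_pair hk hvk (by omega)
      · refine hedge _ hv _ (hFcF hv') ?_ (Or.inr (hout _ hv'))
        have h5 := gridCubeFace_pair hk (a := Function.update v j c) (j := j) (fun l => by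
          rcases eq_or_ne l j with rfl | hl
          · simp only [Function.update_self]; omega
          · simpa only [Function.update_of_ne hl] using hvk l) (by
          simp only [Function.update_self]; omega)
        rwa [Function.update_self, Function.update_idem, ← e, Function.update_eq_self,
          Finset.pair_comm] at h5
    have := (hproj v hv).trans (hproj w hw).symm
    rw [hv1, hw1] at this
    exact absurd this (by decide)

end CubeComplex

/-! ### The complex of Kuhn simplices -/

section KuhnComplex

variable {d : ℕ} {n : ℕ}

/-- The faces of all the Kuhn simplices of the grid. -/
def gridKuhnFace (n i : ℕ) (F : Finset (Fin d → ℕ)) : Prop :=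
  ∃ k π, IsGridCube n k ∧ IsKuhnFace k π i F

theorem mem_gridHull_iff {F : Finset (Fin d → ℕ)} {x : EuclideanSpace ℝ (Fin d)} :
    x ∈ gridHull n F ↔ ∃ w : (Fin d → ℕ) → ℝ, (∀ v ∈ F, 0 ≤ w v) ∧ ∑ v ∈ F, w v = 1 ∧
      ∑ v ∈ F, w v • gridPoint n v = x := by
  classical
  constructor
  · intro hx
    have hsub : gridHull n F ⊆ {x | ∃ w : (Fin d → ℕ) → ℝ, (∀ v ∈ F, 0 ≤ w v) ∧
        ∑ v ∈ F, w v = 1 ∧ ∑ v ∈ F, w v • gridPoint n v = x} := by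
      refine convexHull_min ?_ ?_
      · rintro _ ⟨v, hv, rfl⟩
        refine ⟨fun u => if u = v then 1 else 0, fun u _ => ?_, ?_, ?_⟩
        · dsimp only
          split_ifs <;> norm_num
        · rw [Finset.sum_ite_eq' F v, if_pos (Finset.mem_coe.1 hv)]
        · simp only [ite_smul, one_smul, zero_smul]
          rw [Finset.sum_ite_eq' F v, if_pos (Finset.mem_coe.1 hv)]
      · rintro x ⟨w, hw, hw1, rfl⟩ y ⟨w', hw', hw1', rfl⟩ a b ha hb hab
        refine ⟨fun v => a * w v + b * w' v, fun v hv => ?_, ?_, ?_⟩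
        · exact add_nonneg (mul_nonneg ha (hw v hv)) (mul_nonneg hb (hw' v hv))
        · rw [Finset.sum_add_distrib, ← Finset.mul_sum, ← Finset.mul_sum, hw1, hw1', mul_one,
            mul_one, hab]
        · rw [Finset.smul_sum, Finset.smul_sum, ← Finset.sum_add_distrib]
          exact Finset.sum_congr rfl fun v _ => by rw [add_smul, mul_smul, mul_smul]
    exact hsub hx
  · rintro ⟨w, hw, hw1, rfl⟩
    exact (convex_gridHull F).sum_mem hw hw1 fun v hv => gridPoint_mem_gridHull hv

theorem mem_gridHull_of_support {F G : Finset (Fin d → ℕ)} {w : (Fin d → ℕ) → ℝ} (hGF : G ⊆ F)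
    (hw : ∀ v ∈ F, 0 ≤ w v) (hw1 : ∑ v ∈ F, w v = 1) (hG : ∀ v ∈ F, 0 < w v → v ∈ G) :
    ∑ v ∈ F, w v • gridPoint n v ∈ gridHull n G := by
  have h0 : ∀ v ∈ F, v ∉ G → w v = 0 := fun v hv hvG =>
    le_antisymm (not_lt.1 fun h => hvG (hG v hv h)) (hw v hv)
  rw [mem_gridHull_iff]
  refine ⟨w, fun v hv => hw v (hGF hv), ?_, ?_⟩
  · rw [← hw1]
    exact Finset.sum_subset hGF h0
  · exact Finset.sum_subset hGF fun v hv hvG => by rw [h0 v hv hvG, zero_smul]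

/-- A set of vertices of the cube with lowest vertex `k` that is a chain. -/
structure IsCubeChain (k : Fin d → ℕ) (F : Finset (Fin d → ℕ)) : Prop where
  cube : ∀ v ∈ F, ∀ j, v j = k j ∨ v j = k j + 1
  total : ∀ u ∈ F, ∀ v ∈ F, u ≤ v ∨ v ≤ u

open scoped Classical in
/-- A weight `θ` between those of the vertices above `v`, with `v` excluded or included, determines
the vertex `v`. -/
theorem IsCubeChain.eq_ceil (hn : 2 ≤ n) {k : Fin d → ℕ} {F : Finset (Fin d → ℕ)}
    (hF : IsCubeChain k F) {w : (Fin d → ℕ) → ℝ} (hw : ∀ v ∈ F, 0 ≤ w v)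
    (hw1 : ∑ v ∈ F, w v = 1) {v : Fin d → ℕ} (hv : v ∈ F) {θ : ℝ}
    (hθ : ∑ u ∈ F.filter (fun u => v < u), w u ≤ θ) (hθ' : θ < ∑ u ∈ F.filter (fun u => v ≤ u), w u)
    (j : Fin d) :
    (v j : ℤ) = ⌈(∑ u ∈ F, w u • gridPoint n u : EuclideanSpace ℝ (Fin d)) j / meshSize n - θ⌉ := by
  have hε := meshSize_pos hn
  have hfil : ∀ (P : (Fin d → ℕ) → Prop) [DecidablePred P], 0 ≤ ∑ u ∈ F.filter P, w u ∧
      ∑ u ∈ F.filter P, w u ≤ 1 := fun P _ =>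
    ⟨Finset.sum_nonneg fun u hu => hw u (Finset.mem_filter.1 hu).1, hw1 ▸
      Finset.sum_le_sum_of_subset_of_nonneg (Finset.filter_subset _ _) fun u hu _ => hw u hu⟩
  -- In units of the mesh size, coordinate `j` exceeds `k j` by the total weight of the vertices
  -- raised in direction `j`. In a chain, these lie strictly above `v` if `v` is not raised, and
  -- include all those above or equal to `v` if it is; comparison with `θ` decides.
  have hx : (∑ u ∈ F, w u • gridPoint n u : EuclideanSpace ℝ (Fin d)) j / meshSize n =
      k j + ∑ u ∈ F.filter (fun u => u j = k j + 1), w u := by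
    rw [div_eq_iff hε.ne', WithLp.ofLp_sum, Finset.sum_apply, Finset.sum_filter, add_mul]
    have h1 : (k j : ℝ) * meshSize n = ∑ u ∈ F, w u * (k j * meshSize n) := by
      rw [← Finset.sum_mul, hw1, one_mul]
    rw [h1, Finset.sum_mul, ← Finset.sum_add_distrib]
    refine Finset.sum_congr rfl fun u hu => ?_
    simp only [PiLp.smul_apply, smul_eq_mul, gridPoint_apply]
    rcases hF.cube u hu j with e | e
    · rw [e, if_neg (by omega)]; ring
    · rw [e, if_pos rfl]; push_cast; ring
  rw [hx]
  have hc := hfil fun u => u j = k j + 1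
  have hθ0 := (hfil fun u => v < u).1.trans hθ
  have hθ1 := hθ'.trans_le (hfil fun u => v ≤ u).2
  set c := ∑ u ∈ F.filter (fun u => u j = k j + 1), w u
  symm
  rw [Int.ceil_eq_iff]
  rcases hF.cube v hv j with e | e
  · have hle : c ≤ θ := by
      refine le_trans ?_ hθ
      refine Finset.sum_le_sum_of_subset_of_nonneg (fun u hu => ?_)
        fun u hu _ => hw u (Finset.mem_filter.1 hu).1
      rw [Finset.mem_filter] at hu ⊢
      refine ⟨hu.1, lt_of_le_not_ge ((hF.total v hv u hu.1).resolve_right fun h => ?_) fun h => ?_⟩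
        <;>
      · have : u j ≤ v j := h j
        have := hu.2
        omega
    rw [e]
    push_cast
    constructor <;> linarith
  · have hle : θ < c := by
      refine hθ'.trans_le ?_
      refine Finset.sum_le_sum_of_subset_of_nonneg (fun u hu => ?_)
        fun u hu _ => hw u (Finset.mem_filter.1 hu).1
      rw [Finset.mem_filter] at hu ⊢
      refine ⟨hu.1, ?_⟩
      have h1 : v j ≤ u j := hu.2 j
      have := hF.cube u hu.1 j
      omega
    rw [e]
    push_cast
    constructor <;> linarith

open scoped Classical in
theorem sum_filter_le_eq {F : Finset (Fin d → ℕ)} {w : (Fin d → ℕ) → ℝ} {v : Fin d → ℕ} (hv : v ∈ F) :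
    ∑ u ∈ F.filter (fun u => v ≤ u), w u = w v + ∑ u ∈ F.filter (fun u => v < u), w u := by
  have : F.filter (fun u => v ≤ u) = insert v (F.filter fun u => v < u) := by
    ext u
    simp only [Finset.mem_filter, Finset.mem_insert]
    constructor
    · rintro ⟨h1, h2⟩
      exact h2.eq_or_lt.imp (fun h => h.symm) fun h => ⟨h1, h⟩
    · rintro (rfl | h)
      · exact ⟨hv, le_rfl⟩
      · exact ⟨h.1, h.2.le⟩
  rw [this, Finset.sum_insert (by simp)]

open scoped Classical in
/-- The vertices with positive weight in a convex combination over a chain of vertices of a cube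
are determined by the point. -/
theorem IsCubeChain.support_iff (hn : 2 ≤ n) {k : Fin d → ℕ} {F : Finset (Fin d → ℕ)}
    (hF : IsCubeChain k F) {w : (Fin d → ℕ) → ℝ} (hw : ∀ v ∈ F, 0 ≤ w v)
    (hw1 : ∑ v ∈ F, w v = 1) (v : Fin d → ℕ) :
    (v ∈ F ∧ 0 < w v) ↔ ∃ θ : ℝ, 0 ≤ θ ∧ θ < 1 ∧ ∀ j, (v j : ℤ) =
      ⌈(∑ u ∈ F, w u • gridPoint n u : EuclideanSpace ℝ (Fin d)) j / meshSize n - θ⌉ := by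
  constructor
  · rintro ⟨hv, hvw⟩
    have hs := sum_filter_le_eq (w := w) hv
    refine ⟨∑ u ∈ F.filter (fun u => v < u), w u,
      Finset.sum_nonneg fun u hu => hw u (Finset.mem_filter.1 hu).1, ?_,
      hF.eq_ceil hn hw hw1 hv le_rfl (by linarith)⟩
    have : ∑ u ∈ F.filter (fun u => v ≤ u), w u ≤ 1 := hw1 ▸
      Finset.sum_le_sum_of_subset_of_nonneg (Finset.filter_subset _ _) fun u hu _ => hw u hu
    linarith
  · rintro ⟨θ, hθ0, hθ1, hθ⟩
    have hne : F.Nonempty := Finset.nonempty_of_sum_ne_zero (hw1 ▸ one_ne_zero)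
    obtain ⟨v₀, hv₀, hmin⟩ := F.exists_minimal hne
    have hv₀le : ∀ u ∈ F, v₀ ≤ u := fun u hu =>
      (hF.total v₀ hv₀ u hu).elim id fun h => hmin hu h
    set T := F.filter fun v => θ < ∑ u ∈ F.filter (fun u => v ≤ u), w u with hT
    have hv₀T : v₀ ∈ T := by
      rw [hT, Finset.mem_filter, Finset.filter_true_of_mem hv₀le, hw1]
      exact ⟨hv₀, hθ1⟩
    -- The highest vertex whose cumulated weight from above still exceeds `θ` satisfies the same
    -- ceiling formula as `v`, hence equals `v`.
    obtain ⟨u, huT, hmax⟩ := T.exists_maximal ⟨v₀, hv₀T⟩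
    obtain ⟨huF, huθ⟩ := Finset.mem_filter.1 huT
    have hlow : ∑ z ∈ F.filter (fun z => u < z), w z ≤ θ := by
      rcases (F.filter fun z => u < z).eq_empty_or_nonempty with h | h
      · rw [h, Finset.sum_empty]; exact hθ0
      · obtain ⟨m, hm, hm'⟩ := Finset.exists_minimal h
        obtain ⟨hmF, hum⟩ := Finset.mem_filter.1 hm
        have heq : F.filter (fun z => u < z) = F.filter fun z => m ≤ z := by
          ext z
          simp only [Finset.mem_filter]
          refine and_congr_right fun hz => ⟨fun h => ?_, fun h => hum.trans_le h⟩
          exact (hF.total m hmF z hz).elim id fun h' => hm' (Finset.mem_filter.2 ⟨hz, h⟩) h'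
        rw [heq]
        by_contra! hlt
        exact absurd (hmax (Finset.mem_filter.2 ⟨hmF, hlt⟩) hum.le) (not_le_of_gt hum)
    have huv : u = v := by
      ext j
      have h1 := hF.eq_ceil hn hw hw1 huF hlow huθ j
      have h2 := hθ j
      exact_mod_cast h1.trans h2.symm
    rw [← huv]
    have hs := sum_filter_le_eq (w := w) huF
    exact ⟨huF, by linarith⟩

/-- Two convex combinations with the same value have the same vertices with positive weight. -/
theorem IsCubeChain.mem_of_sum_eq (hn : 2 ≤ n) {k k' : Fin d → ℕ} {F G : Finset (Fin d → ℕ)}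
    (hF : IsCubeChain k F) (hG : IsCubeChain k' G) {w w' : (Fin d → ℕ) → ℝ}
    (hw : ∀ v ∈ F, 0 ≤ w v) (hw1 : ∑ v ∈ F, w v = 1) (hw' : ∀ v ∈ G, 0 ≤ w' v)
    (hw1' : ∑ v ∈ G, w' v = 1)
    (h : ∑ v ∈ F, w v • gridPoint n v = ∑ v ∈ G, w' v • gridPoint n v)
    {v : Fin d → ℕ} (hv : v ∈ F) (hvw : 0 < w v) : v ∈ G := by
  have h1 := (hF.support_iff hn hw hw1 v).1 ⟨hv, hvw⟩
  rw [h] at h1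
  exact ((hG.support_iff hn hw' hw1' v).2 h1).1

/-- The vertex number `m` of a Kuhn simplex. -/
def kuhnVertex (k : Fin d → ℕ) (π : Equiv.Perm (Fin d)) (m : ℕ) : Fin d → ℕ :=
  cubeVertex k (Finset.univ.filter fun j => m ≤ (π.symm j : ℕ))

theorem kuhnVertex_apply (k : Fin d → ℕ) (π : Equiv.Perm (Fin d)) (m : ℕ) (j : Fin d) :
    kuhnVertex k π m j = k j + if m ≤ (π.symm j : ℕ) then 1 else 0 := by
  simp [kuhnVertex, cubeVertex]

theorem mem_kuhnVertices {k : Fin d → ℕ} {π : Equiv.Perm (Fin d)} {v : Fin d → ℕ} :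
    v ∈ kuhnVertices k π ↔ ∃ m < d + 1, kuhnVertex k π m = v := by
  simp [kuhnVertices, kuhnVertex]

theorem card_kuhnVertices (k : Fin d → ℕ) (π : Equiv.Perm (Fin d)) :
    (kuhnVertices k π).card = d + 1 := by
  have hlt : ∀ m m', m < m' → m' < d + 1 → kuhnVertex k π m ≠ kuhnVertex k π m' := by
    intro m m' h h' heq
    have := congrFun heq (π ⟨m, by omega⟩)
    simp only [kuhnVertex_apply, Equiv.symm_apply_apply] at this
    rw [if_pos le_rfl, if_neg (by omega)] at this
    omega
  rw [kuhnVertices, Finset.card_image_of_injOn, Finset.card_range]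
  intro m hm m' hm' heq
  rw [Finset.coe_range, Set.mem_Iio] at hm hm'
  rcases lt_trichotomy m m' with h | h | h
  · exact absurd heq (hlt m m' h hm')
  · exact h
  · exact absurd heq.symm (hlt m' m h hm)

theorem isCubeChain_of_subset {k : Fin d → ℕ} {π : Equiv.Perm (Fin d)} {F : Finset (Fin d → ℕ)}
    (hF : F ⊆ kuhnVertices k π) : IsCubeChain k F := by
  refine ⟨fun v hv j => ?_, fun u hu v hv => ?_⟩
  · obtain ⟨m, -, rfl⟩ := mem_kuhnVertices.1 (hF hv)
    rw [kuhnVertex_apply]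
    split_ifs <;> omega
  · obtain ⟨m, -, rfl⟩ := mem_kuhnVertices.1 (hF hu)
    obtain ⟨m', -, rfl⟩ := mem_kuhnVertices.1 (hF hv)
    have key : ∀ m m', m ≤ m' → kuhnVertex k π m' ≤ kuhnVertex k π m := fun m m' h j => by
      change kuhnVertex k π m' j ≤ kuhnVertex k π m j
      rw [kuhnVertex_apply, kuhnVertex_apply]
      split_ifs <;> omega
    exact (le_total m m').symm.imp (key m' m) (key m m')

/-- A point of a grid cube lies in one of its Kuhn simplices. -/
theorem exists_mem_gridHull_kuhnVertices (hn : 2 ≤ n) {k : Fin d → ℕ}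
    {x : EuclideanSpace ℝ (Fin d)}
    (hx : ∀ j, k j * meshSize n ≤ x j ∧ x j ≤ (k j + 1) * meshSize n) :
    ∃ π, x ∈ gridHull n (kuhnVertices k π) := by
  have hε := meshSize_pos hn
  set y : Fin d → ℝ := fun j => x j / meshSize n - k j with hy
  have hy0 : ∀ j, 0 ≤ y j := fun j => sub_nonneg.2 ((le_div_iff₀ hε).2 (hx j).1)
  have hy1 : ∀ j, y j ≤ 1 := fun j => by
    have := (div_le_iff₀ hε).2 (hx j).2
    simp only [hy]
    linarith
  set π := Tuple.sort y
  have hmono : Monotone (y ∘ π) := Tuple.monotone_sort y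
  -- The sorted relative coordinates, preceded by `0` and followed by `1`. Vertex `m` gets weight `g
  -- (m + 1) - g m`; the sum over `m ≤ i` telescopes to coordinate `π i`.
  set g : ℕ → ℝ := fun m => if m = 0 then 0 else
    if h : m - 1 < d then y (π ⟨m - 1, h⟩) else 1 with hg
  have hgsucc : ∀ (m : ℕ) (h : m < d), g (m + 1) = y (π ⟨m, h⟩) := fun m h => by
    simp [hg, h]
  have hglast : g (d + 1) = 1 := by simp [hg]
  have hgstep : ∀ m, m < d + 1 → 0 ≤ g (m + 1) - g m := by
    intro m hm
    rw [sub_nonneg]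
    rcases Nat.eq_zero_or_pos m with rfl | h0
    · have : g 0 = 0 := by simp [hg]
      rw [this]
      by_cases h : 0 < d
      · rw [hgsucc 0 h]; exact hy0 _
      · obtain rfl : d = 0 := by omega
        rw [hglast]; norm_num
    · obtain ⟨l, rfl⟩ : ∃ l, m = l + 1 := ⟨m - 1, by omega⟩
      rw [hgsucc l (by omega)]
      by_cases h : l + 1 < d
      · rw [hgsucc (l + 1) h]
        exact hmono (show (⟨l, _⟩ : Fin d) ≤ ⟨l + 1, h⟩ from Nat.le_succ l)
      · obtain rfl : d = l + 1 := by omega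
        rw [hglast]; exact hy1 _
  refine ⟨π, ?_⟩
  have hsum : ∑ m ∈ Finset.range (d + 1), (g (m + 1) - g m) = 1 := by
    rw [Finset.sum_range_sub, hglast]
    simp [hg]
  have hxeq : x = ∑ m ∈ Finset.range (d + 1), (g (m + 1) - g m) •
      gridPoint n (kuhnVertex k π m) := by
    ext j
    rw [WithLp.ofLp_sum, Finset.sum_apply]
    simp only [PiLp.smul_apply, smul_eq_mul, gridPoint_apply, kuhnVertex_apply]
    have hi : ((π.symm j : Fin d) : ℕ) < d := (π.symm j).2
    have h1 : ∀ m, (g (m + 1) - g m) *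
        (((k j + if m ≤ ((π.symm j : Fin d) : ℕ) then 1 else 0 : ℕ) : ℝ) * meshSize n) =
        (g (m + 1) - g m) * (k j * meshSize n) +
          (if m < ((π.symm j : Fin d) : ℕ) + 1 then g (m + 1) - g m else 0) * meshSize n := by
      intro m
      by_cases h : m ≤ ((π.symm j : Fin d) : ℕ)
      · rw [if_pos h, if_pos (by omega)]; push_cast; ring
      · rw [if_neg h, if_neg (by omega)]; push_cast; ring
    simp only [h1]
    rw [Finset.sum_add_distrib, ← Finset.sum_mul, hsum, one_mul, ← Finset.sum_mul,
      ← Finset.sum_filter]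
    have h2 : (Finset.range (d + 1)).filter (fun m => m < ((π.symm j : Fin d) : ℕ) + 1) =
        Finset.range (((π.symm j : Fin d) : ℕ) + 1) := by
      ext m
      simp only [Finset.mem_filter, Finset.mem_range]
      omega
    rw [h2, Finset.sum_range_sub, hgsucc _ hi]
    have h3 : g 0 = 0 := by simp [hg]
    rw [h3, Fin.eta, Equiv.apply_symm_apply]
    simp only [hy]
    field_simp
    ring
  rw [hxeq]
  refine (convex_gridHull _).sum_mem (fun m hm => hgstep m (Finset.mem_range.1 hm)) hsum
    fun m hm => gridPoint_mem_gridHull (mem_kuhnVertices.2 ⟨m, Finset.mem_range.1 hm, rfl⟩)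

theorem isGridComplex_kuhn (hn : 2 ≤ n) : IsGridComplex n (gridKuhnFace (d := d) n) := by
  have hε := meshSize_pos hn
  refine ⟨?_, ?_, ?_, ?_, ?_, ?_, ?_, ?_, ?_, ?_⟩
  · intro x hx
    obtain ⟨C, hC, hxC⟩ := (isGridComplex_cube hn).cover x hx
    obtain ⟨k, lo, hi, hk, h, hcard, rfl⟩ := gridCubeFace_iff.1 hC
    have hall : ∀ j, lo j < hi j := by
      have : (Finset.univ.filter fun j => lo j < hi j) = Finset.univ := by
        rw [← Finset.card_eq_iff_eq_univ, hcard, Fintype.card_fin]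
      simpa [Finset.filter_eq_self] using this
    rw [mem_gridHull_Icc hn fun j => by have := h j; omega] at hxC
    obtain ⟨π, hπ⟩ := exists_mem_gridHull_kuhnVertices hn (k := k) (x := x) fun j => by
      have h1 := h j
      have h2 := hall j
      have h3 := hxC j
      rw [show lo j = k j by omega, show hi j = k j + 1 by omega] at h3
      push_cast at h3
      exact h3
    exact ⟨_, ⟨k, π, hk, subset_rfl, card_kuhnVertices k π⟩, hπ⟩
  · rintro i F ⟨k, π, -, -, hcard⟩
    rw [← Finset.card_pos]
    omega
  · rintro i F ⟨k, π, hk, hF, -⟩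
    refine ⟨k, hk, fun v hv j => ?_⟩
    have := (isCubeChain_of_subset hF).cube v hv j
    omega
  · rintro i F m G x ⟨k, π, hk, hF, -⟩ ⟨k', π', hk', hG, -⟩ hxF hxG
    have hFc := isCubeChain_of_subset hF
    have hGc := isCubeChain_of_subset hG
    obtain ⟨w, hw, hw1, rfl⟩ := mem_gridHull_iff.1 hxF
    obtain ⟨w', hw', hw1', heq⟩ := mem_gridHull_iff.1 hxG
    have hsub : F.filter (fun v => 0 < w v) ⊆ F := Finset.filter_subset _ _
    have hmem := mem_gridHull_of_support (n := n) hsub hw hw1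
      fun v hv h => Finset.mem_filter.2 ⟨hv, h⟩
    have hne : (F.filter fun v => 0 < w v).Nonempty := by
      by_contra hne
      rw [Finset.not_nonempty_iff_eq_empty.1 hne] at hmem
      simp [gridHull] at hmem
    refine ⟨(F.filter fun v => 0 < w v).card - 1, F.filter fun v => 0 < w v,
      ⟨k, π, hk, hsub.trans hF, ?_⟩, hsub, fun v hv => ?_, hmem⟩
    · have := hne.card_pos
      omega
    · obtain ⟨hvF, hvw⟩ := Finset.mem_filter.1 hv
      exact hFc.mem_of_sum_eq hn hGc hw hw1 hw' hw1' heq.symm hvF hvw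
  · rintro i F m G ⟨k, π, hk, hF, -⟩ ⟨k', π', hk', hG, -⟩ hGF
    have hFc := isCubeChain_of_subset hF
    have hGc := isCubeChain_of_subset hG
    refine ⟨gridHull_mono hGF, fun x hx y hy z hz hseg => ?_⟩
    obtain ⟨u, v, hu, hv, huv, rfl⟩ := hseg
    obtain ⟨w, hw, hw1, rfl⟩ := mem_gridHull_iff.1 hx
    obtain ⟨w', hw', hw1', rfl⟩ := mem_gridHull_iff.1 hy
    obtain ⟨κ, hκ, hκ1, heq⟩ := mem_gridHull_iff.1 hz
    -- A vertex of positive weight in `x` keeps positive weight in the combination; as the support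
    -- depends only on the point, it lies in `G`.
    refine mem_gridHull_of_support hGF hw hw1 fun p hp hpw => ?_
    refine hFc.mem_of_sum_eq hn hGc (w := fun p => u * w p + v * w' p)
      (fun p hp => add_nonneg (mul_nonneg hu.le (hw p hp)) (mul_nonneg hv.le (hw' p hp)))
      ?_ hκ hκ1 ?_ hp (add_pos_of_pos_of_nonneg (mul_pos hu hpw) (mul_nonneg hv.le (hw' p hp)))
    · rw [Finset.sum_add_distrib, ← Finset.mul_sum, ← Finset.mul_sum, hw1, hw1', mul_one,
        mul_one, huv]
    · rw [heq, Finset.smul_sum, Finset.smul_sum, ← Finset.sum_add_distrib]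
      exact Finset.sum_congr rfl fun p _ => by rw [add_smul, mul_smul, mul_smul]
  · rintro i F x ⟨k, π, hk, hF, -⟩ hx hmin b hb
    obtain ⟨w, hw, hw1, rfl⟩ := mem_gridHull_iff.1 hx
    obtain ⟨w', hw', hw1', rfl⟩ := mem_gridHull_iff.1 hb
    have hpos : ∀ v ∈ F, 0 < w v := by
      intro v hv
      by_contra hv0
      have hmem := mem_gridHull_of_support (n := n) (F.erase_subset v) hw hw1
        fun u hu huw => Finset.mem_erase.2 ⟨fun h => hv0 (h ▸ huw), hu⟩
      have hne : (F.erase v).Nonempty := by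
        by_contra hne
        rw [Finset.not_nonempty_iff_eq_empty.1 hne] at hmem
        simp [gridHull] at hmem
      refine hmin ((F.erase v).card - 1) (F.erase v)
        ⟨k, π, hk, (F.erase_subset v).trans hF, ?_⟩ (Finset.erase_ssubset hv) hmem
      have := hne.card_pos
      omega
    have hne : F.Nonempty := Finset.nonempty_of_sum_ne_zero (hw1 ▸ one_ne_zero)
    obtain ⟨v₀, hv₀, hle⟩ := F.exists_min_image w hne
    -- With the smallest weight as parameter, the new weights are at least `w v - w v₀ ≥ 0`, because
    -- `w' v ≤ 1`.
    refine ⟨w v₀, hpos v₀ hv₀, mem_gridHull_iff.2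
      ⟨fun v => w v + w v₀ * (w v - w' v), fun v hv => ?_, ?_, ?_⟩⟩
    · have h1 : w' v ≤ 1 := hw1' ▸ Finset.single_le_sum hw' hv
      nlinarith [hle v hv, hpos v hv, hpos v₀ hv₀]
    · rw [Finset.sum_add_distrib, ← Finset.mul_sum, Finset.sum_sub_distrib, hw1, hw1']
      ring
    · rw [← Finset.sum_sub_distrib, Finset.smul_sum, ← Finset.sum_add_distrib]
      exact Finset.sum_congr rfl fun v _ => by module
  · rintro i F m G ⟨k, π, hk, hF, hFc⟩ ⟨k', π', hk', hG, hGc⟩ hGF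
    have := Finset.card_le_card hGF
    exact ⟨by omega, fun h => Finset.eq_of_subset_of_card_le hGF (by omega)⟩
  · rintro i F m G ⟨k, π, hk, hF, hFc⟩ ⟨k', π', hk', hG, hGc⟩ hGF hmi
    obtain ⟨H, hGH, hHF, hH⟩ := Finset.exists_subsuperset_card_eq hGF
      (show G.card ≤ m + 1 + 1 by omega) (by omega)
    exact ⟨H, ⟨k, π, hk, hHF.trans hF, hH⟩, hGH, hHF⟩
  -- Any two vertices of a simplex span an edge.
  · rintro i F s ⟨k, π, hk, hF, -⟩ - ⟨v, hv, hv1⟩ ⟨u, hu, hu1⟩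
    refine ⟨u, hu, v, hv, ⟨k, π, hk, fun z hz => ?_, Finset.card_pair ?_⟩, hu1, hv1⟩
    · rcases Finset.mem_insert.1 hz with rfl | hz
      · exact hF hu
      · rw [Finset.mem_singleton.1 hz]; exact hF hv
    · rintro rfl
      rw [hv1] at hu1
      exact absurd hu1 (by decide)
  · rintro i F m G s ⟨k, π, hk, hF, -⟩ - hGF hs ⟨v, hv, hv1⟩ ⟨u, hu, hu1⟩
    have hpair : ∀ a ∈ F, ∀ b ∈ F, s a = -1 → s b = 1 → gridKuhnFace n 1 {a, b} := by
      intro a ha b hb ha1 hb1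
      refine ⟨k, π, hk, fun z hz => ?_, Finset.card_pair ?_⟩
      · rcases Finset.mem_insert.1 hz with rfl | hz
        · exact hF ha
        · rw [Finset.mem_singleton.1 hz]; exact hF hb
      · rintro rfl
        rw [hb1] at ha1
        exact absurd ha1 (by decide)
    obtain ⟨z, hz, hzG⟩ := Finset.exists_of_ssubset hGF
    rcases hs z hz with h | h
    · exact ⟨u, hu, z, hz, hpair u hu z hz hu1 h, hu1, h, Or.inr hzG⟩
    · exact ⟨z, hz, v, hv, hpair z hz v hv h hv1, h, hv1, Or.inl hzG⟩

end KuhnComplex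

/-! ### From the interface of the complex to the resistars -/

section Resistars

variable {d : ℕ} {lab : EuclideanSpace ℝ (Fin d) → SignType} {n q : ℕ}
  {face loc : ℕ → Finset (Fin d → ℕ) → Prop}

/-- Resistars refer to the faces of a single cell (`loc`), the complex to those of all cells
(`face`); the two agree on subsets of a cell. -/
theorem boundaryPoints_congr {C F : Finset (Fin d → ℕ)}
    (h : ∀ i G, G ⊆ C → (face i G ↔ loc i G)) (hF : F ⊆ C) :
    boundaryPoints lab n q face F = boundaryPoints lab n q loc F := by
  ext x
  rw [mem_boundaryPoints, mem_boundaryPoints]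
  refine exists_congr fun a => and_congr_right fun ha => exists_congr fun b =>
    and_congr_right fun hb => and_congr_left fun _ => h 1 _ fun z hz => hF ?_
  rcases Finset.mem_insert.1 hz with rfl | hz
  · exact ha
  · rwa [Finset.mem_singleton.1 hz]

theorem boundaryPoints_mono {F G : Finset (Fin d → ℕ)} (h : G ⊆ F) :
    boundaryPoints lab n q face G ⊆ boundaryPoints lab n q face F := fun x hx => by
  obtain ⟨a, ha, b, hb, hab⟩ := mem_boundaryPoints.1 hx
  exact mem_boundaryPoints.2 ⟨a, h ha, b, h hb, hab⟩

theorem subset_of_chain {Φ : ℕ → Finset (Fin d → ℕ)} {i : ℕ}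
    (h : ∀ m, 1 ≤ m → m < i → Φ m ⊆ Φ (m + 1)) {m l : ℕ} (hm : 1 ≤ m) (hml : m ≤ l)
    (hl : l ≤ i) : Φ m ⊆ Φ l := by
  induction l, hml using Nat.le_induction with
  | base => exact subset_rfl
  | succ l hml ih => exact (ih (by omega)).trans (h l (hm.trans hml) (by omega))

/-- The interface in a cell is part of its resistar. -/
theorem ZeroCone.mem_cellResistar (hc : IsGridComplex n face)
    (hlab : ∀ v, IsGridVertex n v → lab (gridPoint n v) = 1 ∨ lab (gridPoint n v) = -1)
    {C : Finset (Fin d → ℕ)} (hC : face d C) (hloc : ∀ i G, G ⊆ C → (face i G ↔ loc i G))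
    {x : EuclideanSpace ℝ (Fin d)} (hx : ZeroCone lab n q face C x) :
    x ∈ cellResistar lab n q loc := by
  obtain ⟨Φ, hΦ, hxΦ⟩ := hx.exists_flag hc hlab hC
  have hsub : ∀ m, 1 ≤ m → m ≤ d → Φ m ⊆ C := fun m hm hmd => by
    rw [← hΦ.top]
    exact subset_of_chain hΦ.subset hm hmd le_rfl
  refine ⟨Φ, fun m hm hmd => (hloc m _ (hsub m hm hmd)).1 (hΦ.face_le m hm hmd), hΦ.subset, ?_, ?_⟩
  · rw [← boundaryPoints_congr hloc (hsub 1 le_rfl hΦ.one_le)]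
    exact hΦ.nonempty
  · convert hxΦ using 2
    refine Set.image_congr fun m hm => ?_
    rw [center, boundaryPoints_congr hloc (hsub m hm.1 hm.2)]

/-- The resistar of a cell lies in the convex hull of the boundary points. -/
theorem exists_mem_convexHull_of_mem_cellResistar (hd : 1 ≤ d)
    (hloc : ∀ C i G, loc d C → G ⊆ C → (face i G ↔ loc i G))
    {x : EuclideanSpace ℝ (Fin d)} (hx : x ∈ cellResistar lab n q loc) :
    ∃ C, face d C ∧
      x ∈ convexHull ℝ (boundaryPoints lab n q face C : Set (EuclideanSpace ℝ (Fin d))) := by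
  obtain ⟨Φ, hΦ, hsub, hne, hx⟩ := hx
  have hC := hΦ d hd le_rfl
  refine ⟨Φ d, (hloc _ d _ hC subset_rfl).2 hC, ?_⟩
  rw [boundaryPoints_congr (fun i G => hloc _ i G hC) subset_rfl]
  refine convexHull_min ?_ (convex_convexHull ℝ _) hx
  rintro _ ⟨m, hm, rfl⟩
  refine convexHull_mono ?_ (barycentre_mem_convexHull
    (hne.mono (boundaryPoints_mono (subset_of_chain hsub le_rfl hm.1 hm.2))))
  exact_mod_cast boundaryPoints_mono (subset_of_chain hsub hm.1 hm.2 le_rfl)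

theorem gridCubeFace_iff_isCubeFace {k : Fin d → ℕ} (hk : IsGridCube n k) {m : ℕ}
    {C : Finset (Fin d → ℕ)} (hC : IsCubeFace k m C) (i : ℕ) (G : Finset (Fin d → ℕ))
    (hGC : G ⊆ C) : gridCubeFace n i G ↔ IsCubeFace k i G := by
  refine ⟨fun hG => ?_, fun hG => ⟨k, hk, hG⟩⟩
  obtain ⟨lo, hi, h, -, rfl⟩ := isCubeFace_iff.1 hC
  obtain ⟨k', lo', hi', -, h', hcard, rfl⟩ := gridCubeFace_iff.1 hG
  have h1 := mem_Icc_pi.1 (hGC (mem_Icc_pi.2 fun j => ⟨le_rfl, (h' j).2.1⟩))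
  have h2 := mem_Icc_pi.1 (hGC (mem_Icc_pi.2 fun j => ⟨(h' j).2.1, le_rfl⟩))
  refine isCubeFace_iff.2 ⟨lo', hi', fun j => ?_, hcard, rfl⟩
  have := h j
  have := h1 j
  have := h2 j
  have := h' j
  omega

theorem gridKuhnFace_iff_isKuhnFace {k : Fin d → ℕ} {π : Equiv.Perm (Fin d)}
    (hk : IsGridCube n k) {m : ℕ} {C : Finset (Fin d → ℕ)} (hC : IsKuhnFace k π m C) (i : ℕ)
    (G : Finset (Fin d → ℕ)) (hGC : G ⊆ C) : gridKuhnFace n i G ↔ IsKuhnFace k π i G := by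
  refine ⟨fun ⟨_, _, _, _, hcard⟩ => ⟨hGC.trans hC.1, hcard⟩, fun hG => ⟨k, π, hk, hG⟩⟩

/-- Since `√i ≤ √2 * i`, the reach exceeds the diameter `√i ε`. Taking `r₀ / 2` instead of `r₀`
leaves room for `s < R` strictly below the reach, even if the reach is exactly `r₀`. -/
theorem tracesReach_of_lt_reach {M : Set (EuclideanSpace ℝ (Fin d))} {r₀ : ℝ} (hr₀ : 0 < r₀)
    (hn : 2 ≤ n)
    (h₀ : ∀ (i : ℕ) (F : Set (EuclideanSpace ℝ (Fin d))), 1 ≤ i → IsFaceOfUnitCube i F →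
      ENNReal.ofReal r₀ ≤ reach (M ∩ F))
    (h : ∀ (i : ℕ) (F : Set (EuclideanSpace ℝ (Fin d))), 1 ≤ i → IsFaceOfUnitCube i F →
      ENNReal.ofReal (√2 * i * meshSize n) < reach (M ∩ F)) :
    TracesReach M n r₀ := by
  intro J a hJ ha
  have hF : IsFaceOfUnitCube J.card (cubeFace J a) := ⟨J, a, rfl, ha, rfl⟩
  have h1 := h₀ _ _ hJ hF
  have h2 := h _ _ hJ hF
  have hε := meshSize_pos hn
  have h3 : √(J.card : ℝ) ≤ √2 * J.card := by
    have h4 : √(J.card : ℝ) ≤ J.card := by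
      rw [Real.sqrt_le_left (Nat.cast_nonneg _)]
      exact_mod_cast Nat.le_self_pow two_ne_zero _
    have h5 : (1 : ℝ) ≤ √2 := Real.one_le_sqrt.2 (by norm_num)
    have h6 : (0 : ℝ) ≤ J.card := Nat.cast_nonneg _
    nlinarith
  have hlt : ENNReal.ofReal (max (√J.card * meshSize n) (r₀ / 2)) < reach (M ∩ cubeFace J a) := by
    rcases max_choice (√(J.card : ℝ) * meshSize n) (r₀ / 2) with e | e <;> rw [e]
    · exact (ENNReal.ofReal_le_ofReal (mul_le_mul_of_nonneg_right h3 hε.le)).trans_lt h2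
    · exact ((ENNReal.ofReal_lt_ofReal_iff hr₀).2 (by linarith)).trans_le h1
  obtain ⟨s, hs0, hs, hsr⟩ := ENNReal.lt_iff_exists_real_btwn.1 hlt
  obtain ⟨R, hR0, hR, hRr⟩ := ENNReal.lt_iff_exists_real_btwn.1 hsr
  have hs' := (ENNReal.ofReal_lt_ofReal_iff_of_nonneg (by positivity)).1 hs
  exact ⟨s, R, (le_max_left _ _).trans_lt hs', (le_max_right _ _).trans hs'.le,
    (ENNReal.ofReal_lt_ofReal_iff_of_nonneg hs0).1 hR,
    fun hne => uniqueNearest_of_lt_reach hne hRr⟩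

end Resistars

/-! ### The theorem -/

/-- The constant `C` depends only on a positive lower bound `r₀` of the reaches of `M` and of its
traces on the faces of the cube; in particular it does not depend on the dimension `d`. -/
theorem theorem1 (r₀ : ℝ) (hr₀ : 0 < r₀) :
    ∃ C : ℝ, ∀ (d : ℕ), 1 ≤ d →
      ∀ (M : Set (EuclideanSpace ℝ (Fin d))) (lab : EuclideanSpace ℝ (Fin d) → SignType),
        IsTopManifold (d - 1) M → Splits M lab →
        ENNReal.ofReal r₀ ≤ reach M →
        (∀ (i : ℕ) (F : Set (EuclideanSpace ℝ (Fin d))), 1 ≤ i → IsFaceOfUnitCube i F →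
          IsTopManifold (i - 1) (M ∩ F) ∧ ENNReal.ofReal r₀ ≤ reach (M ∩ F)) →
        ∀ (n q : ℕ), 2 ≤ n →
          (∀ v : Fin d → ℕ, IsGridVertex n v → gridPoint n v ∉ M) →
          ENNReal.ofReal (√2 * d * meshSize n) < reach M →
          (∀ (i : ℕ) (F : Set (EuclideanSpace ℝ (Fin d))), 1 ≤ i → IsFaceOfUnitCube i F →
            ENNReal.ofReal (√2 * i * meshSize n) < reach (M ∩ F)) →
          -Real.logb 2 (meshSize n) ≤ (q : ℝ) →
          Metric.hausdorffEDist M (cResistar lab n q)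
              ≤ ENNReal.ofReal (C * d * meshSize n ^ 2) ∧
            Metric.hausdorffEDist M (kResistar lab n q)
              ≤ ENNReal.ofReal (C * d * meshSize n ^ 2) := by
  refine ⟨2 * (4 / r₀ + 1 / 2), fun d hd M lab _ hsp _ hF n q hn hgrid _ hFε hq => ?_⟩
  have hlab : ∀ v, IsGridVertex n v → lab (gridPoint n v) = 1 ∨ lab (gridPoint n v) = -1 := by
    intro v hv
    have h0 : lab (gridPoint n v) ≠ 0 := fun h =>
      hgrid v hv ((hsp.zero_iff _ (gridPoint_mem_unitCube hn hv)).1 h)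
    revert h0
    cases lab (gridPoint n v) <;> decide
  have hM : TracesReach M n r₀ :=
    tracesReach_of_lt_reach hr₀ hn (fun i F hi h => (hF i F hi h).2) hFε
  have hbound : 2 * (4 / r₀ + 1 / 2) * d * meshSize n ^ 2 = 2 * traceBound r₀ n d := by
    rw [traceBound]; ring
  rw [hbound]
  constructor
  · refine (isGridComplex_cube hn).hausdorffEDist_le hd hn hsp hlab hq hr₀ hM
      (fun C z hC hz => ?_) fun z hz => ?_
    · obtain ⟨k, hk, hkC⟩ := hC
      exact Set.mem_iUnion₂.2 ⟨k, hk, hz.mem_cellResistar (isGridComplex_cube hn) hlab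
        ⟨k, hk, hkC⟩ (gridCubeFace_iff_isCubeFace hk hkC)⟩
    · obtain ⟨k, hk, hz⟩ := Set.mem_iUnion₂.1 hz
      exact exists_mem_convexHull_of_mem_cellResistar hd
        (fun C i G hC => gridCubeFace_iff_isCubeFace hk hC i G) hz
  · refine (isGridComplex_kuhn hn).hausdorffEDist_le hd hn hsp hlab hq hr₀ hM
      (fun C z hC hz => ?_) fun z hz => ?_
    · obtain ⟨k, π, hk, hkC⟩ := hC
      exact Set.mem_iUnion₂.2 ⟨k, hk, Set.mem_iUnion.2 ⟨π,
        hz.mem_cellResistar (isGridComplex_kuhn hn) hlab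
          ⟨k, π, hk, hkC⟩ (gridKuhnFace_iff_isKuhnFace hk hkC)⟩⟩
    · obtain ⟨k, hk, hz⟩ := Set.mem_iUnion₂.1 hz
      obtain ⟨π, hz⟩ := Set.mem_iUnion.1 hz
      exact exists_mem_convexHull_of_mem_cellResistar hd
        (fun C i G hC => gridKuhnFace_iff_isKuhnFace hk hC i G) hz
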